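/- A tournament is a loopless directed graph in which any two distinct vertices are joined by exactly one of the two possible edges. A set of vertices is transitive if the subtournament induced by it has no directed cycle; a colouring of a tournament $T$ with $k$ colours is a partition of its vertex set into $k$ (possibly empty) transitive sets; $T$ is $H$-free if no subtournament of $T$ is isomorphic to $H$. A tournament $H$ is prime if it has no set $S \ne V(H)$ with $|S| > 1$ such that every vertex outside $S$ is adjacent to all of $S$ or adjacent from all of $S$. Given an ordering of $V(H)$, an edge is backward if its head precedes its tail; $H$ is a galaxy if there is an ordering such that every connected component of the undirected graph of backward edges is a single vertex or a star $K_{1,t}$ ($t \ge 1$) whose center comes before all its leaves or after all its leaves, and such that no center of a star lies between two leaves of another star (for $t=1$ either vertex may be chosen as the center). Write $|H|$ for the number of vertices of $H$; logarithms are natural. Theorem. There are absolute constants $C, K > 0$ such that for every prime galaxy $H$ with $|H| \ge 2$ there is an algorithm, running in quasipolynomial time $2^{(\log n)^{O(1)}}$ (where the $O(1)$ may depend on $H$), which, given the adjacency matrix of an $n$-vertex $H$-free tournament $T$, outputs a colouring of $T$, with at most $$K\, n^{1-\frac{C}{|H|^{5}\log |H|}}\,\log n$$ colours if $n \ge 2$.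 -/

import Mathlib

/-! ### Tournaments -/

namespace Digraph

/-- A tournament: no loops, and for any two distinct vertices exactly one of the two possible
edges is present. -/
def IsTournament {V : Type*} (G : Digraph V) : Prop :=
  (∀ v, ¬ G.Adj v v) ∧ ∀ v w, v ≠ w → Xor (G.Adj v w) (G.Adj w v)

/-- `T` is `H`-free: `T` has no induced subgraph isomorphic to `H`. -/
def IsFree {V W : Type*} (T : Digraph W) (H : Digraph V) : Prop :=
  ¬ ∃ f : V → W, Function.Injective f ∧ ∀ v w, H.Adj v w ↔ T.Adj (f v) (f w)

/-- The vertex set `S` is transitive: the subgraph induced by `S` has no directed cycle, i.e. no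
vertex can be reached from itself by a nonempty directed walk inside `S`. -/
def IsTransitiveSet {V : Type*} (T : Digraph V) (S : Set V) : Prop :=
  ∀ v, ¬ Relation.TransGen (fun a b => a ∈ S ∧ b ∈ S ∧ T.Adj a b) v v

/-- A homogeneous set: every vertex outside `S` is adjacent to all of `S`, or adjacent from all
of `S`. -/
def IsHomogeneous {V : Type*} (H : Digraph V) (S : Set V) : Prop :=
  ∀ v, v ∉ S → (∀ w ∈ S, H.Adj w v) ∨ (∀ w ∈ S, H.Adj v w)

/-- `H` is prime: it has no homogeneous set with more than one vertex other than the set of all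
vertices. -/
def IsPrime {V : Type*} (H : Digraph V) : Prop :=
  ¬ ∃ S : Set V, H.IsHomogeneous S ∧ S.Nontrivial ∧ S ≠ Set.univ

/-- The graph of backward edges of `H` under the ordering `θ`; the edge from `v` to `w` is
backward if `w` precedes `v`. -/
def backwardGraph {V : Type*} [Fintype V] (H : Digraph V) (θ : V ≃ Fin (Fintype.card V)) :
    SimpleGraph V where
  Adj v w := (H.Adj v w ∧ θ w < θ v) ∨ (H.Adj w v ∧ θ v < θ w)
  symm := ⟨fun _ _ h => h.symm⟩
  loopless := ⟨fun v h => by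
    rcases h with h | h <;> exact lt_irrefl _ h.2⟩

/-- The set `s` induces in the graph of backward edges a star `K_{1,t}`, `t ≥ 1`, with center
`z`, and `z` comes before all the leaves (a left star) or after all of them (a right star). -/
def IsStarAt {V : Type*} [Fintype V] (H : Digraph V) (θ : V ≃ Fin (Fintype.card V))
    (s : Set V) (z : V) : Prop :=
  z ∈ s ∧ s.Nontrivial ∧
  (∀ v ∈ s, ∀ w ∈ s, (H.backwardGraph θ).Adj v w ↔ (v ≠ w ∧ (v = z ∨ w = z))) ∧
  ((∀ l ∈ s, l ≠ z → θ z < θ l) ∨ (∀ l ∈ s, l ≠ z → θ l < θ z))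

/-- `θ` is a galaxy ordering of `H`: every connected component of the graph of backward edges is
a singleton or a star, and, for some choice of the centers (which is a real choice only for
stars with two vertices), no center of a star is between two leaves of another star. -/
def IsGalaxyOrdering {V : Type*} [Fintype V] (H : Digraph V)
    (θ : V ≃ Fin (Fintype.card V)) : Prop :=
  ∃ center : (H.backwardGraph θ).ConnectedComponent → V,
    (∀ c, (∃ v, c.supp = {v}) ∨ H.IsStarAt θ c.supp (center c)) ∧
    ∀ c c', c ≠ c' → c.supp.Nontrivial → c'.supp.Nontrivial →
      ∀ l ∈ c'.supp, ∀ l' ∈ c'.supp, l ≠ center c' → l' ≠ center c' →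
        ¬ (θ l < θ (center c) ∧ θ (center c) < θ l')

/-- A galaxy is a tournament that has a galaxy ordering. -/
def IsGalaxy {V : Type*} [Fintype V] (H : Digraph V) : Prop :=
  H.IsTournament ∧ ∃ θ : V ≃ Fin (Fintype.card V), H.IsGalaxyOrdering θ

/-- A colouring of `T` with the `k` colours `Fin k`: every colour class is a transitive set. -/
def IsColoring {V : Type*} (T : Digraph V) {k : ℕ} (c : V → Fin k) : Prop :=
  ∀ i : Fin k, T.IsTransitiveSet {v | c v = i}

end Digraph

/-! ### The model of computation: first-order pure LISP

Data are S-expressions over the single atom `nil`. A program is a finite list of mutually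
recursive one-argument functions. The only primitives are `nil`, `cons`, `head`, `tail`, the test
for `nil`, local definitions and calls. The running time is the number of evaluation steps.
With S-expressions stored as pointers to cells, each step is a constant number of operations on
pointers (the length of the program being constant), and at most one cell is allocated per step:
this is a pointer machine with unit cost, which is polynomially equivalent to Turing machines. -/

/-- S-expressions over the single atom `nil`. -/
inductive SExp : Type where
  | nil : SExp
  | cons : SExp → SExp → SExp

namespace SExp

/-- The first component of a pair; `nil` has first component `nil`. -/
def head : SExp → SExp
  | nil => nil
  | cons a _ => a

/-- The second component of a pair; `nil` has second component `nil`. -/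
def tail : SExp → SExp
  | nil => nil
  | cons _ b => b

/-- Lists of S-expressions as S-expressions. -/
def ofList : List SExp → SExp
  | [] => nil
  | a :: l => cons a (ofList l)

/-- Natural numbers in unary: `m` is the list of `m` atoms. -/
def ofNat (m : ℕ) : SExp := ofList (List.replicate m nil)

/-- Bits: `0` is `nil`, `1` is the pair of two atoms. -/
def ofBool : Bool → SExp
  | false => nil
  | true => cons nil nil

end SExp

/-- Expressions of the language. `var i` is the `i`-th innermost variable; `ite e e₁ e₂` is `e₁` if
`e` is a pair and `e₂` if `e` is `nil`; `letE e e'` binds the value of `e` as the new innermost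
variable in `e'`; `call f e` calls the `f`-th function of the program with the value of `e`. -/
inductive LispExp : Type where
  | var : ℕ → LispExp
  | nil : LispExp
  | cons : LispExp → LispExp → LispExp
  | head : LispExp → LispExp
  | tail : LispExp → LispExp
  | ite : LispExp → LispExp → LispExp → LispExp
  | letE : LispExp → LispExp → LispExp
  | call : ℕ → LispExp → LispExp

/-- A program: the list of the bodies of its functions. Function `0` is the main function. -/
abbrev LispProgram : Type := List LispExp

/-- The body of the `f`-th function (a function that is not in the list returns `nil`). -/
def LispProgram.body (P : LispProgram) (f : ℕ) : LispExp := P.getD f LispExp.nil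

/-- `LispEval P env e v t`: in the program `P`, with the values `env` of the variables (a variable
that is out of range has value `nil`), the evaluation of `e` (call by value) terminates with value
`v` after exactly `t` steps. The body of a called function sees only its argument. -/
inductive LispEval (P : LispProgram) : List SExp → LispExp → SExp → ℕ → Prop where
  | var (env : List SExp) (i : ℕ) :
      LispEval P env (.var i) (env.getD i SExp.nil) 1
  | nil (env : List SExp) :
      LispEval P env .nil SExp.nil 1
  | cons {env : List SExp} {e₁ e₂ : LispExp} {v₁ v₂ : SExp} {t₁ t₂ : ℕ} :
      LispEval P env e₁ v₁ t₁ → LispEval P env e₂ v₂ t₂ →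
      LispEval P env (.cons e₁ e₂) (SExp.cons v₁ v₂) (t₁ + t₂ + 1)
  | head {env : List SExp} {e : LispExp} {v : SExp} {t : ℕ} :
      LispEval P env e v t → LispEval P env (.head e) v.head (t + 1)
  | tail {env : List SExp} {e : LispExp} {v : SExp} {t : ℕ} :
      LispEval P env e v t → LispEval P env (.tail e) v.tail (t + 1)
  | ite_cons {env : List SExp} {e e₁ e₂ : LispExp} {a b v : SExp} {t t₁ : ℕ} :
      LispEval P env e (SExp.cons a b) t → LispEval P env e₁ v t₁ →
      LispEval P env (.ite e e₁ e₂) v (t + t₁ + 1)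
  | ite_nil {env : List SExp} {e e₁ e₂ : LispExp} {v : SExp} {t t₂ : ℕ} :
      LispEval P env e SExp.nil t → LispEval P env e₂ v t₂ →
      LispEval P env (.ite e e₁ e₂) v (t + t₂ + 1)
  | letE {env : List SExp} {e e' : LispExp} {v w : SExp} {t t' : ℕ} :
      LispEval P env e v t → LispEval P (v :: env) e' w t' →
      LispEval P env (.letE e e') w (t + t' + 1)
  | call {env : List SExp} {f : ℕ} {e : LispExp} {v w : SExp} {t t' : ℕ} :
      LispEval P env e v t → LispEval P [v] (P.body f) w t' →
      LispEval P env (.call f e) w (t + t' + 1)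

/-- On input `x` the main function of `P` terminates with output `y` after exactly `t` steps. -/
def LispProgram.Outputs (P : LispProgram) (x y : SExp) (t : ℕ) : Prop :=
  LispEval P [x] (P.body 0) y t

open Classical in
/-- The input: the adjacency matrix of `T`, as a list of `n` rows of `n` bits. -/
noncomputable def encodeDigraph {n : ℕ} (T : Digraph (Fin n)) : SExp :=
  SExp.ofList (List.ofFn fun i : Fin n =>
    SExp.ofList (List.ofFn fun j : Fin n => SExp.ofBool (decide (T.Adj i j))))

/-- The output: the list of the colours of the vertices `0, …, n - 1`. -/
def encodeColoring {n k : ℕ} (c : Fin n → Fin k) : SExp :=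
  SExp.ofList (List.ofFn fun i : Fin n => SExp.ofNat (c i : ℕ))

/-- Quasipolynomial growth, `2 ^ ((log n) ^ O(1))`. -/
def IsQuasipolynomial (t : ℕ → ℕ) : Prop :=
  ∃ a : ℕ, ∀ n : ℕ, t n ≤ 2 ^ (a * (Nat.log 2 n + 1) ^ a)

/-! Write h for the number of vertices of `H`. The heart is that every nonempty `H`-free tournament
on m vertices has a transitive set of at least m^ε vertices, ε = 1/(1000 h^5 log h), and that a
search finds one. Removing such sets greedily leaves at most n^(1-ε)/(1-ε) colour classes.

Existence goes by induction on the number n of vertices. A failed greedy embedding of `H` yields two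
sets of proportional size with few edges from the second back to the first (`exists_sparse_pair`).
Iteration gives 2h+1 blocks in order, each a fraction of n depending only on h
(`exists_block_family`). A star center of the galaxy receives a whole block; every other vertex
receives a piece of a transitive set that the induction provides inside a block. The leaves of a
star share a block, because no center separates them, so their pieces are in order. Now `H` is
embedded star by star, with star edges backward and all other edges forward. Forward edges are
abundant, so the embedding can fail only at a star edge: then a large part A of a center's block is
complete to or from most of a leaf's piece C (`exists_complete_pair`). A transitive set in A has
about (n/G)^ε vertices with G = `totalLoss h`, and C has a fixed fraction of this size. As G^ε ≤ 1 +
1/(8h), adding C makes up for the loss (`exists_chain_rpow`).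

The algorithm need not know which choices succeed. Every set in the argument arises from the input
by a number of operations of `derived` that depends only on h, so trying all of them for
`searchDepth h` rounds meets the right sets; `Reach` keeps track of this. There are polynomially
many lists, and recursive calls halve the input, so the time is n^(O(log n)) (`runs_find`). The rest
checks that a concrete program performs this search within that time. -/

/-! ### The search -/

namespace Digraph

section Search

variable {α : Type*} (T : Digraph α) [DecidableRel T.Adj]

/-- The vertices in `X` with at least `|W|` out-neighbours in `Y`. -/
def manyOut (X Y W : List α) : List α :=
  X.filter fun v => W.length ≤ (Y.filter fun y => T.Adj v y).length

/-- The vertices in `X` with at least `|W|` in-neighbours in `Y`. -/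
def manyIn (X Y W : List α) : List α :=
  X.filter fun v => W.length ≤ (Y.filter fun y => T.Adj y v).length

/-- The vertex lists that the search derives from `X`, `Y`, `W`; `F` is the recursive call. -/
def derived (F : List α → List α) (X Y W : List α) : List (List α) :=
  [X, X ++ Y, X.take W.length, X.drop W.length, T.manyOut X Y W, T.manyIn X Y W, F X]

/-- One round of the search. -/
def searchRound (F : List α → List α) (D : List (List α)) : List (List α) :=
  D.flatMap fun X => D.flatMap fun Y => D.flatMap fun W => T.derived F X Y W

/-- The vertex lists that are found in `k` rounds, starting from the suffixes of `S`. -/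
def search (F : List α → List α) (S : List α) (k : ℕ) : List (List α) :=
  (T.searchRound F)^[k] S.tails

/-- A longest transitively ordered list in a family of lists. -/
def longestChain : List (List α) → List α
  | [] => []
  | X :: D => if X.Pairwise T.Adj ∧ (longestChain D).length < X.length then X else longestChain D

/-- The transitively ordered list of vertices in `S` that is found by `K` rounds of search, with
recursive calls on lists of at most half the length. -/
def findChain (K : ℕ) (S : List α) : List α :=
  if _h : S.length ≤ 1 then S
  else T.longestChain (T.search (fun X => findChain K (X.take (S.length / 2))) S K)
termination_by S.length
decreasing_by simp; omega

theorem pairwise_longestChain (D : List (List α)) : (T.longestChain D).Pairwise T.Adj := by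
  induction D with
  | nil => simp [longestChain]
  | cons X D ih =>
    rw [longestChain]
    split_ifs with h
    exacts [h.1, ih]

theorem longestChain_mem (D : List (List α)) : T.longestChain D ∈ D ∨ T.longestChain D = [] := by
  induction D with
  | nil => simp [longestChain]
  | cons X D ih =>
    rw [longestChain]
    split_ifs with h
    · simp
    · rcases ih with ih | ih
      · exact Or.inl (List.mem_cons_of_mem _ ih)
      · exact Or.inr ih

theorem length_le_longestChain {D : List (List α)} {X : List α} (hX : X ∈ D)
    (h : X.Pairwise T.Adj) : X.length ≤ (T.longestChain D).length := by
  induction D with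
  | nil => simp at hX
  | cons Z D ih =>
    rw [longestChain]
    rcases List.mem_cons.1 hX with rfl | hX
    · split_ifs with h'
      · exact le_rfl
      · push Not at h'
        exact h' h
    · split_ifs with h'
      · exact (ih hX).trans h'.2.le
      · exact ih hX

variable (F : List α → List α) (S : List α)

theorem mem_search_succ {k : ℕ} {X Y W Z : List α} (hX : X ∈ T.search F S k)
    (hY : Y ∈ T.search F S k) (hW : W ∈ T.search F S k) (hZ : Z ∈ T.derived F X Y W) :
    Z ∈ T.search F S (k + 1) := by
  rw [search, Function.iterate_succ_apply']
  simp only [searchRound, List.mem_flatMap]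
  exact ⟨X, hX, Y, hY, W, hW, hZ⟩

theorem search_mono {k k' : ℕ} (h : k ≤ k') {X : List α} (hX : X ∈ T.search F S k) :
    X ∈ T.search F S k' := by
  induction k', h using Nat.le_induction with
  | base => exact hX
  | succ k' _ ih => exact T.mem_search_succ F S ih ih ih (by simp [derived])

/-- In `derived` the list `W` matters only through its length. The suffixes of `S` thus serve as a
supply of all thresholds up to `S.length`. -/
theorem exists_search_length {r : ℕ} (hr : r ≤ S.length) (k : ℕ) :
    ∃ W ∈ T.search F S k, W.length = r := by
  refine ⟨S.drop (S.length - r), T.search_mono F S (Nat.zero_le k) ?_, ?_⟩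
  · simp only [search, Function.iterate_zero, id_eq, List.mem_tails]
    exact List.drop_suffix _ _
  · simp; omega

theorem subset_of_mem_search (hF : ∀ X, F X ⊆ X) {k : ℕ} {X : List α}
    (hX : X ∈ T.search F S k) : X ⊆ S := by
  induction k generalizing X with
  | zero =>
    simp only [search, Function.iterate_zero, id_eq, List.mem_tails] at hX
    exact hX.subset
  | succ k ih =>
    rw [search, Function.iterate_succ_apply'] at hX
    simp only [searchRound, List.mem_flatMap] at hX
    obtain ⟨X', hX', Y, hY, W, hW, hZ⟩ := hX
    have h1 : X' ⊆ S := ih hX'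
    have h2 : Y ⊆ S := ih hY
    simp only [derived, List.mem_cons, List.not_mem_nil, or_false] at hZ
    rcases hZ with rfl | rfl | rfl | rfl | rfl | rfl | rfl
    · exact h1
    · exact List.append_subset.2 ⟨h1, h2⟩
    · exact List.Subset.trans (List.take_subset _ _) h1
    · exact List.Subset.trans (List.drop_subset _ _) h1
    · exact List.Subset.trans (List.filter_subset_self _) h1
    · exact List.Subset.trans (List.filter_subset_self _) h1
    · exact List.Subset.trans (hF _) h1

end Search

/-! ### Sets that are found by the search -/

section Reach

variable {α : Type*} [DecidableEq α] (T : Digraph α) [DecidableRel T.Adj]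
  (F : List α → List α) (S : List α)

/-- The set `A` is found in `k` rounds of search, as a list of vertices in `S` that is pairwise
`R`-ordered. -/
def Reach (R : α → α → Prop) (k : ℕ) (A : Finset α) : Prop :=
  ∃ X ∈ T.search F S k, X.Pairwise R ∧ X ⊆ S ∧ X.toFinset = A

variable {T F S} {R : α → α → Prop} {k : ℕ} {A B : Finset α}

theorem Reach.mono (h : T.Reach F S R k A) {k' : ℕ} (hk : k ≤ k') : T.Reach F S R k' A := by
  obtain ⟨X, h1, h2⟩ := h
  exact ⟨X, T.search_mono F S hk h1, h2⟩

theorem Reach.imp (h : T.Reach F S R k A) {R' : α → α → Prop} (hR : ∀ a b, R a b → R' a b) :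
    T.Reach F S R' k A := by
  obtain ⟨X, h1, h2, h3⟩ := h
  exact ⟨X, h1, h2.imp (hR _ _), h3⟩

theorem Reach.subset (h : T.Reach F S R k A) : A ⊆ S.toFinset := by
  obtain ⟨X, h1, h2, h3, rfl⟩ := h
  intro x hx
  simp only [List.mem_toFinset] at hx ⊢
  exact h3 hx

theorem Reach.card_le (h : T.Reach F S R k A) : A.card ≤ S.length :=
  (Finset.card_le_card h.subset).trans (List.toFinset_card_le S)

theorem reach_self (hS : S.Nodup) (k : ℕ) : T.Reach F S (· ≠ ·) k S.toFinset := by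
  refine ⟨S, T.search_mono F S (Nat.zero_le k) ?_, hS, List.Subset.refl _, rfl⟩
  simp [search]

theorem Reach.manyOut (hA : T.Reach F S R k A) (hB : T.Reach F S (· ≠ ·) k B) {r : ℕ}
    (hr : r ≤ S.length) :
    T.Reach F S R (k + 1) (A.filter fun v => r ≤ (B.filter fun w => T.Adj v w).card) := by
  obtain ⟨X, hX1, hX2, hX3, rfl⟩ := hA
  obtain ⟨Y, hY1, hY2, hY3, rfl⟩ := hB
  obtain ⟨W, hW, rfl⟩ := T.exists_search_length F S hr k
  refine ⟨T.manyOut X Y W, T.mem_search_succ F S hX1 hY1 hW (by simp [derived]),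
    hX2.filter _, List.Subset.trans (List.filter_subset_self _) hX3, ?_⟩
  have : ∀ v, (Y.toFinset.filter fun w => T.Adj v w).card =
      (Y.filter fun y => T.Adj v y).length := by
    intro v
    rw [← List.toFinset_card_of_nodup (List.Nodup.filter _ hY2)]
    congr 1
    ext; simp
  ext v
  simp [Digraph.manyOut, this]

theorem Reach.manyIn (hA : T.Reach F S R k A) (hB : T.Reach F S (· ≠ ·) k B) {r : ℕ}
    (hr : r ≤ S.length) :
    T.Reach F S R (k + 1) (A.filter fun v => r ≤ (B.filter fun w => T.Adj w v).card) := by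
  obtain ⟨X, hX1, hX2, hX3, rfl⟩ := hA
  obtain ⟨Y, hY1, hY2, hY3, rfl⟩ := hB
  obtain ⟨W, hW, rfl⟩ := T.exists_search_length F S hr k
  refine ⟨T.manyIn X Y W, T.mem_search_succ F S hX1 hY1 hW (by simp [derived]),
    hX2.filter _, List.Subset.trans (List.filter_subset_self _) hX3, ?_⟩
  have : ∀ v, (Y.toFinset.filter fun w => T.Adj w v).card =
      (Y.filter fun y => T.Adj y v).length := by
    intro v
    rw [← List.toFinset_card_of_nodup (List.Nodup.filter _ hY2)]
    congr 1
    ext; simp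
  ext v
  simp [Digraph.manyIn, this]

/-- Turns a bound on the fraction of exceptions into a lower threshold on the number of neighbours,
which is what `manyOut` and `manyIn` test. -/
theorem mul_card_filter_not_le_iff {β : Type*} (B : Finset β) (p : β → Prop) [DecidablePred p]
    {l : ℕ} (hl : 0 < l) :
    l * (B.filter fun w => ¬ p w).card ≤ B.card ↔
      B.card - B.card / l ≤ (B.filter p).card := by
  have h := Finset.card_filter_add_card_filter_not (s := B) p
  rw [mul_comm, ← Nat.le_div_iff_mul_le hl]
  omega

theorem Reach.fewNonOut (hA : T.Reach F S R k A) (hB : T.Reach F S (· ≠ ·) k B) {l : ℕ}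
    (hl : 0 < l) : T.Reach F S R (k + 1)
      (A.filter fun v => l * (B.filter fun w => ¬ T.Adj v w).card ≤ B.card) := by
  simp only [mul_card_filter_not_le_iff _ _ hl]
  exact hA.manyOut hB ((Nat.sub_le _ _).trans hB.card_le)

theorem Reach.fewNonIn (hA : T.Reach F S R k A) (hB : T.Reach F S (· ≠ ·) k B) {l : ℕ}
    (hl : 0 < l) : T.Reach F S R (k + 1)
      (A.filter fun v => l * (B.filter fun w => ¬ T.Adj w v).card ≤ B.card) := by
  simp only [mul_card_filter_not_le_iff _ (fun w => T.Adj w _) hl]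
  exact hA.manyIn hB ((Nat.sub_le _ _).trans hB.card_le)

theorem reach_singleton (R : α → α → Prop) {s : α} (hs : s ∈ S) : T.Reach F S R 1 {s} := by
  obtain ⟨S₁, S₂, rfl⟩ := List.append_of_mem hs
  obtain ⟨W, hW, hW1⟩ := T.exists_search_length F (S₁ ++ s :: S₂) (r := 1) (by simp; omega) 0
  have h2 : (s :: S₂) ∈ T.search F (S₁ ++ s :: S₂) 0 := by simp [search]
  exact ⟨(s :: S₂).take W.length, T.mem_search_succ F _ h2 h2 hW (by simp [derived]),
    by simp [hW1], by simp [hW1], by simp [hW1]⟩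

/-- Being an out-neighbour of `s` means having at least one in-neighbour in `{s}`, and singletons
are found after one round. -/
theorem Reach.out (hA : T.Reach F S R k A) (hk : 1 ≤ k) {s : α} (hs : s ∈ S) :
    T.Reach F S R (k + 1) (A.filter fun v => T.Adj s v) := by
  have h := hA.manyIn ((reach_singleton (F := F) (T := T) (· ≠ ·) hs).mono hk) (r := 1)
    (List.length_pos_of_mem hs)
  convert h using 3
  simp only [Finset.filter_singleton]
  split_ifs <;> simp [*]

theorem Reach.inn (hA : T.Reach F S R k A) (hk : 1 ≤ k) {s : α} (hs : s ∈ S) :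
    T.Reach F S R (k + 1) (A.filter fun v => T.Adj v s) := by
  have h := hA.manyOut ((reach_singleton (F := F) (T := T) (· ≠ ·) hs).mono hk) (r := 1)
    (List.length_pos_of_mem hs)
  convert h using 3
  simp only [Finset.filter_singleton]
  split_ifs <;> simp [*]

/-- The pieces are consecutive segments of one `R`-ordered list, hence ordered among themselves. A
segment costs two rounds, a drop and a take; the remainder of the division is discarded. -/
theorem Reach.pieces (hA : T.Reach F S R k A) (hR : ∀ a b, R a b → a ≠ b) (h : ℕ) :
    ∃ X : Fin h → Finset α, (∀ i, T.Reach F S R (k + 2) (X i) ∧ X i ⊆ A ∧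
      (X i).card = A.card / h) ∧ ∀ i j, i < j → ∀ x ∈ X i, ∀ y ∈ X j, R x y := by
  have hcard := hA.card_le
  obtain ⟨X, hX1, hX2, hX3, rfl⟩ := hA
  have hnd : X.Nodup := hX2.imp (hR _ _)
  rw [List.toFinset_card_of_nodup hnd] at *
  set p := X.length / h with hp
  have hph : p * h ≤ X.length := Nat.div_mul_le_self _ _
  have hbd : ∀ i : Fin h, i * p + p ≤ X.length := by
    intro i
    have : ((i : ℕ) + 1) * p ≤ h * p := Nat.mul_le_mul_right _ i.2
    nlinarith
  have hsub : ∀ i : ℕ, ((X.drop (i * p)).take p).Sublist X := fun i =>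
    (List.take_sublist _ _).trans (List.drop_sublist _ _)
  refine ⟨fun i => ((X.drop (i * p)).take p).toFinset, fun i => ⟨?_, ?_, ?_⟩, ?_⟩
  · obtain ⟨W, hW, hW1⟩ := T.exists_search_length F S (r := i * p) ((le_of_add_le_left (hbd i)).trans hcard) k
    obtain ⟨W', hW', hW1'⟩ := T.exists_search_length F S (r := p) ((le_of_add_le_right (hbd i)).trans hcard) (k + 1)
    have h1 : X.drop W.length ∈ T.search F S (k + 1) :=
      T.mem_search_succ F S hX1 hX1 hW (by simp [derived])
    refine ⟨_, T.mem_search_succ F S h1 h1 hW' (Z := (X.drop W.length).take W'.length)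
      (by simp [derived]), ?_⟩
    rw [hW1, hW1']
    exact ⟨hX2.sublist (hsub i), List.Subset.trans (hsub i).subset hX3, rfl⟩
  · intro x hx
    simp only [List.mem_toFinset] at hx ⊢
    exact (hsub i).subset hx
  · rw [List.toFinset_card_of_nodup (hnd.sublist (hsub i))]
    have := hbd i
    simp; omega
  · intro i j hij x hx y hy
    simp only [List.mem_toFinset] at hx hy
    have hij' : ((i : ℕ) + 1) * p ≤ j * p := Nat.mul_le_mul_right _ hij
    have hx' : x ∈ X.take (j * p) := by
      rw [List.take_drop] at hx
      have := List.mem_of_mem_drop hx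
      exact (List.take_subset_take_left X (by nlinarith)) this
    have hy' : y ∈ X.drop (j * p) := List.mem_of_mem_take hy
    have h3 := hX2
    rw [← List.take_append_drop (j * p) X, List.pairwise_append] at h3
    exact h3.2.2 x hx' y hy'

end Reach

end Digraph

namespace Digraph

/-! ### Counting -/

theorem IsTournament.adj_of_not_adj {V : Type*} {G : Digraph V} (h : G.IsTournament) {v w : V}
    (hvw : v ≠ w) (hn : ¬ G.Adj v w) : G.Adj w v := by
  rcases h.2 v w hvw with h | h
  exacts [absurd h.1 hn, h.1]

theorem IsTournament.ne_of_adj {V : Type*} {G : Digraph V} (h : G.IsTournament) {v w : V}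
    (hvw : G.Adj v w) : v ≠ w := by
  rintro rfl
  exact h.1 v hvw

theorem IsTournament.asymm {V : Type*} {G : Digraph V} (h : G.IsTournament) {v w : V}
    (hvw : G.Adj v w) : ¬ G.Adj w v := by
  rcases h.2 v w (h.ne_of_adj hvw) with h | h
  exacts [h.2, absurd hvw h.2]

/-- Between tournaments, preserving edges is enough: loops are absent, which gives injectivity, and
a non-edge between distinct vertices is a reversed edge. -/
theorem not_isFree_of_hom {V α : Type*} {H : Digraph V} {T : Digraph α} (hH : H.IsTournament)
    (hT : T.IsTournament) (φ : V → α) (hφ : ∀ u v, H.Adj u v → T.Adj (φ u) (φ v)) :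
    ¬ T.IsFree H := by
  refine fun hf => hf ⟨φ, fun u v huv => ?_, fun u v => ⟨hφ u v, fun h => ?_⟩⟩
  · by_contra hne
    rcases hH.2 u v hne with h | h
    · exact hT.ne_of_adj (hφ _ _ h.1) huv
    · exact hT.ne_of_adj (hφ _ _ h.1) huv.symm
  · by_contra hn
    have hne : u ≠ v := by
      rintro rfl
      exact hT.1 _ h
    exact hT.asymm h (hφ _ _ (hH.adj_of_not_adj hne hn))

/-- Markov's inequality by double counting of bad pairs: if every `b` is bad for at most a 1/l₀ part
of `A`, then at most an l₁/l₀ part of `A` is bad for more than a 1/l₁ part of `B`. -/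
theorem mul_card_filter_not_le {α β : Type*} (A : Finset α) (B : Finset β) (p : α → β → Prop)
    [∀ a b, Decidable (p a b)] {l₀ l₁ : ℕ}
    (h : ∀ b ∈ B, l₀ * (A.filter fun a => p a b).card ≤ A.card) :
    l₀ * (A.filter fun a => ¬ l₁ * (B.filter fun b => p a b).card ≤ B.card).card ≤
      l₁ * A.card := by
  rcases B.eq_empty_or_nonempty with rfl | hB
  · simp
  set N := A.filter fun a => ¬ l₁ * (B.filter fun b => p a b).card ≤ B.card with hN
  have h1 : N.card * B.card ≤ l₁ * ∑ a ∈ A, (B.filter fun b => p a b).card := by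
    rw [Finset.mul_sum, ← smul_eq_mul, ← Finset.sum_const]
    refine (Finset.sum_le_sum fun a ha => ?_).trans
      (Finset.sum_le_sum_of_subset (Finset.filter_subset _ A))
    have := (Finset.mem_filter.1 ha).2
    omega
  have h2 : ∑ a ∈ A, (B.filter fun b => p a b).card = ∑ b ∈ B, (A.filter fun a => p a b).card := by
    simp only [Finset.card_filter]
    exact Finset.sum_comm
  have h3 : l₀ * ∑ b ∈ B, (A.filter fun a => p a b).card ≤ B.card * A.card := by
    rw [Finset.mul_sum, ← smul_eq_mul (a := B.card), ← Finset.sum_const]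
    exact Finset.sum_le_sum h
  refine Nat.le_of_mul_le_mul_right ?_ hB.card_pos
  calc l₀ * N.card * B.card = l₀ * (N.card * B.card) := by ring
    _ ≤ l₀ * (l₁ * ∑ b ∈ B, (A.filter fun a => p a b).card) := by
      rw [← h2]; exact Nat.mul_le_mul_left _ h1
    _ = l₁ * (l₀ * ∑ b ∈ B, (A.filter fun a => p a b).card) := by ring
    _ ≤ l₁ * (B.card * A.card) := Nat.mul_le_mul_left _ h3
    _ = l₁ * A.card * B.card := by ring

theorem exists_card_le_mul_card_filter {α V : Type*} [Fintype V] {A : Finset α}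
    (hA : A.Nonempty) (p : α → V → Prop) [∀ a u, Decidable (p a u)] (h : ∀ a ∈ A, ∃ u, p a u) :
    ∃ u, A.card ≤ Fintype.card V * (A.filter fun a => p a u).card := by
  classical
  by_contra! hlt
  have hV : Nonempty V := ⟨(h _ hA.choose_spec).choose⟩
  have h1 : A.card ≤ ∑ u : V, (A.filter fun a => p a u).card := by
    refine (Finset.card_le_card fun a ha => ?_).trans Finset.card_biUnion_le
    obtain ⟨u, hu⟩ := h a ha
    simp only [Finset.mem_biUnion, Finset.mem_filter, Finset.mem_univ, true_and]
    exact ⟨u, ha, hu⟩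
  have h2 : ∑ u : V, Fintype.card V * (A.filter fun a => p a u).card < ∑ _u : V, A.card :=
    Finset.sum_lt_sum_of_nonempty Finset.univ_nonempty fun u _ => hlt u
  rw [← Finset.mul_sum, Finset.sum_const, smul_eq_mul, Finset.card_univ] at h2
  exact absurd (lt_of_mul_lt_mul_left h2 (Nat.zero_le _)) (not_lt.2 h1)

theorem card_le_two_mul_card_filter {α : Type*} (A : Finset α) (p : α → Prop) [DecidablePred p]
    (h : 2 * (A.filter fun a => ¬ p a).card ≤ A.card) : A.card ≤ 2 * (A.filter p).card := by
  have := Finset.card_filter_add_card_filter_not (s := A) p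
  omega

/-! ### Sparse pairs -/

section

variable {α : Type*} [DecidableEq α] {T : Digraph α} [DecidableRel T.Adj]
  {F : List α → List α} {S : List α} {V : Type*} [Fintype V] {H : Digraph V}

/-- In a tournament without a copy of `H`, every large enough set that is found by the search
contains disjoint sets `P`, `Q`, found a bounded number of rounds later and of proportional size,
such that the vertices in `Q` have few out-neighbours in `P`. -/
theorem exists_sparse_pair (hH : H.IsTournament) (hT : T.IsTournament) (hfree : T.IsFree H)
    {l : ℕ} (hl : 0 < l) {k : ℕ} (hk : 1 ≤ k) {Y : Finset α} (hY : T.Reach F S (· ≠ ·) k Y)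
    (hcard : Fintype.card V ≤ Y.card) (hV : 0 < Fintype.card V) :
    ∃ P Q, T.Reach F S (· ≠ ·) (k + Fintype.card V + 5) P ∧
      T.Reach F S (· ≠ ·) (k + Fintype.card V + 5) Q ∧ P ⊆ Y ∧ Q ⊆ Y ∧ Disjoint P Q ∧
      Y.card ≤ 4 * Fintype.card V ^ 2 * (4 * l) ^ Fintype.card V * P.card ∧
      Y.card ≤ 4 * Fintype.card V ^ 2 * (4 * l) ^ Fintype.card V * Q.card ∧
      ∀ b ∈ Q, l * (P.filter fun a => ¬ T.Adj a b).card ≤ P.card := by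
  classical
  set h := Fintype.card V with hh
  by_contra hno
  obtain ⟨X, hX, hXd⟩ := hY.pieces (fun _ _ => id) h
  have hYpos : 0 < Y.card := by omega
  have e := Fintype.equivFin V
  have hXd' : ∀ u w : V, u ≠ w → ∀ x ∈ X (e u), ∀ y ∈ X (e w), x ≠ y := by
    intro u w huw x hx y hy
    rcases lt_or_gt_of_ne (fun hc => huw (e.injective hc)) with hc | hc
    · exact hXd _ _ hc x hx y hy
    · exact (hXd _ _ hc y hy x hx).symm
  -- Greedy embedding, one piece of `Y` per vertex of `H`: the vertices in `U` are placed, and `C w`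
  -- holds the candidates for `w` that are compatible with them. Each placement may shrink a
  -- candidate set by a factor 4l, and the initial 2h accounts for the rounding of the pieces.
  -- Completing this for all of `V` contradicts freeness.
  have hmain : ∀ U : Finset V, ∃ (φ : V → α) (C : V → Finset α),
      (∀ u ∈ U, ∀ u' ∈ U, H.Adj u u' → T.Adj (φ u) (φ u')) ∧
      ∀ w ∉ U, T.Reach F S (· ≠ ·) (k + 2 + U.card) (C w) ∧ C w ⊆ X (e w) ∧
        Y.card ≤ 2 * h * (4 * l) ^ U.card * (C w).card ∧
        ∀ v ∈ C w, ∀ u ∈ U, (H.Adj u w → T.Adj (φ u) v) ∧ (H.Adj w u → T.Adj v (φ u)) := by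
    intro U
    induction U using Finset.induction_on with
    | empty =>
      have : Nonempty α := ⟨(Finset.card_pos.1 hYpos).choose⟩
      refine ⟨fun _ => Classical.arbitrary α, fun w => X (e w), by simp, fun w _ =>
        ⟨(hX _).1, subset_rfl, ?_, by simp⟩⟩
      rw [(hX _).2.2]
      have h1 := Nat.lt_mul_div_succ Y.card hV
      have h2 : 1 ≤ Y.card / h := (Nat.one_le_div_iff hV).2 hcard
      simp only [Finset.card_empty, pow_zero, mul_one]
      nlinarith
    | insert w U hw ih =>
      obtain ⟨φ, C, hφ, hC⟩ := ih
      have hUh : U.card ≤ h := Finset.card_le_univ U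
      have hpow : (4 * l) ^ U.card ≤ (4 * l) ^ h := Nat.pow_le_pow_right (by omega) hUh
      let N : V → α → Finset α := fun u v =>
        if H.Adj w u then (C u).filter fun x => T.Adj v x else (C u).filter fun x => T.Adj x v
      by_cases hex : ∃ v ∈ C w, ∀ u ∉ insert w U, (C u).card ≤ 4 * l * (N u v).card
      · obtain ⟨v, hv, hvN⟩ := hex
        have hvS : v ∈ S := by
          have := (hC w hw).1.subset hv
          simpa using this
        refine ⟨Function.update φ w v, fun u => N u v, ?_, ?_⟩
        · intro u hu u' hu' huu'
          have hne := hH.ne_of_adj huu'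
          rcases Finset.mem_insert.1 hu with rfl | hu₁ <;>
            rcases Finset.mem_insert.1 hu' with rfl | hu₂
          · exact absurd rfl hne
          · rw [Function.update_self, Function.update_of_ne hne.symm]
            exact ((hC _ hw).2.2.2 v hv u' hu₂).2 huu'
          · rw [Function.update_self, Function.update_of_ne hne]
            exact ((hC _ hw).2.2.2 v hv u hu₁).1 huu'
          · rw [Function.update_of_ne (by rintro rfl; exact hw hu₁),
              Function.update_of_ne (by rintro rfl; exact hw hu₂)]
            exact hφ u hu₁ u' hu₂ huu'
        · intro u hu
          have huU : u ∉ U := fun hc => hu (Finset.mem_insert_of_mem hc)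
          have huw : u ≠ w := fun hc => hu (hc ▸ Finset.mem_insert_self _ _)
          obtain ⟨h1, h2, h3, h4⟩ := hC u huU
          have hNC : N u v ⊆ C u := by
            simp only [N]
            split_ifs <;> exact Finset.filter_subset _ _
          refine ⟨?_, hNC.trans h2, ?_, ?_⟩
          · rw [Finset.card_insert_of_notMem hw, ← add_assoc]
            simp only [N]
            split_ifs
            · exact h1.out (by omega) hvS
            · exact h1.inn (by omega) hvS
          · rw [Finset.card_insert_of_notMem hw, pow_succ]
            calc _ ≤ _ := h3
              _ ≤ 2 * h * (4 * l) ^ U.card * (4 * l * (N u v).card) :=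
                Nat.mul_le_mul_left _ (hvN u hu)
              _ = _ := by ring
          · intro x hx u' hu'
            rcases Finset.mem_insert.1 hu' with rfl | hu₂
            · rw [Function.update_self]
              simp only [N] at hx
              split_ifs at hx with hadj
              · exact ⟨fun _ => (Finset.mem_filter.1 hx).2, fun hc => absurd hc (hH.asymm hadj)⟩
              · exact ⟨fun hc => absurd hc hadj, fun _ => (Finset.mem_filter.1 hx).2⟩
            · rw [Function.update_of_ne (by rintro rfl; exact hw hu₂)]
              exact h4 x (hNC hx) u' hu₂
      · exfalso
        push Not at hex
        obtain ⟨hw1, hw2, hw3, -⟩ := hC w hw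
        have hwne : (C w).Nonempty := by
          rw [Finset.nonempty_iff_ne_empty]
          intro hc
          rw [hc, Finset.card_empty, mul_zero] at hw3
          omega
        -- No placement of `w` is good, so by pigeonhole one vertex `u` is to blame for a 1/h part
        -- of `C w`. These placements have few neighbours of the required direction in `C u`.
        obtain ⟨u, hu⟩ := exists_card_le_mul_card_filter hwne
          (fun v u => u ∉ insert w U ∧ 4 * l * (N u v).card < (C u).card) hex
        have huU : u ∉ insert w U := by
          intro hc
          simp [hc] at hu
          exact hwne.ne_empty hu
        have huU' : u ∉ U := fun hc => huU (Finset.mem_insert_of_mem hc)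
        have huw : u ≠ w := fun hc => huU (hc ▸ Finset.mem_insert_self _ _)
        obtain ⟨hu1, hu2, hu3, -⟩ := hC u huU'
        have hdis : ∀ x ∈ C u, ∀ v ∈ C w, x ≠ v := fun x hx v hv =>
          hXd' u w huw x (hu2 hx) v (hw2 hv)
        have hbig : ∀ A : Finset α, (C w).card ≤ h * A.card →
            Y.card ≤ 4 * h ^ 2 * (4 * l) ^ h * A.card := by
          intro A hA
          calc Y.card ≤ 2 * h * (4 * l) ^ U.card * (C w).card := hw3
            _ ≤ 2 * h * (4 * l) ^ h * (h * A.card) := by gcongr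
            _ ≤ 4 * h ^ 2 * (4 * l) ^ h * A.card := by
              have : 0 ≤ h ^ 2 * (4 * l) ^ h * A.card := Nat.zero_le _
              nlinarith
        have hbig' : ∀ A : Finset α, (C u).card ≤ 2 * A.card →
            Y.card ≤ 4 * h ^ 2 * (4 * l) ^ h * A.card := by
          intro A hA
          calc Y.card ≤ 2 * h * (4 * l) ^ U.card * (C u).card := hu3
            _ ≤ 2 * h * (4 * l) ^ h * (2 * A.card) := by gcongr
            _ = 4 * (h * 1) * (4 * l) ^ h * A.card := by ring
            _ ≤ 4 * h ^ 2 * (4 * l) ^ h * A.card := by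
              rw [sq]; gcongr; omega
        -- If the edge goes from `w` to `u`, the bad placements receive edges from almost all of `C
        -- u`, so they can serve as `Q` directly.
        by_cases hadj : H.Adj w u
        · set A := (C w).filter fun v =>
            4 * l * ((C u).filter fun x => ¬ T.Adj x v).card ≤ (C u).card with hA
          have hAr : T.Reach F S (· ≠ ·) (k + 2 + U.card + 1) A := hw1.fewNonIn hu1 (by omega)
          have hAc : (C w).card ≤ h * A.card := by
            refine hu.trans (Nat.mul_le_mul_left _ (Finset.card_le_card fun v hv => ?_))
            rw [Finset.mem_filter] at hv ⊢
            refine ⟨hv.1, ?_⟩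
            have h2 := hv.2.2
            simp only [N, if_pos hadj] at h2
            refine le_trans (Nat.mul_le_mul_left _ (Finset.card_le_card fun x hx => ?_)) h2.le
            rw [Finset.mem_filter] at hx ⊢
            exact ⟨hx.1, hT.adj_of_not_adj (hdis x hx.1 v hv.1) hx.2⟩
          refine hno ⟨C u, A, hu1.mono (by omega), hAr.mono (by omega),
            hu2.trans (hX _).2.1, (Finset.filter_subset _ _).trans (hw2.trans (hX _).2.1), ?_,
            hbig' _ (by omega), hbig _ hAc, ?_⟩
          · exact Finset.disjoint_left.2 fun x hx hxA =>
              hdis x hx x (Finset.mem_of_mem_filter _ hxA) rfl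
          · intro b hb
            have := (Finset.mem_filter.1 hb).2
            nlinarith
        · set A := (C w).filter fun v =>
            4 * l * ((C u).filter fun x => ¬ T.Adj v x).card ≤ (C u).card with hA
          have hAr : T.Reach F S (· ≠ ·) (k + 2 + U.card + 1) A := hw1.fewNonOut hu1 (by omega)
          have hAc : (C w).card ≤ h * A.card := by
            refine hu.trans (Nat.mul_le_mul_left _ (Finset.card_le_card fun v hv => ?_))
            rw [Finset.mem_filter] at hv ⊢
            refine ⟨hv.1, ?_⟩
            have h2 := hv.2.2
            simp only [N, if_neg hadj] at h2
            refine le_trans (Nat.mul_le_mul_left _ (Finset.card_le_card fun x hx => ?_)) h2.le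
            rw [Finset.mem_filter] at hx ⊢
            exact ⟨hx.1, hT.adj_of_not_adj (hdis x hx.1 v hv.1).symm hx.2⟩
          -- Here the few exceptions are counted on the wrong side: each vertex of `A` has few in `C
          -- u`. Markov with ratio 4l to l leaves at least half of `C u` with few exceptions in `A`;
          -- this is why 4l was used above.
          set Q := (C u).filter fun x => l * (A.filter fun a => ¬ T.Adj a x).card ≤ A.card with hQ
          have hQr : T.Reach F S (· ≠ ·) (k + 2 + U.card + 1 + 1) Q :=
            (hu1.mono (by omega)).fewNonIn hAr hl
          have hQc : (C u).card ≤ 2 * Q.card := by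
            have h5 := mul_card_filter_not_le (C u) A (fun x a => ¬ T.Adj a x) (l₀ := 4 * l)
              (l₁ := l) fun a ha => (Finset.mem_filter.1 ha).2
            refine card_le_two_mul_card_filter _ _ ?_
            rw [mul_comm 4 l, mul_assoc] at h5
            have h6 := Nat.le_of_mul_le_mul_left h5 hl
            omega
          refine hno ⟨A, Q, hAr.mono (by omega), hQr.mono (by omega),
            (Finset.filter_subset _ _).trans (hw2.trans (hX _).2.1),
            (Finset.filter_subset _ _).trans (hu2.trans (hX _).2.1), ?_,
            hbig _ hAc, hbig' _ hQc, ?_⟩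
          · exact Finset.disjoint_left.2 fun x hx hxA =>
              hdis x (Finset.mem_of_mem_filter _ hxA) x (Finset.mem_of_mem_filter _ hx) rfl
          · exact fun b hb => (Finset.mem_filter.1 hb).2
  obtain ⟨φ, C, hφ, -⟩ := hmain Finset.univ
  exact not_isFree_of_hom hH hT φ (fun u v => hφ u (Finset.mem_univ _) v (Finset.mem_univ _)) hfree

end

end Digraph

namespace Digraph

/-! ### Galaxies -/

/-- The centers of the stars of a galaxy ordering: `z` maps every leaf to the center of its star
and fixes all other vertices. -/
theorem IsGalaxyOrdering.exists_center {V : Type*} [Fintype V] {H : Digraph V}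
    (hH : H.IsTournament) {θ : V ≃ Fin (Fintype.card V)} (h : H.IsGalaxyOrdering θ) :
    ∃ z : V → V, (∀ v, z (z v) = z v) ∧
      (∀ u v, θ u < θ v → (H.Adj u v ↔ ¬ (z u = v ∨ z v = u))) ∧
      ∀ u v w w', z u = z v → z u ≠ u → z v ≠ v → w' ≠ w → z w' = w →
        ¬ (θ u < θ w ∧ θ w < θ v) := by
  classical
  obtain ⟨center, h1, h2⟩ := h
  let comp : V → (H.backwardGraph θ).ConnectedComponent :=
    fun v => (H.backwardGraph θ).connectedComponentMk v
  have hmem : ∀ v, v ∈ (comp v).supp := fun v => rfl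
  have hstar : ∀ c, c.supp.Nontrivial → H.IsStarAt θ c.supp (center c) := by
    intro c hc
    rcases h1 c with ⟨v, hv⟩ | h
    · rw [hv] at hc
      exact absurd hc Set.not_nontrivial_singleton
    · exact h
  have hcomp : ∀ c v, v ∈ c.supp → comp v = c := fun c v hv => hv
  let z : V → V := fun v => if (comp v).supp.Nontrivial then center (comp v) else v
  have hzcomp : ∀ v, comp (z v) = comp v := by
    intro v
    simp only [z]
    split_ifs with hv
    · exact hcomp _ _ (hstar _ hv).1
    · rfl
  have hzn : ∀ v, z v ≠ v → (comp v).supp.Nontrivial ∧ z v = center (comp v) := by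
    intro v hv
    simp only [z] at hv ⊢
    split_ifs with hv' <;> simp_all
  have hz : ∀ v, (comp v).supp.Nontrivial → z v = center (comp v) := fun v hv => by
    simp only [z, if_pos hv]
  have hadj : ∀ u v, u ≠ v → ((H.backwardGraph θ).Adj u v ↔ z u = v ∨ z v = u) := by
    have key : ∀ u v, u ≠ v → z u = v → (H.backwardGraph θ).Adj u v := by
      intro u v huv huz
      obtain ⟨hn, hc⟩ := hzn u (by rw [huz]; exact huv.symm)
      have hs := hstar _ hn
      rw [← hc, huz] at hs
      exact (hs.2.2.1 u (hmem u) v hs.1).2 ⟨huv, Or.inr rfl⟩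
    intro u v huv
    constructor
    · intro h
      have hc : comp u = comp v := SimpleGraph.ConnectedComponent.sound h.reachable
      have hn : (comp u).supp.Nontrivial := ⟨u, hmem u, v, by rw [hc]; exact hmem v, huv⟩
      rcases ((hstar _ hn).2.2.1 u (hmem u) v (by rw [hc]; exact hmem v)).1 h with ⟨-, h | h⟩
      · right
        rw [hz v (hc ▸ hn), ← hc, ← h]
      · left
        rw [hz u hn, ← h]
    · rintro (h | h)
      · exact key u v huv h
      · exact (key v u huv.symm h).symm
  refine ⟨z, fun v => ?_, fun u v huv => ?_, ?_⟩
  · by_cases hv : (comp v).supp.Nontrivial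
    · rw [hz (z v) (by rwa [hzcomp]), hzcomp, ← hz v hv]
    · have : z v = v := by simp only [z, if_neg hv]
      rw [this, this]
  · have hne : u ≠ v := by
      rintro rfl
      exact lt_irrefl _ huv
    rw [← hadj u v hne]
    have : (H.backwardGraph θ).Adj u v ↔ H.Adj v u := by
      simp only [backwardGraph]
      constructor
      · rintro (h | h)
        · exact absurd h.2 huv.asymm
        · exact h.1
      · exact fun h => Or.inr ⟨h, huv⟩
    rw [this]
    exact ⟨fun h => hH.asymm h, fun h => hH.adj_of_not_adj hne.symm h⟩
  · rintro u v w w' huv hu hv hw' rfl hbet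
    obtain ⟨hnu, hcu⟩ := hzn u hu
    obtain ⟨hnv, hcv⟩ := hzn v hv
    obtain ⟨hnw, hcw⟩ := hzn w' hw'.symm
    have hc : comp u = comp v := by rw [← hzcomp u, huv, hzcomp]
    rw [hcw] at hbet
    -- The center of the star itself is not between two of its leaves since the star is left or
    -- right; for the center of another star this is the galaxy condition.
    by_cases hcc : comp w' = comp u
    · rw [hcc] at hbet
      rcases (hstar _ hnu).2.2.2 with h | h
      · exact (h u (hmem u) (fun h => hu (hcu.trans h.symm))).asymm hbet.1
      · exact (h v (by rw [hc]; exact hmem v)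
          (fun h => hv (hcv.trans (by rw [← hc]; exact h.symm)))).asymm hbet.2
    · exact h2 (comp w') (comp u) hcc hnw hnu u (hmem u) v (by rw [hc]; exact hmem v)
        (fun h => hu (hcu.trans h.symm))
        (fun h => hv (hcv.trans (by rw [← hc]; exact h.symm))) hbet

/-! ### Blocks -/

section

variable {α : Type*} [DecidableEq α] {T : Digraph α} [DecidableRel T.Adj]
  {F : List α → List α} {S : List α}

/-- One condition per round. The relation `R` is kept throughout, so a transitively ordered list
stays one. -/
theorem Reach.filter_forall {ι : Type*} (B : Finset ι) (p : ι → α → Prop)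
    [∀ i, DecidablePred (p i)] [DecidablePred fun a => ∀ i ∈ B, p i a] {k : ℕ}
    (hp : ∀ i ∈ B, ∀ (R : α → α → Prop) (k' : ℕ) (A : Finset α), k ≤ k' → T.Reach F S R k' A →
      T.Reach F S R (k' + 1) (A.filter (p i)))
    {R : α → α → Prop} {A : Finset α} (hA : T.Reach F S R k A) :
    T.Reach F S R (k + B.card) (A.filter fun a => ∀ i ∈ B, p i a) := by
  classical
  have key : ∃ A', T.Reach F S R (k + B.card) A' ∧ ∀ a, a ∈ A' ↔ a ∈ A ∧ ∀ i ∈ B, p i a := by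
    induction B using Finset.induction_on with
    | empty => exact ⟨A, hA, by simp⟩
    | insert i B hi ih =>
      obtain ⟨A', h1, h1'⟩ := ih fun i hi => hp i (Finset.mem_insert_of_mem hi)
      have h2 := hp i (Finset.mem_insert_self _ _) R _ _ (Nat.le_add_right _ _) h1
      rw [Finset.card_insert_of_notMem hi, ← add_assoc]
      refine ⟨_, h2, fun a => ?_⟩
      simp only [Finset.mem_filter, Finset.forall_mem_insert, h1']
      tauto
  obtain ⟨A', h1, h1'⟩ := key
  convert h1 using 1
  ext a
  simp [h1']

/-- Union bound: at most h conditions, each failing on at most a 1/(2h) part of `A`. -/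
theorem card_le_two_mul_card_filter_forall {V : Type*} [Fintype V] (A : Finset α) (B : Finset V)
    (p : V → α → Prop) [∀ v, DecidablePred (p v)] [DecidablePred fun a => ∀ v ∈ B, p v a]
    (h : ∀ v ∈ B, 2 * Fintype.card V * (A.filter fun a => ¬ p v a).card ≤ A.card) :
    A.card ≤ 2 * (A.filter fun a => ∀ v ∈ B, p v a).card := by
  classical
  refine card_le_two_mul_card_filter _ _ ?_
  rcases B.eq_empty_or_nonempty with rfl | ⟨v₀, hv₀⟩
  · simp
  have hV : 0 < Fintype.card V := Fintype.card_pos_iff.2 ⟨v₀⟩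
  have h1 : (A.filter fun a => ¬ ∀ v ∈ B, p v a).card ≤
      ∑ v ∈ B, (A.filter fun a => ¬ p v a).card := by
    refine (Finset.card_le_card fun a ha => ?_).trans Finset.card_biUnion_le
    simp only [Finset.mem_filter, Finset.mem_biUnion] at ha ⊢
    push Not at ha
    obtain ⟨ha, v, hv, hav⟩ := ha
    exact ⟨v, hv, ha, hav⟩
  have h2 : ∑ v ∈ B, 2 * Fintype.card V * (A.filter fun a => ¬ p v a).card ≤
      Fintype.card V * A.card := by
    refine (Finset.sum_le_card_nsmul _ _ _ h).trans ?_
    rw [smul_eq_mul]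
    exact Nat.mul_le_mul_right _ (Finset.card_le_univ B)
  rw [← Finset.mul_sum] at h2
  refine Nat.le_of_mul_le_mul_left ?_ hV
  calc _ = 2 * Fintype.card V * (A.filter fun a => ¬ ∀ v ∈ B, p v a).card := by ring
    _ ≤ _ := (Nat.mul_le_mul_left _ h1).trans h2

variable {V : Type*} [Fintype V] {H : Digraph V}

/-- One vertex set for every vertex of `H`: the blocks `q` are in order, with few backward edges
from later blocks to earlier ones. The single vertices `v` with `c v` get large sets, the other
vertices get transitive sets, which are in order inside each block. -/
theorem exists_block_family (hH : H.IsTournament) (hT : T.IsTournament) (hfree : T.IsFree H)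
    (hV : 0 < Fintype.card V) (hS : S.Nodup) (θ : V → ℕ) (q : V → ℕ) {M : ℕ}
    (hq : ∀ v, q v < M) (c : V → Prop) (hc : ∀ v w, c v → q w = q v → w = v) {l C : ℕ}
    (hl : 0 < l) (hC : C = 8 * Fintype.card V ^ 2 * (8 * Fintype.card V * l) ^ Fintype.card V)
    (hlarge : C ^ M * Fintype.card V ≤ S.length) {m : ℕ}
    (hpiece : ∀ k A, T.Reach F S (· ≠ ·) k A → S.length ≤ C ^ M * A.card →
      ∃ X : V → Finset α, (∀ v, T.Reach F S T.Adj (k + 3) (X v) ∧ X v ⊆ A ∧ m ≤ (X v).card) ∧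
        ∀ u v, θ u < θ v → ∀ x ∈ X u, ∀ y ∈ X v, T.Adj x y) :
    ∃ X : V → Finset α, (∀ v, T.Reach F S (· ≠ ·) (1 + M * (2 * Fintype.card V + 8)) (X v) ∧
        (¬ c v → T.Reach F S T.Adj (1 + M * (2 * Fintype.card V + 8)) (X v) ∧ m ≤ (X v).card) ∧
        (c v → S.length ≤ C ^ M * (X v).card)) ∧
      (∀ u v, q u < q v → Disjoint (X u) (X v) ∧
        ∀ x ∈ X u, l * ((X v).filter fun y => ¬ T.Adj x y).card ≤ (X v).card) ∧
      ∀ u v, q u = q v → θ u < θ v → ∀ x ∈ X u, ∀ y ∈ X v, T.Adj x y := by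
  classical
  set h := Fintype.card V with hh
  have hCpos : 0 < C := by rw [hC]; positivity
  -- The blocks are split off from the right. After j steps the last j blocks are filled, and `Y` is
  -- the room left of them, each of its vertices having few exceptions to every set already chosen;
  -- this passes to all later subsets of `Y`. A step takes h+5 rounds for the sparse pair, 3 for the
  -- pieces and at most h for cleaning.
  have hmain : ∀ j ≤ M, ∃ (Y : Finset α) (X : V → Finset α),
      T.Reach F S (· ≠ ·) (1 + j * (2 * h + 8)) Y ∧ S.length ≤ C ^ j * Y.card ∧
      (∀ v, M - j ≤ q v → T.Reach F S (· ≠ ·) (1 + j * (2 * h + 8)) (X v) ∧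
        (¬ c v → T.Reach F S T.Adj (1 + j * (2 * h + 8)) (X v) ∧ m ≤ (X v).card) ∧
        (c v → S.length ≤ C ^ M * (X v).card) ∧ Disjoint Y (X v) ∧
        ∀ y ∈ Y, l * ((X v).filter fun x => ¬ T.Adj y x).card ≤ (X v).card) ∧
      (∀ u v, M - j ≤ q u → q u < q v → Disjoint (X u) (X v) ∧
        ∀ x ∈ X u, l * ((X v).filter fun y => ¬ T.Adj x y).card ≤ (X v).card) ∧
      ∀ u v, M - j ≤ q u → q u = q v → θ u < θ v → ∀ x ∈ X u, ∀ y ∈ X v, T.Adj x y := by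
    intro j hj
    induction j with
    | zero =>
      refine ⟨S.toFinset, fun _ => ∅, reach_self hS _, ?_, fun v hv => ?_, fun u v hu => ?_,
        fun u v hu => ?_⟩
      · rw [List.toFinset_card_of_nodup hS]
        simp
      · exact absurd (hq v) (by omega)
      · exact absurd (hq u) (by omega)
      · exact absurd (hq u) (by omega)
    | succ j ih =>
      obtain ⟨Y, X, hY, hYc, hX1, hX2, hX3⟩ := ih (by omega)
      have hpowj : C ^ (j + 1) ≤ C ^ M := Nat.pow_le_pow_right hCpos hj
      have hYh : h ≤ Y.card := by
        have h1 : C ^ M * h ≤ C ^ M * Y.card := hlarge.trans (hYc.trans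
          (Nat.mul_le_mul_right _ (Nat.pow_le_pow_right hCpos (by omega))))
        exact Nat.le_of_mul_le_mul_left h1 (by positivity)
      obtain ⟨P, Q, hP, hQ, hPY, hQY, hPQ, hPc, hQc, hsp⟩ := exists_sparse_pair hH hT hfree
        (l := 2 * h * l) (by positivity) (by omega) hY hYh hV
      rw [← hh] at hP hQ hPc hQc
      have hC' : 4 * h ^ 2 * (4 * (2 * h * l)) ^ h * 2 = C := by
        rw [hC]
        ring_nf
      have hQc' : S.length ≤ C ^ M * Q.card := by
        calc S.length ≤ C ^ j * Y.card := hYc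
          _ ≤ C ^ j * (C * Q.card) := by
            refine Nat.mul_le_mul_left _ (hQc.trans (Nat.mul_le_mul_right _ ?_))
            omega
          _ = C ^ (j + 1) * Q.card := by ring
          _ ≤ C ^ M * Q.card := Nat.mul_le_mul_right _ hpowj
      obtain ⟨Z, hZ1, hZ2⟩ := hpiece _ Q hQ hQc'
      -- The pieces `Z v` may be tiny compared with `Q`. They inherit sparseness because it was
      -- established for each single vertex of `Q`, not on average.
      let X' : V → Finset α := fun v => if q v = M - (j + 1) then (if c v then Q else Z v) else X v
      have hX'Q : ∀ v, q v = M - (j + 1) → X' v ⊆ Q ∧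
          T.Reach F S (· ≠ ·) (1 + j * (2 * h + 8) + h + 8) (X' v) := by
        intro v hv
        simp only [X', if_pos hv]
        split_ifs
        · exact ⟨subset_rfl, hQ.mono (by omega)⟩
        · exact ⟨(hZ1 v).2.1, ((hZ1 v).1.imp fun a b => hT.ne_of_adj).mono (by omega)⟩
      have hX'X : ∀ v, M - j ≤ q v → X' v = X v := by
        intro v hv
        have : q v ≠ M - (j + 1) := by omega
        simp only [X', if_neg this]
      let B : Finset V := Finset.univ.filter fun v => q v = M - (j + 1)
      have hB : ∀ v, v ∈ B ↔ q v = M - (j + 1) := fun v => by simp [B]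
      -- The sparse pair has parameter 2hl instead of l, so by Markov each of the at most h sets in
      -- the new block spoils at most a 1/(2h) part of `P`.
      let Y' : Finset α := P.filter fun a => ∀ v ∈ B,
        l * ((X' v).filter fun x => ¬ T.Adj a x).card ≤ (X' v).card
      have hY'P : Y' ⊆ P := Finset.filter_subset _ _
      have hY' : T.Reach F S (· ≠ ·) (1 + (j + 1) * (2 * h + 8)) Y' := by
        refine (Reach.filter_forall (k := 1 + j * (2 * h + 8) + h + 8) B _ (fun v hv R k' A hk' hA =>
          hA.fewNonOut ((hX'Q v ((hB v).1 hv)).2.mono hk') hl)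
          (hP.mono (by omega))).mono ?_
        have : B.card ≤ h := Finset.card_le_univ B
        have h2 : (j + 1) * (2 * h + 8) = j * (2 * h + 8) + (2 * h + 8) := by ring
        omega
      have hPY'c : P.card ≤ 2 * Y'.card := by
        refine card_le_two_mul_card_filter_forall P B
          (fun v a => l * ((X' v).filter fun x => ¬ T.Adj a x).card ≤ (X' v).card) fun v hv => ?_
        have h5 := mul_card_filter_not_le P (X' v) (fun a x => ¬ T.Adj a x) (l₀ := 2 * h * l)
          (l₁ := l) fun x hx => hsp x ((hX'Q v ((hB v).1 hv)).1 hx)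
        refine Nat.le_of_mul_le_mul_left (le_trans (le_of_eq ?_) h5) hl
        ring
      refine ⟨Y', X', hY', ?_, fun v hv => ?_, fun u v hu huv => ?_, fun u v hu huv hθ => ?_⟩
      · calc S.length ≤ C ^ j * Y.card := hYc
          _ ≤ C ^ j * (4 * h ^ 2 * (4 * (2 * h * l)) ^ h * P.card) := Nat.mul_le_mul_left _ hPc
          _ ≤ C ^ j * (4 * h ^ 2 * (4 * (2 * h * l)) ^ h * (2 * Y'.card)) := by gcongr
          _ = C ^ j * (4 * h ^ 2 * (4 * (2 * h * l)) ^ h * 2) * Y'.card := by ring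
          _ = C ^ (j + 1) * Y'.card := by rw [hC', pow_succ]
      · have hk : 1 + j * (2 * h + 8) + h + 8 ≤ 1 + (j + 1) * (2 * h + 8) := by
          have h2 : (j + 1) * (2 * h + 8) = j * (2 * h + 8) + (2 * h + 8) := by ring
          omega
        by_cases hvj : q v = M - (j + 1)
        · obtain ⟨h1, h2⟩ := hX'Q v hvj
          refine ⟨h2.mono hk, fun hcv => ?_, fun hcv => ?_, ?_, fun y hy => ?_⟩
          · simp only [X', if_pos hvj, if_neg hcv]
            exact ⟨(hZ1 v).1.mono (by omega), (hZ1 v).2.2⟩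
          · simp only [X', if_pos hvj, if_pos hcv]
            exact hQc'
          · exact Finset.disjoint_of_subset_left hY'P (Finset.disjoint_of_subset_right h1 hPQ)
          · exact (Finset.mem_filter.1 hy).2 v ((hB v).2 hvj)
        · have hvj' : M - j ≤ q v := by omega
          rw [hX'X v hvj']
          obtain ⟨h1, h2, h3, h4, h5⟩ := hX1 v hvj'
          refine ⟨h1.mono (by omega), fun hcv => ⟨(h2 hcv).1.mono (by omega), (h2 hcv).2⟩, h3,
            Finset.disjoint_of_subset_left (hY'P.trans hPY) h4, fun y hy => h5 y (hPY (hY'P hy))⟩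
      · rw [hX'X v (by omega)]
        by_cases huj : q u = M - (j + 1)
        · obtain ⟨-, -, -, h4, h5⟩ := hX1 v (by omega)
          have h6 := (hX'Q u huj).1.trans hQY
          exact ⟨Finset.disjoint_of_subset_left h6 h4, fun x hx => h5 x (h6 hx)⟩
        · rw [hX'X u (by omega)]
          exact hX2 u v (by omega) huv
      · by_cases huj : q u = M - (j + 1)
        · have hvj : q v = M - (j + 1) := by omega
          have hne : u ≠ v := by
            rintro rfl
            exact lt_irrefl _ hθ
          have hcu : ¬ c u := fun hcu => hne (hc u v hcu huv.symm).symm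
          have hcv : ¬ c v := fun hcv => hne (hc v u hcv huv)
          simp only [X', if_pos huj, if_pos hvj, if_neg hcu, if_neg hcv]
          exact hZ2 u v hθ
        · rw [hX'X u (by omega), hX'X v (by omega)]
          exact hX3 u v (by omega) huv hθ
  obtain ⟨Y, X, -, -, h1, h2, h3⟩ := hmain M le_rfl
  simp only [Nat.sub_self, Nat.zero_le, true_imp_iff] at h1 h2 h3
  exact ⟨X, fun v => ⟨(h1 v).1, (h1 v).2.1, (h1 v).2.2.1⟩, h2, h3⟩

/-- The sets of `exists_block_family` can be cleaned such that every vertex in one of them has few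
backward neighbours in each of the others. -/
theorem exists_smooth_family (hH : H.IsTournament) (hT : T.IsTournament) (hfree : T.IsFree H)
    (hV : 0 < Fintype.card V) (hS : S.Nodup) (θ : V → ℕ) (q : V → ℕ) {M : ℕ}
    (hq : ∀ v, q v < M) (hqθ : ∀ u v, θ u < θ v → q u ≤ q v) (c : V → Prop)
    (hc : ∀ v w, c v → q w = q v → w = v) {C : ℕ}
    (hC : C = 8 * Fintype.card V ^ 2 *
      (8 * Fintype.card V * (8 * Fintype.card V ^ 2)) ^ Fintype.card V)
    (hlarge : C ^ M * Fintype.card V ≤ S.length) {m : ℕ} (hm : 0 < m)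
    (hpiece : ∀ k A, T.Reach F S (· ≠ ·) k A → S.length ≤ C ^ M * A.card →
      ∃ X : V → Finset α, (∀ v, T.Reach F S T.Adj (k + 3) (X v) ∧ X v ⊆ A ∧ m ≤ (X v).card) ∧
        ∀ u v, θ u < θ v → ∀ x ∈ X u, ∀ y ∈ X v, T.Adj x y) :
    ∃ (K : ℕ) (X : V → Finset α), K = 1 + M * (2 * Fintype.card V + 8) + Fintype.card V ∧
      (∀ v, (X v).Nonempty ∧ T.Reach F S (· ≠ ·) K (X v) ∧
        (¬ c v → T.Reach F S T.Adj K (X v) ∧ m ≤ 2 * (X v).card) ∧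
        (c v → S.length ≤ 2 * C ^ M * (X v).card)) ∧
      (∀ u v, q u = q v → θ u < θ v → ∀ x ∈ X u, ∀ y ∈ X v, T.Adj x y) ∧
      ∀ u v, θ u < θ v → Disjoint (X u) (X v) ∧
        (∀ x ∈ X u,
          2 * Fintype.card V * ((X v).filter fun y => ¬ T.Adj x y).card ≤ (X v).card) ∧
        (∀ y ∈ X v,
          2 * Fintype.card V * ((X u).filter fun x => ¬ T.Adj x y).card ≤ (X u).card) := by
  classical
  set h := Fintype.card V with hh
  obtain ⟨X, hX1, hX2, hX3⟩ := exists_block_family hH hT hfree hV hS θ q hq c hc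
    (l := 8 * h ^ 2) (by positivity) hC hlarge hpiece
  let B : V → Finset V := fun v => Finset.univ.filter fun u => q u < q v
  have hB : ∀ u v, u ∈ B v ↔ q u < q v := fun u v => by simp [B]
  -- The block family bounds exceptions only as seen from the earlier set. Markov with 8h² and 4h
  -- makes a 1/(2h) part bad for each earlier set, so half of `X v` remains. Passing to halves at
  -- most doubles the densities 1/(8h²) and 1/(4h), and both stay within 1/(2h).
  let Z : V → Finset α := fun v => (X v).filter fun x => ∀ u ∈ B v,
    4 * h * ((X u).filter fun y => ¬ T.Adj y x).card ≤ (X u).card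
  have hZX : ∀ v, Z v ⊆ X v := fun v => Finset.filter_subset _ _
  have hZR : ∀ (R : α → α → Prop) v, T.Reach F S R (1 + M * (2 * h + 8)) (X v) →
      T.Reach F S R (1 + M * (2 * h + 8) + h) (Z v) := by
    intro R v hv
    refine (Reach.filter_forall (B v) _ (fun u hu R k' A hk' hA =>
      hA.fewNonIn (l := 4 * h) ((hX1 u).1.mono hk') (by positivity)) hv).mono ?_
    exact Nat.add_le_add_left (Finset.card_le_univ _) _
  have hXZ : ∀ v, (X v).card ≤ 2 * (Z v).card := by
    intro v
    refine card_le_two_mul_card_filter_forall (X v) (B v)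
      (fun u x => 4 * h * ((X u).filter fun y => ¬ T.Adj y x).card ≤ (X u).card) fun u hu => ?_
    have h5 := mul_card_filter_not_le (X v) (X u) (fun x y => ¬ T.Adj y x) (l₀ := 8 * h ^ 2)
      (l₁ := 4 * h) (hX2 u v ((hB u v).1 hu)).2
    refine Nat.le_of_mul_le_mul_left (le_trans (le_of_eq ?_) h5) (show 0 < 4 * h by positivity)
    ring
  have hadj : ∀ u v, q u = q v → θ u < θ v → ∀ x ∈ Z u, ∀ y ∈ Z v, T.Adj x y :=
    fun u v h1 h2 x hx y hy => hX3 u v h1 h2 x (hZX u hx) y (hZX v hy)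
  refine ⟨_, Z, rfl, fun v => ⟨?_, hZR _ v (hX1 v).1, fun hcv => ?_, fun hcv => ?_⟩, hadj,
    fun u v huv => ?_⟩
  · have : 0 < (X v).card := by
      by_cases hcv : c v
      · have h1 := (hX1 v).2.2 hcv
        have h2 : 0 < C ^ M * h := by rw [hC]; positivity
        exact Nat.pos_of_ne_zero fun h3 => by rw [h3] at h1; omega
      · exact hm.trans_le ((hX1 v).2.1 hcv).2
    have h2 := hXZ v
    exact Finset.card_pos.1 (by omega)
  · have h1 := (hX1 v).2.1 hcv
    exact ⟨hZR _ v h1.1, h1.2.trans (hXZ v)⟩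
  · calc S.length ≤ C ^ M * (X v).card := (hX1 v).2.2 hcv
      _ ≤ C ^ M * (2 * (Z v).card) := Nat.mul_le_mul_left _ (hXZ v)
      _ = _ := by ring
  · rcases (hqθ u v huv).lt_or_eq with hlt | heq
    · obtain ⟨h1, h2⟩ := hX2 u v hlt
      refine ⟨Finset.disjoint_of_subset_left (hZX u) (Finset.disjoint_of_subset_right (hZX v) h1),
        fun x hx => ?_, fun y hy => ?_⟩
      · have h3 := h2 x (hZX u hx)
        have h4 : ((Z v).filter fun y => ¬ T.Adj x y).card ≤
            ((X v).filter fun y => ¬ T.Adj x y).card :=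
          Finset.card_le_card (Finset.filter_subset_filter _ (hZX v))
        have h5 := hXZ v
        have h6 : 1 ≤ h := hV
        nlinarith [Nat.mul_le_mul_left (8 * h ^ 2) h4,
          Nat.zero_le (h * (h - 1) * ((Z v).filter fun y => ¬ T.Adj x y).card),
          Nat.mul_le_mul_right ((Z v).filter fun y => ¬ T.Adj x y).card
            (show h ≤ h ^ 2 by nlinarith)]
      · have h3 := (Finset.mem_filter.1 hy).2 u ((hB u v).2 hlt)
        have h4 : ((Z u).filter fun x => ¬ T.Adj x y).card ≤
            ((X u).filter fun x => ¬ T.Adj x y).card :=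
          Finset.card_le_card (Finset.filter_subset_filter _ (hZX u))
        have h5 := hXZ u
        nlinarith [Nat.mul_le_mul_left (4 * h) h4]
    · have h1 := hadj u v heq huv
      refine ⟨Finset.disjoint_left.2 fun x hx hx' => hT.1 x (h1 x hx x hx'), fun x hx => ?_,
        fun y hy => ?_⟩
      · rw [Finset.filter_false_of_mem fun y hy => not_not.2 (h1 x hx y hy)]
        simp
      · rw [Finset.filter_false_of_mem fun x hx => not_not.2 (h1 x hx y hy)]
        simp

end

end Digraph

/-! ### Embedding a galaxy star by star -/

namespace Digraph

section

variable {α : Type*} [DecidableEq α] {T : Digraph α} [DecidableRel T.Adj]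
  {F : List α → List α} {S : List α}

/-- With parameter `B.card + 1`, a single exception already exceeds the permitted fraction, so the
sparse filter selects exactly the complete vertices. -/
theorem Reach.completeOut {R : α → α → Prop} {k : ℕ} {A B : Finset α} (hA : T.Reach F S R k A)
    (hB : T.Reach F S (· ≠ ·) k B) :
    T.Reach F S R (k + 1) (A.filter fun a => ∀ b ∈ B, T.Adj a b) := by
  convert hA.fewNonOut hB (Nat.succ_pos B.card) using 3 with a
  have : (∀ b ∈ B, T.Adj a b) ↔ (B.filter fun b => ¬ T.Adj a b).card = 0 := by
    simp [Finset.filter_eq_empty_iff]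
  rw [this]
  constructor
  · intro h
    simp [h]
  · intro h
    by_contra hne
    have := Nat.mul_le_mul_left B.card.succ (Nat.one_le_iff_ne_zero.2 hne)
    omega

theorem Reach.completeIn {R : α → α → Prop} {k : ℕ} {A B : Finset α} (hA : T.Reach F S R k A)
    (hB : T.Reach F S (· ≠ ·) k B) :
    T.Reach F S R (k + 1) (A.filter fun a => ∀ b ∈ B, T.Adj b a) := by
  convert hA.fewNonIn hB (Nat.succ_pos B.card) using 3 with a
  have : (∀ b ∈ B, T.Adj b a) ↔ (B.filter fun b => ¬ T.Adj b a).card = 0 := by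
    simp [Finset.filter_eq_empty_iff]
  rw [this]
  constructor
  · intro h
    simp [h]
  · intro h
    by_contra hne
    have := Nat.mul_le_mul_left B.card.succ (Nat.one_le_iff_ne_zero.2 hne)
    omega

/-- All losses are measured against the original set `X`, so they add up instead of multiplying. -/
theorem card_mul_sdiff_filter_forall_le {V : Type*} (B : Finset V) (X C : Finset α)
    (p : V → α → Prop) [∀ v, DecidablePred (p v)] [DecidablePred fun a => ∀ v ∈ B, p v a]
    {m n : ℕ} (hC : m * (X \ C).card ≤ n * X.card)
    (h : ∀ v ∈ B, m * (X.filter fun a => ¬ p v a).card ≤ X.card) :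
    m * (X \ C.filter fun a => ∀ v ∈ B, p v a).card ≤ (n + B.card) * X.card := by
  classical
  have h1 : (X \ C.filter fun a => ∀ v ∈ B, p v a).card ≤
      (X \ C).card + ∑ v ∈ B, (X.filter fun a => ¬ p v a).card := by
    refine le_trans (Finset.card_le_card (t := (X \ C) ∪ B.biUnion fun v =>
      X.filter fun a => ¬ p v a) fun a ha => ?_) ((Finset.card_union_le _ _).trans
        (Nat.add_le_add_left Finset.card_biUnion_le _))
    simp only [Finset.mem_sdiff, Finset.mem_filter, Finset.mem_union, Finset.mem_biUnion] at ha ⊢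
    by_cases haC : a ∈ C
    · right
      have h2 := ha.2
      push Not at h2
      obtain ⟨v, hv, hav⟩ := h2 haC
      exact ⟨v, hv, ha.1, hav⟩
    · exact Or.inl ⟨ha.1, haC⟩
  have h2 : ∑ v ∈ B, m * (X.filter fun a => ¬ p v a).card ≤ B.card * X.card := by
    rw [← smul_eq_mul (a := B.card)]
    exact Finset.sum_le_card_nsmul _ _ _ h
  rw [← Finset.mul_sum] at h2
  nlinarith [Nat.mul_le_mul_left m h1]

variable {V : Type*} [Fintype V] {H : Digraph V}

/-- If the sets `X v` have few backward edges between them and there is no copy of `H` that takes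
every vertex `v` from `X v`, then a large part of some `X l`, `l` a leaf, is complete to or from a
large part of `X r`, `r` its center. -/
theorem exists_complete_pair (hH : H.IsTournament) (hT : T.IsTournament) (hfree : T.IsFree H)
    (hV : 0 < Fintype.card V) {θ : V → ℕ} (hθ : Function.Injective θ) {z : V → V}
    (hzz : ∀ v, z (z v) = z v)
    (hz : ∀ u v, θ u < θ v → (H.Adj u v ↔ ¬ (z u = v ∨ z v = u)))
    {K : ℕ} (hK : 1 ≤ K) {X : V → Finset α} (hne : ∀ v, (X v).Nonempty)
    (hX : ∀ v, T.Reach F S (· ≠ ·) K (X v))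
    (hleaf : ∀ u v, z u = z v → z u ≠ u → z v ≠ v → θ u < θ v →
      ∀ x ∈ X u, ∀ y ∈ X v, T.Adj x y)
    (hsm : ∀ u v, θ u < θ v → Disjoint (X u) (X v) ∧
        (∀ x ∈ X u,
          2 * Fintype.card V * ((X v).filter fun y => ¬ T.Adj x y).card ≤ (X v).card) ∧
        (∀ y ∈ X v,
          2 * Fintype.card V * ((X u).filter fun x => ¬ T.Adj x y).card ≤ (X u).card)) :
    ∃ r l A C, z l = r ∧ l ≠ r ∧
      T.Reach F S (· ≠ ·) (K + Fintype.card V + 1) A ∧ A ⊆ X r ∧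
      (X r).card ≤ 2 * Fintype.card V * A.card ∧
      (∀ R, T.Reach F S R K (X l) → T.Reach F S R (K + Fintype.card V + 1) C) ∧ C ⊆ X l ∧
      (X l).card ≤ 2 * C.card ∧
      ((∀ a ∈ A, ∀ b ∈ C, T.Adj a b) ∨ ∀ a ∈ A, ∀ b ∈ C, T.Adj b a) := by
  classical
  set h := Fintype.card V with hh
  by_contra hno
  -- `fwd u w x y`: the pair `x`, `y` is forward, as images of `u`, `w`
  let fwd : V → V → α → α → Prop := fun u w x y =>
    (θ u < θ w → T.Adj x y) ∧ (θ w < θ u → T.Adj y x)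
  have hdisj : ∀ u w, u ≠ w → ∀ x ∈ X u, ∀ y ∈ X w, x ≠ y := by
    intro u w huw x hx y hy hxy
    rcases lt_or_gt_of_ne (hθ.ne huw) with hlt | hlt
    · exact Finset.disjoint_left.1 (hsm u w hlt).1 hx (hxy ▸ hy)
    · exact Finset.disjoint_left.1 (hsm w u hlt).1 hy (hxy ▸ hx)
  have hfwd : ∀ u w, u ≠ w → ∀ x ∈ X u,
      2 * h * ((X w).filter fun y => ¬ fwd u w x y).card ≤ (X w).card := by
    intro u w huw x hx
    rcases lt_or_gt_of_ne (hθ.ne huw) with hlt | hlt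
    · simpa [fwd, hlt, hlt.asymm] using (hsm u w hlt).2.1 x hx
    · simpa [fwd, hlt, hlt.asymm] using (hsm w u hlt).2.2 x hx
  have hfwdR : ∀ u w, u ≠ w → ∀ x ∈ S, ∀ (R : α → α → Prop) k A, 1 ≤ k →
      T.Reach F S R k A → T.Reach F S R (k + 1) (A.filter fun y => fwd u w x y) := by
    intro u w huw x hx R k A hk hA
    rcases lt_or_gt_of_ne (hθ.ne huw) with hlt | hlt
    · simpa [fwd, hlt, hlt.asymm] using hA.out hk hx
    · simpa [fwd, hlt, hlt.asymm] using hA.inn hk hx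
  let U : Finset V → Finset V := fun Z => Finset.univ.filter fun u => z u ∈ Z
  have hU : ∀ Z u, u ∈ U Z ↔ z u ∈ Z := fun Z u => by simp [U]
  -- Stars are placed whole: `U Z` consists of the vertices whose center is in `Z`, isolated
  -- vertices being their own centers. Candidates for the others are forward to everything placed;
  -- each placed vertex removes at most a 1/(2h) part of `X w`, so at least half survives to the
  -- end.
  have hmain : ∀ Z : Finset V, ∃ (φ : V → α) (C : V → Finset α),
      (∀ u ∈ U Z, ∀ u' ∈ U Z, H.Adj u u' → T.Adj (φ u) (φ u')) ∧
      ∀ w ∉ U Z, (∀ R, T.Reach F S R K (X w) → T.Reach F S R (K + (U Z).card) (C w)) ∧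
        C w ⊆ X w ∧ 2 * h * (X w \ C w).card ≤ (U Z).card * (X w).card ∧
        ∀ v ∈ C w, ∀ u ∈ U Z, fwd u w (φ u) v := by
    intro Z
    induction Z using Finset.induction_on with
    | empty =>
      have hU0 : U ∅ = ∅ := by simp [U]
      rw [hU0]
      exact ⟨fun v => (hne v).choose, X, by simp, fun w _ => ⟨fun R hR => by simpa using hR,
        subset_rfl, by simp, by simp⟩⟩
    | insert r Z hr ih =>
      obtain ⟨φ, C, hφ, hC⟩ := ih
      by_cases hzr : z r = r
      swap
      · have hU' : U (insert r Z) = U Z := by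
          ext u
          rw [hU, hU, Finset.mem_insert, or_iff_right]
          rintro rfl
          exact hzr (hzz u)
        rw [hU']
        exact ⟨φ, C, hφ, hC⟩
      let B : Finset V := Finset.univ.filter fun u => z u = r
      have hB : ∀ u, u ∈ B ↔ z u = r := fun u => by simp [B]
      have hBU : ∀ u ∈ B, u ∉ U Z := by
        intro u hu hu'
        rw [hU, (hB u).1 hu] at hu'
        exact hr hu'
      have hUB : U (insert r Z) = U Z ∪ B := by
        ext u
        rw [Finset.mem_union, hU, hU, hB, Finset.mem_insert, or_comm]
      have hUBc : (U (insert r Z)).card = (U Z).card + B.card := by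
        rw [hUB, Finset.card_union_of_disjoint]
        exact Finset.disjoint_left.2 fun u hu hu' => hBU u hu' hu
      have hUh : (U Z).card ≤ h := Finset.card_le_univ _
      have hCX : ∀ w ∉ U Z, (X w).card ≤ 2 * (C w).card := by
        intro w hw
        obtain ⟨-, h2, h3, -⟩ := hC w hw
        have h4 : 2 * h * (X w \ C w).card ≤ h * (X w).card :=
          h3.trans (Nat.mul_le_mul_right _ hUh)
        have h5 : 2 * (X w \ C w).card ≤ (X w).card :=
          Nat.le_of_mul_le_mul_left (by linarith) hV
        rw [Finset.card_sdiff_of_subset h2] at h5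
        omega
      have hrB : r ∈ B := (hB r).2 hzr
      have hrU := hBU r hrB
      have hCr : (C r).Nonempty := by
        have := hCX r hrU
        have h2 := (hne r).card_pos
        exact Finset.card_pos.1 (by omega)
      -- The center needs a backward partner among the candidates of each leaf. If no choice of `a`
      -- works, pigeonhole finds one leaf for which a 1/h part of `C r` is entirely forward to `C
      -- l`, which is the excluded complete pair. Edges between leaves need no care, by `hleaf`.
      have hstar : ∃ a ∈ C r, ∀ l, z l = r → l ≠ r → ∃ b ∈ C l, ¬ fwd r l a b := by
        by_contra! hcon
        obtain ⟨l, hl⟩ := exists_card_le_mul_card_filter hCr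
          (fun a l => z l = r ∧ l ≠ r ∧ ∀ b ∈ C l, fwd r l a b) hcon
        have hlr : z l = r ∧ l ≠ r := by
          by_contra hc
          have : (C r).filter (fun a => z l = r ∧ l ≠ r ∧ ∀ b ∈ C l, fwd r l a b) = ∅ :=
            Finset.filter_false_of_mem fun a _ h => hc ⟨h.1, h.2.1⟩
          rw [this, Finset.card_empty, mul_zero] at hl
          have := hCr.card_pos
          omega
        have hlU := hBU l ((hB l).2 hlr.1)
        have hCrR := ((hC r hrU).1 _ (hX r)).mono
          (k' := K + h) (Nat.add_le_add_left hUh _)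
        have hClR := ((hC l hlU).1 _ (hX l)).mono
          (k' := K + h) (Nat.add_le_add_left hUh _)
        refine hno ⟨r, l, (C r).filter fun a => ∀ b ∈ C l, fwd r l a b, C l, hlr.1, hlr.2, ?_,
          (Finset.filter_subset _ _).trans (hC r hrU).2.1, ?_,
          fun R hR => ((hC l hlU).1 R hR).mono (by omega), (hC l hlU).2.1, hCX l hlU, ?_⟩
        · rcases lt_or_gt_of_ne (hθ.ne hlr.2) with hlt | hlt
          · simpa [fwd, hlt, hlt.asymm] using hCrR.completeIn hClR
          · simpa [fwd, hlt, hlt.asymm] using hCrR.completeOut hClR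
        · have h1 := hCX r hrU
          simp only [hlr.1, ne_eq, hlr.2, not_false_eq_true, true_and] at hl
          nlinarith
        · rcases lt_or_gt_of_ne (hθ.ne hlr.2) with hlt | hlt
          · exact Or.inr fun a ha b hb => ((Finset.mem_filter.1 ha).2 b hb).2 hlt
          · exact Or.inl fun a ha b hb => ((Finset.mem_filter.1 ha).2 b hb).1 hlt
      obtain ⟨a, ha, hab⟩ := hstar
      have : Nonempty α := ⟨a⟩
      choose! b hb using hab
      let φ' : V → α := fun u => if z u = r then (if u = r then a else b u) else φ u
      have hφ'U : ∀ u ∈ U Z, φ' u = φ u := by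
        intro u hu
        have : z u ≠ r := fun hc => hBU u ((hB u).2 hc) hu
        simp only [φ', if_neg this]
      have hφ'r : φ' r = a := by simp [φ', hzr]
      have hφ'l : ∀ l, z l = r → l ≠ r → φ' l = b l := fun l h1 h2 => by simp [φ', h1, h2]
      have hφ'C : ∀ u ∈ B, φ' u ∈ C u := by
        intro u hu
        by_cases hur : u = r
        · rw [hur, hφ'r]
          exact ha
        · rw [hφ'l u ((hB u).1 hu) hur]
          exact (hb u ((hB u).1 hu) hur).1
      have hφ'X : ∀ u ∈ B, φ' u ∈ X u := fun u hu => (hC u (hBU u hu)).2.1 (hφ'C u hu)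
      refine ⟨φ', fun w => (C w).filter fun v => ∀ u ∈ B, fwd u w (φ' u) v, ?_, ?_⟩
      · -- edges between two new vertices
        have hnew : ∀ u ∈ B, ∀ u' ∈ B, H.Adj u u' → T.Adj (φ' u) (φ' u') := by
          intro u hu u' hu' huu'
          have hne' := hH.ne_of_adj huu'
          have hxy := hdisj u u' hne' _ (hφ'X u hu) _ (hφ'X u' hu')
          rw [hB] at hu hu'
          rcases lt_or_gt_of_ne (hθ.ne hne') with hlt | hlt
          · have h1 := (hz u u' hlt).1 huu'
            rw [not_or, hu, hu'] at h1
            exact hleaf u u' (hu.trans hu'.symm) (hu ▸ h1.2) (hu' ▸ h1.1) hlt _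
              (hφ'X u ((hB u).2 hu)) _ (hφ'X u' ((hB u').2 hu'))
          · have h1 := (hz u' u hlt).not.1 (hH.asymm huu')
            rw [not_not, hu, hu'] at h1
            rcases h1 with rfl | rfl
            · have h2 := (hb u' hu' hne'.symm).2
              rw [hφ'r, hφ'l u' hu' hne'.symm]
              rw [hφ'r, hφ'l u' hu' hne'.symm] at hxy
              simp only [fwd, hlt, hlt.asymm, false_imp_iff, true_imp_iff, true_and] at h2
              exact hT.adj_of_not_adj hxy.symm h2
            · have h2 := (hb u hu hne').2
              rw [hφ'r, hφ'l u hu hne']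
              rw [hφ'r, hφ'l u hu hne'] at hxy
              simp only [fwd, hlt, hlt.asymm, false_imp_iff, true_imp_iff, and_true] at h2
              exact hT.adj_of_not_adj hxy.symm h2
        -- edges between a new and an old vertex are forward
        have hmix : ∀ u ∈ B, ∀ u' ∈ U Z, (H.Adj u u' → T.Adj (φ' u) (φ' u')) ∧
            (H.Adj u' u → T.Adj (φ' u') (φ' u)) := by
          intro u hu u' hu'
          have h1 := (hC u (hBU u hu)).2.2.2 _ (hφ'C u hu) u' hu'
          rw [hφ'U u' hu']
          have h2 : z u ≠ u' := by
            rintro rfl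
            rw [hU, hzz, ← hU] at hu'
            exact hBU u hu hu'
          have h3 : z u' ≠ u := by
            rintro rfl
            rw [hB, hzz] at hu
            rw [hU, hu] at hu'
            exact hr hu'
          have hne' : u ≠ u' := by
            rintro rfl
            exact hBU u hu hu'
          rcases lt_or_gt_of_ne (hθ.ne hne') with hlt | hlt
          · have h4 := (hz u u' hlt).2 (by tauto)
            exact ⟨fun _ => h1.2 hlt, fun h5 => absurd h5 (hH.asymm h4)⟩
          · have h4 := (hz u' u hlt).2 (by tauto)
            exact ⟨fun h5 => absurd h5 (hH.asymm h4), fun _ => h1.1 hlt⟩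
        intro u hu u' hu' huu'
        rw [hUB, Finset.mem_union] at hu hu'
        rcases hu with hu | hu <;> rcases hu' with hu' | hu'
        · rw [hφ'U u hu, hφ'U u' hu']
          exact hφ u hu u' hu' huu'
        · exact (hmix u' hu' u hu).2 huu'
        · exact (hmix u hu u' hu').1 huu'
        · exact hnew u hu u' hu' huu'
      · intro w hw
        rw [hUB, Finset.mem_union, not_or] at hw
        obtain ⟨h1, h2, h3, h4⟩ := hC w hw.1
        have hBw : ∀ u ∈ B, u ≠ w := by
          rintro u hu rfl
          exact hw.2 hu
        rw [hUBc]
        refine ⟨fun R hR => ?_, (Finset.filter_subset _ _).trans h2, ?_, ?_⟩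
        · rw [← add_assoc]
          refine Reach.filter_forall B (fun u v => fwd u w (φ' u) v) (fun u hu R k' A hk' hA => ?_)
            (h1 R hR)
          refine hfwdR u w (hBw u hu) _ ?_ R k' A (by omega) hA
          simpa using (hX u).subset (hφ'X u hu)
        · exact card_mul_sdiff_filter_forall_le B (X w) (C w) (fun u v => fwd u w (φ' u) v) h3
            fun u hu => hfwd u w (hBw u hu) _ (hφ'X u hu)
        · intro v hv u hu
          rw [Finset.mem_filter] at hv
          rw [hUB, Finset.mem_union] at hu
          rcases hu with hu | hu
          · rw [hφ'U u hu]
            exact h4 v hv.1 u hu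
          · exact hv.2 u hu
  obtain ⟨φ, C, hφ, -⟩ := hmain Finset.univ
  exact not_isFree_of_hom hH hT φ (fun u v => hφ u (by simp [hU]) v (by simp [hU])) hfree

end

end Digraph

namespace Digraph

/-! ### The size of the transitive sets that are found -/

section

variable {α : Type*} [DecidableEq α] {T : Digraph α} [DecidableRel T.Adj]
  {F : List α → List α} {S : List α}

/-- One round applies the recursive call to the list behind `A`, one more concatenates its result
with the list behind `B`, in the order given by `hAB`. -/
theorem exists_chain_of_complete (hFp : ∀ X : List α, (F X).Pairwise T.Adj)
    (hFs : ∀ X, F X ⊆ X) {k : ℕ} {A B : Finset α} (hT : T.IsTournament)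
    (hA : T.Reach F S (· ≠ ·) k A) (hB : T.Reach F S T.Adj k B)
    (hAB : (∀ a ∈ A, ∀ b ∈ B, T.Adj a b) ∨ ∀ a ∈ A, ∀ b ∈ B, T.Adj b a) :
    ∃ X : List α, X.Nodup ∧ X.length = A.card ∧ ∃ Z ∈ T.search F S (k + 2), Z.Pairwise T.Adj ∧
      Z.length = (F X).length + B.card := by
  obtain ⟨X, hX1, hX2, hX3, rfl⟩ := hA
  obtain ⟨Y, hY1, hY2, hY3, rfl⟩ := hB
  have hFX : F X ∈ T.search F S (k + 1) := T.mem_search_succ F S hX1 hX1 hX1 (by simp [derived])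
  have hY1' := T.search_mono F S (Nat.le_succ k) hY1
  have hnd : Y.Nodup := hY2.imp hT.ne_of_adj
  refine ⟨X, hX2, (List.toFinset_card_of_nodup hX2).symm, ?_⟩
  rw [List.toFinset_card_of_nodup hnd]
  simp only [List.mem_toFinset] at hAB
  rcases hAB with h | h
  · exact ⟨F X ++ Y, T.mem_search_succ F S hFX hY1' hY1' (by simp [derived]),
      List.pairwise_append.2 ⟨hFp X, hY2, fun a ha b hb => h a (hFs X ha) b hb⟩, by simp⟩
  · exact ⟨Y ++ F X, T.mem_search_succ F S hY1' hFX hFX (by simp [derived]),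
      List.pairwise_append.2 ⟨hY2, hFp X, fun b hb a ha => h a (hFs X ha) b hb⟩, by
        simp [add_comm]⟩

/-- The classical logarithmic bound: a vertex together with a transitive set in the larger of its
two neighbourhoods, which has at least ⌊n/2⌋ vertices. It handles small inputs and makes recursive
results long enough to be cut into h pieces. -/
theorem exists_chain_log (hT : T.IsTournament) (hFp : ∀ X : List α, (F X).Pairwise T.Adj)
    (hFs : ∀ X, F X ⊆ X) (hS : S.Nodup) (hn : 2 ≤ S.length)
    (hF : ∀ X : List α, X.Nodup → X ≠ [] →
      Nat.log 2 (min X.length (S.length / 2)) + 1 ≤ (F X).length) :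
    ∃ Z ∈ T.search F S 4, Z.Pairwise T.Adj ∧ Nat.log 2 S.length + 1 ≤ Z.length := by
  obtain ⟨v, hv⟩ : ∃ v, v ∈ S := List.exists_mem_of_length_pos (by omega)
  have hSr : T.Reach F S (· ≠ ·) 1 S.toFinset := reach_self hS 1
  have hvr : T.Reach F S T.Adj 2 {v} := (reach_singleton _ hv).mono (by omega)
  set O := S.toFinset.filter fun u => T.Adj v u with hO
  set I := S.toFinset.filter fun u => T.Adj u v with hI
  have hOI : S.length - 1 ≤ O.card + I.card := by
    rw [← List.toFinset_card_of_nodup hS, ← Finset.card_erase_of_mem (List.mem_toFinset.2 hv)]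
    refine (Finset.card_le_card fun u hu => ?_).trans (Finset.card_union_le _ _)
    rw [Finset.mem_erase] at hu
    simp only [hO, hI, Finset.mem_union, Finset.mem_filter, hu.2, true_and]
    by_cases h : T.Adj v u
    · exact Or.inl h
    · exact Or.inr (hT.adj_of_not_adj hu.1.symm h)
  have key : ∀ A : Finset α, T.Reach F S (· ≠ ·) 2 A → S.length / 2 ≤ A.card →
      ((∀ a ∈ A, ∀ b ∈ ({v} : Finset α), T.Adj a b) ∨
        ∀ a ∈ A, ∀ b ∈ ({v} : Finset α), T.Adj b a) →
      ∃ Z ∈ T.search F S 4, Z.Pairwise T.Adj ∧ Nat.log 2 S.length + 1 ≤ Z.length := by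
    intro A hA hAc hc
    obtain ⟨X, hX, hXA, Z, hZ1, hZ2, hZ3⟩ := exists_chain_of_complete hFp hFs hT hA hvr hc
    refine ⟨Z, hZ1, hZ2, ?_⟩
    have h1 := hF X hX (by rintro rfl; simp at hXA; omega)
    rw [hXA, min_eq_right hAc, Nat.log_div_base] at h1
    rw [hZ3, Finset.card_singleton]
    omega
  by_cases h : S.length / 2 ≤ O.card
  · exact key O (hSr.out le_rfl hv) h (Or.inr fun a ha b hb => by
      rw [Finset.mem_singleton.1 hb]
      exact (Finset.mem_filter.1 ha).2)
  · exact key I (hSr.inn le_rfl hv) (by omega) (Or.inl fun a ha b hb => by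
      rw [Finset.mem_singleton.1 hb]
      exact (Finset.mem_filter.1 ha).2)

/-- The index of the block of a vertex of a galaxy: every center is a block, and the other vertices
between two consecutive centers are a block. -/
theorem exists_block_index {V : Type*} [Fintype V] {θ : V → ℕ} (hθ : Function.Injective θ)
    (c : V → Prop) :
    ∃ q : V → ℕ, (∀ v, q v < 2 * Fintype.card V + 1) ∧ (∀ u v, θ u < θ v → q u ≤ q v) ∧
      (∀ v w, c v → q w = q v → w = v) ∧
      ∀ u v, θ u < θ v → ¬ c u → ¬ c v → (∀ w, c w → ¬ (θ u < θ w ∧ θ w < θ v)) → q u = q v := by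
  classical
  let N : V → Finset V := fun v => Finset.univ.filter fun w => c w ∧ θ w < θ v
  have hN : ∀ v w, w ∈ N v ↔ c w ∧ θ w < θ v := fun v w => by simp [N]
  have hNle : ∀ u v, θ u < θ v → N u ⊆ N v := fun u v huv w hw => by
    rw [hN] at hw ⊢
    exact ⟨hw.1, hw.2.trans huv⟩
  have hNlt : ∀ u v, θ u < θ v → c u → (N u).card < (N v).card := fun u v huv hu =>
    Finset.card_lt_card (Finset.ssubset_iff_of_subset (hNle u v huv) |>.2
      ⟨u, (hN v u).2 ⟨hu, huv⟩, fun h => lt_irrefl _ ((hN u u).1 h).2⟩)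
  -- Twice the number of earlier centers, plus one for a center: centers get distinct odd indices,
  -- the gaps between them even ones.
  refine ⟨fun v => 2 * (N v).card + if c v then 1 else 0, fun v => ?_, fun u v huv => ?_,
    fun v w hv hwv => ?_, fun u v huv hu hv h => ?_⟩
  · have : (N v).card < Fintype.card V := by
      rw [← Finset.card_univ]
      exact Finset.card_lt_card (Finset.ssubset_univ_iff.2 fun h =>
        lt_irrefl _ ((hN v v).1 (h ▸ Finset.mem_univ v)).2)
    dsimp only
    split_ifs <;> omega
  · dsimp only
    by_cases hu : c u
    · have := hNlt u v huv hu
      split_ifs <;> omega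
    · have := Finset.card_le_card (hNle u v huv)
      rw [if_neg hu]
      omega
  · dsimp only at hwv
    rw [if_pos hv] at hwv
    by_cases hw : c w
    · rw [if_pos hw] at hwv
      by_contra hne
      rcases lt_or_gt_of_ne (hθ.ne hne) with hlt | hlt
      · have := hNlt w v hlt hw
        omega
      · have := hNlt v w hlt hv
        omega
    · rw [if_neg hw] at hwv
      omega
  · have : N u = N v := by
      refine (hNle u v huv).antisymm fun w hw => ?_
      rw [hN] at hw ⊢
      refine ⟨hw.1, ?_⟩
      by_contra hlt
      rcases (not_lt.1 hlt).lt_or_eq with h1 | h1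
      · exact h w hw.1 ⟨h1, hw.2⟩
      · exact hu (hθ h1 ▸ hw.1)
    dsimp only
    rw [if_neg hu, if_neg hv, this]

variable {V : Type*} [Fintype V] {H : Digraph V}

/-- The base of the loss of density of one block. -/
def blockLoss (h : ℕ) : ℕ := 8 * h ^ 2 * (8 * h * (8 * h ^ 2)) ^ h

/-- The loss of density in the search for a galaxy with `h` vertices. -/
def totalLoss (h : ℕ) : ℕ := 4 * h * blockLoss h ^ (2 * h + 1)

/-- The number of rounds of the search for a galaxy with `h` vertices. -/
def searchDepth (h : ℕ) : ℕ := 1 + (2 * h + 1) * (2 * h + 8) + h + h + 1 + 2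

/-- The inductive step for large inputs. The recursion gives (n/G)^ε vertices in the center's set
and the leaf's piece adds a 1/(8h) part of this; `hG` says that together they reach n^ε. -/
theorem exists_chain_rpow (hH : H.IsGalaxy) (hT : T.IsTournament) (hfree : T.IsFree H)
    (hV : 0 < Fintype.card V) (hFp : ∀ X : List α, (F X).Pairwise T.Adj)
    (hFs : ∀ X, F X ⊆ X) (hS : S.Nodup) {ε : ℝ} (hε : 0 < ε)
    (hG : (totalLoss (Fintype.card V) : ℝ) ^ ε ≤ 1 + 1 / (8 * Fintype.card V))
    (hn : totalLoss (Fintype.card V) * 2 ^ Fintype.card V ≤ S.length)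
    (hF : ∀ X : List α, X.Nodup → X ≠ [] →
      Nat.log 2 (min X.length (S.length / 2)) + 1 ≤ (F X).length ∧
      ((min X.length (S.length / 2) : ℕ) : ℝ) ^ ε ≤ (F X).length) :
    ∃ Z ∈ T.search F S (searchDepth (Fintype.card V)), Z.Pairwise T.Adj ∧
      (S.length : ℝ) ^ ε ≤ Z.length := by
  classical
  obtain ⟨hHt, θ, hgal⟩ := hH
  obtain ⟨τ, hτ, hτlt, z, hzz, hz, hzb⟩ : ∃ τ : V → ℕ, Function.Injective τ ∧
      (∀ v, τ v < Fintype.card V) ∧ ∃ z : V → V, (∀ v, z (z v) = z v) ∧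
      (∀ u v, τ u < τ v → (H.Adj u v ↔ ¬ (z u = v ∨ z v = u))) ∧
      ∀ u v w w', z u = z v → z u ≠ u → z v ≠ v → w' ≠ w → z w' = w →
        ¬ (τ u < τ w ∧ τ w < τ v) :=
    ⟨fun v => θ v, fun u v huv => θ.injective (Fin.ext huv), fun v => (θ v).2,
      hgal.exists_center hHt⟩
  clear hgal θ
  set h := Fintype.card V with hh
  let c : V → Prop := fun w => ∃ w', w' ≠ w ∧ z w' = w
  have hcz : ∀ w, c w → z w = w := by
    rintro w ⟨w', -, rfl⟩
    exact hzz w'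
  obtain ⟨q, hq, hqθ, hqc, hqz⟩ := exists_block_index hτ c
  set n := S.length with hnS
  set C := blockLoss h with hC
  set M := 2 * h + 1 with hM
  have hCM3 : 3 ≤ C ^ M := by
    have h1 : 1 ≤ h ^ 2 := Nat.one_le_pow _ _ hV
    have h2 : 1 ≤ (8 * h * (8 * h ^ 2)) ^ h := Nat.one_le_pow _ _ (by positivity)
    have h3 : 8 ≤ C := by
      rw [hC, blockLoss]
      nlinarith
    calc 3 ≤ C := by omega
      _ ≤ C ^ M := Nat.le_self_pow (by omega) C
  have hGdef : totalLoss h = 4 * h * C ^ M := rfl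
  set G := totalLoss h with hGG
  have hCMG : C ^ M ≤ G := by
    rw [hGdef]
    nlinarith
  have hGpos : 0 < G := by omega
  have h2h : 2 ^ h ≤ n / G := (Nat.le_div_iff_mul_le hGpos).2 (by rwa [mul_comm])
  have hnG : 0 < n := lt_of_lt_of_le (by positivity) hn
  -- the size of the recursive calls
  have hmin : ∀ D : ℕ, 3 ≤ D → ∀ m, n ≤ D * m → n ≤ D * min m (n / 2) := by
    intro D hD m hm
    rcases min_choice m (n / 2) with h1 | h1 <;> rw [h1]
    · exact hm
    · have hGn : G ≤ n := (Nat.le_mul_of_pos_right G (by positivity)).trans hn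
      have h3 : 3 ≤ n := hCM3.trans (hCMG.trans hGn)
      -- Halving the input of recursive calls does no harm, as all densities in use are at most 1/3.
      calc n ≤ 3 * (n / 2) := by omega
        _ ≤ D * (n / 2) := Nat.mul_le_mul_right _ hD
  have hFrpow : ∀ D : ℕ, 3 ≤ D → ∀ X : List α, X.Nodup → n ≤ D * X.length →
      ((n : ℝ) / D) ^ ε ≤ (F X).length := by
    intro D hD X hX hXn
    have hX0 : X ≠ [] := by
      rintro rfl
      simp at hXn
      omega
    refine le_trans (Real.rpow_le_rpow (by positivity) ?_ hε.le) (hF X hX hX0).2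
    rw [div_le_iff₀ (by positivity), mul_comm]
    exact_mod_cast hmin D hD _ hXn
  -- The length of a piece: 2h rather than h pays for rounding down when the transitive set is cut
  -- into h pieces.
  set β : ℝ := ((n : ℝ) / (C ^ M : ℕ)) ^ ε / (2 * h) with hβ
  have hβpos : 0 < β := by positivity
  have hpiece : ∀ k A, T.Reach F S (· ≠ ·) k A → n ≤ C ^ M * A.card →
      ∃ X : V → Finset α, (∀ v, T.Reach F S T.Adj (k + 3) (X v) ∧ X v ⊆ A ∧ ⌈β⌉₊ ≤ (X v).card) ∧
        ∀ u v, τ u < τ v → ∀ x ∈ X u, ∀ y ∈ X v, T.Adj x y := by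
    intro k A hA hAn
    obtain ⟨X, hX1, hX2, hX3, rfl⟩ := hA
    rw [List.toFinset_card_of_nodup hX2] at hAn
    have hFX : T.Reach F S T.Adj (k + 1) (F X).toFinset :=
      ⟨F X, T.mem_search_succ F S hX1 hX1 hX1 (by simp [derived]), hFp X,
        List.Subset.trans (hFs X) hX3, rfl⟩
    obtain ⟨Z, hZ1, hZ2⟩ := hFX.pieces (fun _ _ => hT.ne_of_adj) h
    have hcard : (F X).toFinset.card = (F X).length :=
      List.toFinset_card_of_nodup ((hFp X).imp hT.ne_of_adj)
    refine ⟨fun v => Z ⟨τ v, hτlt v⟩, fun v => ⟨(hZ1 _).1, (hZ1 _).2.1.trans fun x hx => ?_, ?_⟩,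
      fun u v huv => hZ2 _ _ huv⟩
    · rw [List.mem_toFinset] at hx ⊢
      exact hFs X hx
    · rw [(hZ1 _).2.2, hcard, Nat.ceil_le, hβ, div_le_iff₀ (by positivity)]
      refine (hFrpow _ hCM3 X hX2 hAn).trans ?_
      have hX0 : X ≠ [] := by
        rintro rfl
        simp at hAn
        omega
      -- The logarithmic bound makes the transitive set longer than h, so no piece is empty; this
      -- uses the factor 2^h in `hn`.
      have h1 : h ≤ Nat.log 2 (min X.length (n / 2)) := by
        refine Nat.le_log_of_pow_le (by norm_num) (h2h.trans ?_)
        refine Nat.div_le_of_le_mul ?_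
        exact (hmin _ hCM3 _ hAn).trans (Nat.mul_le_mul_right _ hCMG)
      have h2 := (hF X hX2 hX0).1
      have h3 := Nat.lt_mul_div_succ (F X).length hV
      have h4 : 1 ≤ (F X).length / h := (Nat.one_le_div_iff hV).2 (by omega)
      have h5 : (F X).length ≤ ((F X).length / h) * (2 * h) := by nlinarith
      exact_mod_cast h5
  have hlarge : C ^ M * h ≤ n := by
    refine le_trans ?_ hn
    have := Nat.one_le_two_pow (n := h)
    rw [hGdef]
    nlinarith [Nat.zero_le (h * C ^ M)]
  obtain ⟨K, X, hK, hX1, hX2, hX3⟩ := exists_smooth_family hHt hT hfree hV hS τ q hq hqθ c hqc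
    hC hlarge (Nat.ceil_pos.2 hβpos) hpiece
  have hcn : ∀ u, z u ≠ u → ¬ c u := fun u hu hc => hu (hcz u hc)
  obtain ⟨r, l, A, B, hlr, hne, hA, -, hAc, hB, -, hBc, hAB⟩ := exists_complete_pair hHt hT hfree hV
    hτ hzz hz (by omega) (fun v => (hX1 v).1) (fun v => (hX1 v).2.1)
    (fun u v huv hu hv hlt => hX2 u v (hqz u v hlt (hcn u hu) (hcn v hv) (by
      rintro w ⟨w', hw', hw⟩ hbet
      exact hzb u v w w' huv hu hv hw' hw hbet)) hlt) hX3
  have hrc : c r := ⟨l, hne, hlr⟩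
  have hlc : ¬ c l := hcn l (by rw [hlr]; exact hne.symm)
  obtain ⟨hlR, hlm⟩ := (hX1 l).2.2.1 hlc
  obtain ⟨Y, hY, hYA, Z, hZ1, hZ2, hZ3⟩ := exists_chain_of_complete hFp hFs hT hA (hB _ hlR) hAB
  have hdepth : K + h + 1 + 2 = searchDepth h := by
    rw [hK, searchDepth]
  rw [hdepth] at hZ1
  refine ⟨Z, hZ1, hZ2, ?_⟩
  -- The loss G is made up of C^M for the block, 2 for smoothing and 2h for the complete pair.
  have hYn : n ≤ G * Y.length := by
    rw [hYA]
    calc n ≤ 2 * C ^ M * (X r).card := (hX1 r).2.2.2 hrc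
      _ ≤ 2 * C ^ M * (2 * h * A.card) := Nat.mul_le_mul_left _ hAc
      _ = G * A.card := by rw [hGdef]; ring
  have h1 := hFrpow G (hCM3.trans hCMG) Y hY hYn
  have h2 : β ≤ 4 * B.card := by
    have : ⌈β⌉₊ ≤ 4 * B.card := hlm.trans (by omega)
    calc β ≤ ⌈β⌉₊ := Nat.le_ceil β
      _ ≤ 4 * B.card := by exact_mod_cast this
  have h3 : ((n : ℝ) / G) ^ ε / (2 * h) ≤ β := by
    rw [hβ]
    gcongr
  have h4 : (n : ℝ) ^ ε = ((n : ℝ) / G) ^ ε * (G : ℝ) ^ ε := by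
    rw [← Real.mul_rpow (by positivity) (by positivity), div_mul_cancel₀ _ (by positivity)]
  have h5 : ((n : ℝ) / G) ^ ε * (1 + 1 / (8 * h)) =
      ((n : ℝ) / G) ^ ε + ((n : ℝ) / G) ^ ε / (2 * h) / 4 := by
    field_simp
    ring
  have h6 : (Z.length : ℝ) = (F Y).length + B.card := by exact_mod_cast hZ3
  calc (n : ℝ) ^ ε ≤ ((n : ℝ) / G) ^ ε * (1 + 1 / (8 * h)) := by
        rw [h4]
        exact mul_le_mul_of_nonneg_left hG (by positivity)
    _ ≤ Z.length := by
        rw [h5, h6]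
        linarith

end

section

variable {α : Type*} (T : Digraph α) [DecidableRel T.Adj]

theorem pairwise_findChain (K : ℕ) (S : List α) : (T.findChain K S).Pairwise T.Adj := by
  rw [findChain]
  split_ifs with h
  · match S, h with
    | [], _ => simp
    | [a], _ => simp
  · exact T.pairwise_longestChain _

theorem findChain_subset (K : ℕ) (S : List α) : T.findChain K S ⊆ S := by
  induction hn : S.length using Nat.strong_induction_on generalizing S with
  | _ n ih =>
    rw [findChain]
    split_ifs with h
    · exact List.Subset.refl S
    · rcases T.longestChain_mem
        (T.search (fun X => T.findChain K (X.take (S.length / 2))) S K) with h1 | h1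
      · refine T.subset_of_mem_search _ S (fun X => ?_) h1
        refine List.Subset.trans (ih _ ?_ _ rfl) (List.take_subset _ _)
        simp only [List.length_take]
        omega
      · rw [h1]
        exact List.nil_subset S

end

/-- Both bounds are proved by one induction because the step for the power uses the logarithmic
bound for the recursive calls. -/
theorem findChain_large {α V : Type*} [DecidableEq α] [Fintype V] {H : Digraph V}
    {T : Digraph α} [DecidableRel T.Adj] (hH : H.IsGalaxy) (hT : T.IsTournament)
    (hfree : T.IsFree H) (hV : 0 < Fintype.card V) {ε : ℝ} (hε : 0 < ε)
    (hG : (totalLoss (Fintype.card V) : ℝ) ^ ε ≤ 1 + 1 / (8 * Fintype.card V))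
    (hG2 : ((totalLoss (Fintype.card V) * 2 ^ Fintype.card V : ℕ) : ℝ) ^ ε ≤ 2) {S : List α}
    (hS : S.Nodup) (hne : S ≠ []) :
    Nat.log 2 S.length + 1 ≤ (T.findChain (searchDepth (Fintype.card V)) S).length ∧
    (S.length : ℝ) ^ ε ≤ (T.findChain (searchDepth (Fintype.card V)) S).length := by
  set K := searchDepth (Fintype.card V) with hK
  induction hn : S.length using Nat.strong_induction_on generalizing S with
  | _ n ih =>
    subst hn
    have hpos : 0 < S.length := List.length_pos_iff.2 hne
    by_cases h1 : S.length ≤ 1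
    · have h2 : S.length = 1 := by omega
      rw [findChain, dif_pos h1, h2]
      simp
    · set F : List α → List α := fun X => T.findChain K (X.take (S.length / 2)) with hFdef
      have hFp : ∀ X, (F X).Pairwise T.Adj := fun X => T.pairwise_findChain K _
      have hFs : ∀ X, F X ⊆ X := fun X =>
        List.Subset.trans (T.findChain_subset K _) (List.take_subset _ _)
      have hF : ∀ X : List α, X.Nodup → X ≠ [] →
          Nat.log 2 (min X.length (S.length / 2)) + 1 ≤ (F X).length ∧
          ((min X.length (S.length / 2) : ℕ) : ℝ) ^ ε ≤ (F X).length := by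
        intro X hX hX0
        have hXpos : 0 < X.length := List.length_pos_iff.2 hX0
        have hlen : (X.take (S.length / 2)).length = min X.length (S.length / 2) := by
          rw [List.length_take, min_comm]
        refine ih _ (by omega) (hX.sublist (List.take_sublist _ _)) ?_ hlen
        rw [← List.length_pos_iff, hlen]
        omega
      have hfind : T.findChain K S = T.longestChain (T.search F S K) := by
        rw [findChain, dif_neg h1]
      have hlog : Nat.log 2 S.length + 1 ≤ (T.findChain K S).length := by
        obtain ⟨Z, hZ1, hZ2, hZ3⟩ := exists_chain_log hT hFp hFs hS (by omega)
          fun X hX hX0 => (hF X hX hX0).1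
        rw [hfind]
        refine hZ3.trans (T.length_le_longestChain (T.search_mono F S ?_ hZ1) hZ2)
        rw [hK, searchDepth]
        omega
      refine ⟨hlog, ?_⟩
      -- Below the threshold n^ε is at most 2, and any two vertices form a transitive set.
      by_cases hlt : S.length < totalLoss (Fintype.card V) * 2 ^ Fintype.card V
      · have h2 : (S.length : ℝ) ^ ε ≤ 2 := le_trans
          (Real.rpow_le_rpow (by positivity) (by exact_mod_cast hlt.le) hε.le) hG2
        have h3 : 1 ≤ Nat.log 2 S.length := Nat.le_log_of_pow_le (by norm_num) (by omega)
        have h4 : 2 ≤ (T.findChain K S).length := by omega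
        exact h2.trans (by exact_mod_cast h4)
      · obtain ⟨Z, hZ1, hZ2, hZ3⟩ := exists_chain_rpow hH hT hfree hV hFp hFs hS hε hG
          (not_lt.1 hlt) hF
        refine hZ3.trans ?_
        rw [hfind]
        exact_mod_cast T.length_le_longestChain hZ1 hZ2

/-! ### Numerical estimates for the exponent -/

theorem totalLoss_mul_two_pow_le {h : ℕ} (hh : 2 ≤ h) :
    totalLoss h * 2 ^ h ≤ h ^ (30 * h ^ 2) := by
  have h4 : 4 ≤ h ^ 2 := Nat.pow_le_pow_left hh 2
  have h8 : 8 ≤ h ^ 3 := Nat.pow_le_pow_left hh 3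
  have hC : blockLoss h ≤ h ^ (5 + 9 * h) := by
    calc blockLoss h ≤ h ^ 3 * h ^ 2 * (h ^ 3 * h * (h ^ 3 * h ^ 2)) ^ h := by
          rw [blockLoss]; gcongr
      _ = h ^ (5 + 9 * h) := by
          rw [show h ^ 3 * h * (h ^ 3 * h ^ 2) = h ^ 9 by ring, ← pow_mul, ← pow_add, ← pow_add]
  calc totalLoss h * 2 ^ h ≤ (h ^ 2 * h * (h ^ (5 + 9 * h)) ^ (2 * h + 1)) * h ^ h := by
        rw [totalLoss]; gcongr
    _ = h ^ (3 + (5 + 9 * h) * (2 * h + 1) + h) := by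
        rw [← pow_mul, ← pow_succ, ← pow_add, ← pow_add]
    _ ≤ h ^ (30 * h ^ 2) := Nat.pow_le_pow_right (by omega) (by nlinarith)

/-- The loss is at most exp(30 h² log h), so its ε-th power is at most exp(0.03/h³), well below 1 +
1/(8h). An exponent of order 1/(h³ log h) would do for this estimate. -/
theorem rpow_totalLoss_le {h : ℕ} (hh : 2 ≤ h) {ε : ℝ}
    (hε : ε = 1 / 1000 / ((h : ℝ) ^ 5 * Real.log h)) :
    (totalLoss h : ℝ) ^ ε ≤ 1 + 1 / (8 * h) ∧ ((totalLoss h * 2 ^ h : ℕ) : ℝ) ^ ε ≤ 2 := by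
  have hh' : (2 : ℝ) ≤ h := by exact_mod_cast hh
  have hlog : 0 < Real.log h := Real.log_pos (by linarith)
  have hε0 : 0 < ε := by rw [hε]; positivity
  have hle : ((totalLoss h * 2 ^ h : ℕ) : ℝ) ^ ε ≤ 1 + 1 / (8 * h) := by
    have h1 : ((totalLoss h * 2 ^ h : ℕ) : ℝ) ≤ (h : ℝ) ^ ((30 * h ^ 2 : ℕ) : ℝ) := by
      rw [Real.rpow_natCast]
      exact_mod_cast totalLoss_mul_two_pow_le hh
    have h2 : (h : ℝ) ^ (((30 * h ^ 2 : ℕ) : ℝ) * ε) = Real.exp (3 / 100 / (h : ℝ) ^ 3) := by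
      rw [Real.rpow_def_of_pos (by linarith), hε]
      congr 1
      push_cast
      field_simp
      norm_num
    calc ((totalLoss h * 2 ^ h : ℕ) : ℝ) ^ ε ≤ ((h : ℝ) ^ ((30 * h ^ 2 : ℕ) : ℝ)) ^ ε :=
          Real.rpow_le_rpow (by positivity) h1 hε0.le
      _ = Real.exp (3 / 100 / (h : ℝ) ^ 3) := by
          rw [← Real.rpow_mul (by positivity), h2]
      _ ≤ 1 + 2 * (3 / 100 / (h : ℝ) ^ 3) := by
          have h3 : 3 / 100 / (h : ℝ) ^ 3 ≤ 1 := by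
            rw [div_le_one (by positivity)]
            nlinarith [sq_nonneg ((h : ℝ) - 1), pow_pos (show (0 : ℝ) < h by linarith) 3,
              pow_le_pow_left₀ (by norm_num) hh' 3]
          have h4 : 0 ≤ 3 / 100 / (h : ℝ) ^ 3 := by positivity
          have := Real.exp_bound_div_one_sub_of_interval h4 (by
            rw [div_lt_one (by positivity)]
            nlinarith [pow_le_pow_left₀ (by norm_num) hh' 3])
          have h5 : 3 / 100 / (h : ℝ) ^ 3 ≤ 1 / 2 := by
            rw [div_le_iff₀ (by positivity)]
            nlinarith [pow_le_pow_left₀ (by norm_num) hh' 3]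
          refine this.trans ?_
          rw [div_le_iff₀ (by linarith)]
          nlinarith
      _ ≤ 1 + 1 / (8 * h) := by
          have : 2 * (3 / 100 / (h : ℝ) ^ 3) ≤ 1 / (8 * h) := by
            rw [← mul_div_assoc, ← mul_div_assoc, div_le_div_iff₀ (by positivity) (by positivity)]
            have : (4 : ℝ) ≤ (h : ℝ) ^ 2 := by nlinarith
            nlinarith [mul_le_mul_of_nonneg_right this (show (0 : ℝ) ≤ h by linarith)]
          linarith
  refine ⟨le_trans (Real.rpow_le_rpow (by positivity) ?_ hε0.le) hle, hle.trans ?_⟩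
  · exact_mod_cast Nat.le_mul_of_pos_right _ (by positivity)
  · have : 1 / (8 * (h : ℝ)) ≤ 1 := by
      rw [div_le_one (by positivity)]
      linarith
    linarith

end Digraph

namespace Digraph

/-! ### Greedy colouring -/

section

variable {α : Type*} [DecidableEq α] (T : Digraph α) [DecidableRel T.Adj]

/-- Transitive sets that cover `R`: remove the one that the search finds, and repeat; the second
argument bounds the number of repetitions. -/
def chainCover (K : ℕ) : ℕ → List α → List (List α)
  | 0, _ => []
  | m + 1, R => if R = [] then [] else
      T.findChain K R :: chainCover K m (R.filter fun v => v ∉ T.findChain K R)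

theorem pairwise_of_mem_chainCover {K m : ℕ} {R X : List α} (h : X ∈ T.chainCover K m R) :
    X.Pairwise T.Adj := by
  induction m generalizing R with
  | zero => simp [chainCover] at h
  | succ m ih =>
    rw [chainCover] at h
    split_ifs at h with hR
    · simp at h
    · rcases List.mem_cons.1 h with rfl | h
      exacts [T.pairwise_findChain K R, ih h]

theorem length_filter_notMem_findChain (hT : T.IsTournament) (K : ℕ) {R : List α}
    (hR : R.Nodup) : (R.filter fun v => v ∉ T.findChain K R).length +
      (T.findChain K R).length = R.length := by
  have hX : (T.findChain K R).Nodup := (T.pairwise_findChain K R).imp hT.ne_of_adj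
  rw [← List.toFinset_card_of_nodup hX, ← List.toFinset_card_of_nodup hR,
    ← List.toFinset_card_of_nodup (hR.filter _), ← Finset.card_union_of_disjoint]
  · congr 1
    ext v
    simp only [Finset.mem_union, List.mem_toFinset, List.mem_filter, decide_eq_true_eq]
    have := @T.findChain_subset _ _ K R v
    tauto
  · rw [Finset.disjoint_left]
    simp

theorem exists_mem_chainCover (hT : T.IsTournament) {K m : ℕ} {R : List α} (hR : R.Nodup)
    (hm : R.length ≤ m) (hK : ∀ R' : List α, R'.Nodup → R' ≠ [] → T.findChain K R' ≠ [])
    {v : α} (hv : v ∈ R) : ∃ X ∈ T.chainCover K m R, v ∈ X := by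
  induction m generalizing R with
  | zero =>
    rw [List.length_eq_zero_iff.1 (Nat.le_zero.1 hm)] at hv
    simp at hv
  | succ m ih =>
    have hR0 : R ≠ [] := List.ne_nil_of_mem hv
    rw [chainCover, if_neg hR0]
    by_cases hvX : v ∈ T.findChain K R
    · exact ⟨_, List.mem_cons_self, hvX⟩
    · have h1 := T.length_filter_notMem_findChain hT K hR
      have h2 := List.length_pos_iff.2 (hK R hR hR0)
      obtain ⟨X, hX, hvX'⟩ := ih (R := R.filter fun v => v ∉ T.findChain K R) (hR.filter _)
        (by omega) (by simp [hv, hvX])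
      exact ⟨X, List.mem_cons_of_mem _ hX, hvX'⟩

/-- The potential r^(1-ε)/(1-ε), with r the number of remaining vertices, drops by at least 1
whenever r^ε vertices are removed. This is Bernoulli's inequality for an exponent below 1, and it
avoids a logarithmic factor. -/
theorem length_chainCover_le (hT : T.IsTournament) {ε : ℝ} (hε1 : ε < 1) {K : ℕ}
    (hK : ∀ R' : List α, R'.Nodup → R' ≠ [] → (R'.length : ℝ) ^ ε ≤ (T.findChain K R').length)
    (m : ℕ) {R : List α} (hR : R.Nodup) (hε : 0 < ε) :
    ((T.chainCover K m R).length : ℝ) ≤ (R.length : ℝ) ^ (1 - ε) / (1 - ε) := by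
  have ha : 0 < 1 - ε := by linarith
  induction m generalizing R with
  | zero =>
    simp only [chainCover, List.length_nil, Nat.cast_zero]
    positivity
  | succ m ih =>
    rw [chainCover]
    split_ifs with hR0
    · simp only [List.length_nil, Nat.cast_zero]
      positivity
    · have h1 := T.length_filter_notMem_findChain hT K hR
      have h2 := ih (R := R.filter fun v => v ∉ T.findChain K R) (hR.filter _)
      have h3 := hK R hR hR0
      set X := T.findChain K R
      have hn : (0 : ℝ) < R.length := by exact_mod_cast List.length_pos_iff.2 hR0
      have h4 : ((R.filter fun v => v ∉ X).length : ℝ) = R.length * (1 + -(X.length / R.length)) := by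
        have : ((R.filter fun v => v ∉ X).length : ℝ) + X.length = R.length := by exact_mod_cast h1
        field_simp
        linarith
      have hle : (X.length : ℝ) / R.length ≤ 1 := by
        rw [div_le_one hn]
        exact_mod_cast (by omega : X.length ≤ R.length)
      have h5 := rpow_one_add_le_one_add_mul_self (s := -(X.length / R.length : ℝ)) (by linarith)
        ha.le (by linarith)
      have h6 : (1 : ℝ) ≤ (R.length : ℝ) ^ (1 - ε) * (X.length / R.length) := by
        have h7 : (R.length : ℝ) ^ (1 - ε) = R.length / (R.length : ℝ) ^ ε := by
          rw [Real.rpow_sub hn, Real.rpow_one]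
        rw [h7, div_mul_div_comm, mul_comm ((R.length : ℝ) ^ ε), mul_div_mul_left _ _ hn.ne',
          one_le_div (by positivity)]
        exact h3
      rw [List.length_cons]
      push_cast
      calc _ ≤ (R.length * (1 + -(X.length / R.length)) : ℝ) ^ (1 - ε) / (1 - ε) + 1 := by
            rw [← h4]; linarith
        _ ≤ (R.length : ℝ) ^ (1 - ε) * (1 + (1 - ε) * -(X.length / R.length)) / (1 - ε) + 1 := by
            rw [Real.mul_rpow hn.le (by linarith)]
            gcongr
        _ = (R.length : ℝ) ^ (1 - ε) / (1 - ε) -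
              (R.length : ℝ) ^ (1 - ε) * (X.length / R.length) + 1 := by
            field_simp
            ring
        _ ≤ _ := by linarith

end

/-- Positions in the list strictly increase along every edge inside `A`, so no walk closes up. -/
theorem IsTournament.isTransitiveSet_of_pairwise {α : Type*} {T : Digraph α} (hT : T.IsTournament)
    {X : List α} (hX : X.Pairwise T.Adj) {A : Set α} (hA : ∀ a ∈ A, a ∈ X) :
    T.IsTransitiveSet A := by
  classical
  have hlt : ∀ a b, a ∈ X → b ∈ X → T.Adj a b → X.idxOf a < X.idxOf b := by
    intro a b ha hb hab
    by_contra hle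
    have ha' := List.idxOf_lt_length_of_mem ha
    have hb' := List.idxOf_lt_length_of_mem hb
    rcases (not_lt.1 hle).lt_or_eq with h | h
    · have := List.pairwise_iff_getElem.1 hX _ _ hb' ha' h
      rw [List.getElem_idxOf, List.getElem_idxOf] at this
      exact hT.asymm hab this
    · have h2 : X[X.idxOf b] = X[X.idxOf a] := by simp only [h]
      rw [List.getElem_idxOf, List.getElem_idxOf] at h2
      exact hT.ne_of_adj hab h2.symm
  intro v hv
  have key : ∀ a b, Relation.TransGen (fun a b => a ∈ A ∧ b ∈ A ∧ T.Adj a b) a b →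
      X.idxOf a < X.idxOf b := by
    intro a b hab
    induction hab with
    | single h => exact hlt _ _ (hA _ h.1) (hA _ h.2.1) h.2.2
    | tail _ h ih => exact ih.trans (hlt _ _ (hA _ h.1) (hA _ h.2.1) h.2.2)
  exact lt_irrefl _ (key v v hv)

/-- The colouring of the vertices by the index of the first transitive set that contains them. -/
theorem exists_coloring {n : ℕ} {T : Digraph (Fin n)} [DecidableRel T.Adj] {V : Type*} [Fintype V]
    {H : Digraph V} (hV : 2 ≤ Fintype.card V) (hH : H.IsGalaxy) (hT : T.IsTournament)
    (hfree : T.IsFree H) :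
    ∃ (k : ℕ) (c : Fin n → Fin k), T.IsColoring c ∧
      (2 ≤ n → (k : ℝ) ≤ 3 * ((n : ℝ) ^
        (1 - 1 / 1000 / ((Fintype.card V : ℝ) ^ 5 * Real.log (Fintype.card V : ℝ))) *
          Real.log (n : ℝ))) ∧
      ∀ v, (c v : ℕ) = (T.chainCover (searchDepth (Fintype.card V)) n (List.finRange n)).findIdx
        fun X => v ∈ X := by
  set h := Fintype.card V with hh
  obtain ⟨ε, hε⟩ : ∃ ε : ℝ, ε = 1 / 1000 / ((h : ℝ) ^ 5 * Real.log h) := ⟨_, rfl⟩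
  have hh2 : (2 : ℝ) ≤ h := by exact_mod_cast hV
  have hlog2 := Real.log_two_gt_d9
  have hlog : Real.log 2 ≤ Real.log h := Real.log_le_log (by norm_num) hh2
  have hε0 : 0 < ε := by
    rw [hε]
    have : 0 < Real.log h := by linarith
    positivity
  have hε1 : ε ≤ 1 / 100 := by
    have h1 : (1 : ℝ) ≤ (h : ℝ) ^ 5 := one_le_pow₀ (by linarith)
    rw [hε, div_div, div_le_div_iff₀ (by nlinarith) (by norm_num)]
    nlinarith
  obtain ⟨hG1, hG2⟩ := rpow_totalLoss_le hV hε
  have hfind : ∀ R : List (Fin n), R.Nodup → R ≠ [] →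
      Nat.log 2 R.length + 1 ≤ (T.findChain (searchDepth h) R).length ∧
      (R.length : ℝ) ^ ε ≤ (T.findChain (searchDepth h) R).length := fun R hR hR0 =>
    findChain_large hH hT hfree (by omega) hε0 hG1 hG2 hR hR0
  set L := T.chainCover (searchDepth h) n (List.finRange n) with hL
  have hcov : ∀ v, ∃ X ∈ L, v ∈ X := fun v =>
    T.exists_mem_chainCover hT (List.nodup_finRange n) (by simp) (fun R hR hR0 hc => by
      have := (hfind R hR hR0).1
      rw [hc] at this
      simp at this) (List.mem_finRange v)
  have hidx : ∀ v, L.findIdx (fun X => v ∈ X) < L.length := fun v => by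
    obtain ⟨X, hX, hv⟩ := hcov v
    exact List.findIdx_lt_length_of_exists ⟨X, hX, by simpa using hv⟩
  refine ⟨L.length, fun v => ⟨L.findIdx fun X => v ∈ X, hidx v⟩, fun i => ?_, fun hn => ?_,
    fun v => rfl⟩
  · refine hT.isTransitiveSet_of_pairwise
      (T.pairwise_of_mem_chainCover (List.getElem_mem i.2)) fun v hv => ?_
    have h1 := List.findIdx_getElem (w := hidx v)
    have h2 : L.findIdx (fun X => v ∈ X) = i := congrArg Fin.val hv
    simp only [h2, decide_eq_true_eq] at h1
    exact h1
  · have h1 := T.length_chainCover_le hT (by linarith) (fun R hR hR0 => (hfind R hR hR0).2) n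
      (List.nodup_finRange n) hε0
    rw [← hL, List.length_finRange] at h1
    rw [← hε]
    refine h1.trans ?_
    have h2 : Real.log 2 ≤ Real.log n := Real.log_le_log (by norm_num) (by exact_mod_cast hn)
    have h3 : (0 : ℝ) ≤ (n : ℝ) ^ (1 - ε) := by positivity
    rw [div_le_iff₀ (by linarith)]
    -- The factor log n ≥ log 2 serves only to absorb the constant 1/(1-ε).
    have h4 : 1 ≤ 3 * Real.log n * (1 - ε) := by nlinarith
    nlinarith [mul_le_mul_of_nonneg_left h4 h3]

end Digraph

/-! ### Programs -/

/-- Evaluation in at most `t` steps. -/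
def LispEvalWithin (P : LispProgram) (env : List SExp) (e : LispExp) (v : SExp) (t : ℕ) : Prop :=
  ∃ s ≤ t, LispEval P env e v s

/-- Function `f` of the program maps `x` to `y` in at most `t` steps. -/
def LispProgram.Runs (P : LispProgram) (f : ℕ) (x y : SExp) (t : ℕ) : Prop :=
  LispEvalWithin P [x] (P.body f) y t

namespace LispEvalWithin

variable {P : LispProgram} {env : List SExp} {e e₁ e₂ : LispExp} {a b c v w v₁ v₂ : SExp}
  {t t' t₁ t₂ : ℕ} {f : ℕ}

theorem mono (h : LispEvalWithin P env e v t) (ht : t ≤ t') : LispEvalWithin P env e v t' := by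
  obtain ⟨s, hs, h⟩ := h
  exact ⟨s, hs.trans ht, h⟩

theorem var0 : LispEvalWithin P (a :: env) (.var 0) a 1 := ⟨1, le_rfl, .var _ 0⟩

theorem var1 : LispEvalWithin P (a :: b :: env) (.var 1) b 1 := ⟨1, le_rfl, .var _ 1⟩

theorem nil : LispEvalWithin P env .nil SExp.nil 1 := ⟨1, le_rfl, .nil _⟩

theorem cons (h₁ : LispEvalWithin P env e₁ v₁ t₁) (h₂ : LispEvalWithin P env e₂ v₂ t₂) :
    LispEvalWithin P env (.cons e₁ e₂) (.cons v₁ v₂) (t₁ + t₂ + 1) := by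
  obtain ⟨s₁, hs₁, h₁⟩ := h₁
  obtain ⟨s₂, hs₂, h₂⟩ := h₂
  exact ⟨_, by omega, .cons h₁ h₂⟩

theorem head (h : LispEvalWithin P env e (.cons a b) t) :
    LispEvalWithin P env (.head e) a (t + 1) := by
  obtain ⟨s, hs, h⟩ := h
  exact ⟨_, by omega, .head h⟩

theorem tail (h : LispEvalWithin P env e (.cons a b) t) :
    LispEvalWithin P env (.tail e) b (t + 1) := by
  obtain ⟨s, hs, h⟩ := h
  exact ⟨_, by omega, .tail h⟩

theorem ite_cons (h : LispEvalWithin P env e (.cons a b) t)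
    (h₁ : LispEvalWithin P env e₁ v t₁) : LispEvalWithin P env (.ite e e₁ e₂) v (t + t₁ + 1) := by
  obtain ⟨s, hs, h⟩ := h
  obtain ⟨s₁, hs₁, h₁⟩ := h₁
  exact ⟨_, by omega, .ite_cons h h₁⟩

theorem ite_nil (h : LispEvalWithin P env e .nil t)
    (h₂ : LispEvalWithin P env e₂ v t₂) : LispEvalWithin P env (.ite e e₁ e₂) v (t + t₂ + 1) := by
  obtain ⟨s, hs, h⟩ := h
  obtain ⟨s₂, hs₂, h₂⟩ := h₂
  exact ⟨_, by omega, .ite_nil h h₂⟩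

theorem letE (h : LispEvalWithin P env e v t) (h' : LispEvalWithin P (v :: env) e₁ w t') :
    LispEvalWithin P env (.letE e e₁) w (t + t' + 1) := by
  obtain ⟨s, hs, h⟩ := h
  obtain ⟨s', hs', h'⟩ := h'
  exact ⟨_, by omega, .letE h h'⟩

theorem call (h : LispEvalWithin P env e v t) (h' : P.Runs f v w t') :
    LispEvalWithin P env (.call f e) w (t + t' + 1) := by
  obtain ⟨s, hs, h⟩ := h
  obtain ⟨s', hs', h'⟩ := h'
  exact ⟨_, by omega, .call h h'⟩

end LispEvalWithin

namespace LispProgram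

variable {P : LispProgram} {f g : ℕ} {x y : SExp} {t t' : ℕ}

theorem Runs.mono (h : P.Runs f x y t) (ht : t ≤ t') : P.Runs f x y t' :=
  LispEvalWithin.mono h ht

/-- Each run below is given as its evaluation tree, a term over the rules above; what remains is to
identify the value and to compare step counts. -/
theorem Runs.of_body {e : LispExp} {y' : SExp} (hb : P.body f = e)
    (h : LispEvalWithin P [x] e y' t') (hy : y' = y) (ht : t' ≤ t) : P.Runs f x y t := by
  subst hy
  unfold Runs
  rw [hb]
  exact h.mono ht

end LispProgram

namespace LispExp

/-- The argument of the current function. -/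
def arg : LispExp := .var 0

/-- The body of a function `f` that maps `(env . l)` to the sublist of the `a` in `l` for which
function `p` does not return `nil` on `(env . a)`. -/
def filterBody (f p : ℕ) : LispExp :=
  .ite (.tail arg)
    (.ite (.call p (.cons (.head arg) (.head (.tail arg))))
      (.cons (.head (.tail arg)) (.call f (.cons (.head arg) (.tail (.tail arg)))))
      (.call f (.cons (.head arg) (.tail (.tail arg)))))
    .nil

/-- The body of a function `f` that maps `(env . l)` to the concatenation of the lists that
function `g` returns on `(env . a)`, `a` in `l`; function `1` appends lists. -/
def flatMapBody (f g : ℕ) : LispExp :=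
  .ite (.tail arg)
    (.call 1 (.cons (.call g (.cons (.head arg) (.head (.tail arg))))
      (.call f (.cons (.head arg) (.tail (.tail arg))))))
    .nil

/-- The body of a function `f` that maps `(env . l)` to the list of the values of function `g` on
`(env . a)`, `a` in `l`. -/
def mapBody (f g : ℕ) : LispExp :=
  .ite (.tail arg)
    (.cons (.call g (.cons (.head arg) (.head (.tail arg))))
      (.call f (.cons (.head arg) (.tail (.tail arg)))))
    .nil

/-- `(a . b) ↦ a ++ b` -/
def appBody : LispExp :=
  .ite (.head arg)
    (.cons (.head (.head arg)) (.call 1 (.cons (.tail (.head arg)) (.tail arg)))) (.tail arg)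

/-- `(a . b) ↦ (|a| ≤ |b|)` -/
def leBody : LispExp :=
  .ite (.head arg)
    (.ite (.tail arg) (.call 2 (.cons (.tail (.head arg)) (.tail (.tail arg)))) .nil)
    (.cons .nil .nil)

/-- `(i . l) ↦` the `i`-th entry of `l` -/
def nthBody : LispExp :=
  .ite (.head arg) (.call 3 (.cons (.tail (.head arg)) (.tail (.tail arg)))) (.head (.tail arg))

/-- `(u . v) ↦` whether `u` is adjacent to `v` -/
def adjOutBody : LispExp := .call 3 (.cons (.head (.tail arg)) (.tail (.head arg)))

/-- `(u . v) ↦` whether `u` is adjacent from `v` -/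
def adjInBody : LispExp := .call 3 (.cons (.head (.head arg)) (.tail (.tail arg)))

/-- `((W . Y) . v) ↦` whether `v` has at least `|W|` neighbours in `Y`; function `g` finds the
neighbours -/
def manyPredBody (g : ℕ) : LispExp :=
  .call 2 (.cons (.head (.head arg)) (.call g (.cons (.tail arg) (.tail (.head arg)))))

/-- `(W . X) ↦` the first `|W|` entries of `X` -/
def takeBody : LispExp :=
  .ite (.head arg)
    (.ite (.tail arg)
      (.cons (.head (.tail arg)) (.call 12 (.cons (.tail (.head arg)) (.tail (.tail arg))))) .nil)
    .nil

/-- `(W . X) ↦ X` without its first `|W|` entries -/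
def dropBody : LispExp :=
  .ite (.head arg)
    (.ite (.tail arg) (.call 13 (.cons (.tail (.head arg)) (.tail (.tail arg)))) .nil)
    (.tail arg)

/-- `X ↦ |X| / 2` -/
def halfBody : LispExp :=
  .ite arg (.ite (.tail arg) (.cons .nil (.call 14 (.tail (.tail arg)))) .nil) .nil

/-- The suffixes of a list. -/
def tailsBody : LispExp :=
  .ite arg (.cons arg (.call 15 (.tail arg))) (.cons .nil .nil)

/-- `((((m . D) . X) . Y) . W) ↦` the lists that are derived from `X`, `Y`, `W` -/
def derivedBody : LispExp :=
  .letE (.tail (.head (.head arg)))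
    (.cons (.var 0)
    (.cons (.call 1 (.cons (.var 0) (.tail (.head (.var 1)))))
    (.cons (.call 12 (.cons (.tail (.var 1)) (.var 0)))
    (.cons (.call 13 (.cons (.tail (.var 1)) (.var 0)))
    (.cons (.call 10 (.cons (.cons (.tail (.var 1)) (.tail (.head (.var 1)))) (.var 0)))
    (.cons (.call 11 (.cons (.cons (.tail (.var 1)) (.tail (.head (.var 1)))) (.var 0)))
    (.cons (.call 25 (.call 12 (.cons (.head (.head (.head (.head (.var 1))))) (.var 0))))
      .nil)))))))

/-- `(((m . D) . X) . Y) ↦` loop over `W` in `D` -/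
def loopThirdBody : LispExp := .call 17 (.cons arg (.tail (.head (.head arg))))

/-- `((m . D) . X) ↦` loop over `Y` in `D` -/
def loopSecondBody : LispExp := .call 19 (.cons arg (.tail (.head arg)))

/-- `(i . (m . D)) ↦` the result of `i` rounds of search -/
def roundsBody : LispExp :=
  .ite (.head arg)
    (.call 22 (.cons (.tail (.head arg)) (.cons (.head (.tail arg))
      (.call 21 (.cons (.tail arg) (.tail (.tail arg)))))))
    (.tail (.tail arg))

/-- `X ↦` whether `X` is transitively ordered -/
def chainBody : LispExp :=
  .ite arg
    (.ite (.call 2 (.cons (.tail arg) (.call 6 (.cons (.head arg) (.tail arg)))))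
      (.call 23 (.tail arg)) .nil)
    (.cons .nil .nil)

/-- A longest transitively ordered list. -/
def longestBody : LispExp :=
  .ite arg
    (.letE (.call 24 (.tail arg))
      (.ite (.call 23 (.head (.var 1)))
        (.ite (.call 2 (.cons (.head (.var 1)) (.var 0))) (.var 0) (.head (.var 1)))
        (.var 0)))
    .nil

/-- The literal `i`. -/
def ofNat : ℕ → LispExp
  | 0 => .nil
  | i + 1 => .cons .nil (ofNat i)

/-- The search with `K` rounds. -/
def findBody (K : ℕ) : LispExp :=
  .ite arg
    (.ite (.tail arg)
      (.call 24 (.call 22 (.cons (ofNat K) (.cons (.call 14 arg) (.call 15 arg))))) arg)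
    arg

/-- `(v . X) ↦ (v ∈ X)` -/
def memBody : LispExp :=
  .ite (.tail arg)
    (.ite (.ite (.call 2 (.cons (.head (.head arg)) (.head (.head (.tail arg)))))
        (.call 2 (.cons (.head (.head (.tail arg))) (.head (.head arg)))) .nil)
      (.cons .nil .nil)
      (.call 26 (.cons (.head arg) (.tail (.tail arg)))))
    .nil

/-- `(X . v) ↦ (v ∉ X)` -/
def notMemBody : LispExp :=
  .ite (.call 26 (.cons (.tail arg) (.head arg))) .nil (.cons .nil .nil)

/-- `(i . R) ↦` at most `i` transitive sets that cover `R` -/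
def coverBody : LispExp :=
  .ite (.head arg)
    (.ite (.tail arg)
      (.letE (.call 25 (.tail arg))
        (.cons (.var 0) (.call 29 (.cons (.tail (.head (.var 1)))
          (.call 28 (.cons (.var 0) (.tail (.var 1))))))))
      .nil)
    .nil

/-- `(L . v) ↦` the index of the first list in `L` that contains `v` -/
def colorBody : LispExp :=
  .ite (.head arg)
    (.ite (.call 26 (.cons (.tail arg) (.head (.head arg)))) .nil
      (.cons .nil (.call 30 (.cons (.tail (.head arg)) (.tail arg)))))
    .nil

/-- `(i . M) ↦` the rows of `M`, numbered from `i` on -/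
def numberBody : LispExp :=
  .ite (.tail arg)
    (.cons (.cons (.head arg) (.head (.tail arg)))
      (.call 32 (.cons (.cons .nil (.head arg)) (.tail (.tail arg)))))
    .nil

/-- The main function. -/
def mainBody : LispExp :=
  .letE (.call 32 (.cons .nil arg))
    (.letE (.call 29 (.cons (.var 0) (.var 0))) (.call 31 (.cons (.var 0) (.var 1))))

end LispExp

open LispExp in
/-- Greedy colouring by transitive sets that are found in `K` rounds of search. A vertex is
represented by the pair of its number and its row of the adjacency matrix. -/
def colouringProgram (K : ℕ) : LispProgram :=
  [mainBody, appBody, leBody, nthBody, adjOutBody, adjInBody, filterBody 6 4, filterBody 7 5,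
    manyPredBody 6, manyPredBody 7, filterBody 10 8, filterBody 11 9, takeBody, dropBody, halfBody,
    tailsBody, derivedBody, flatMapBody 17 16, loopThirdBody, flatMapBody 19 18, loopSecondBody,
    flatMapBody 21 20, roundsBody, chainBody, longestBody, findBody K, memBody, notMemBody,
    filterBody 28 27, coverBody, colorBody, mapBody 31 30, numberBody]

/-! ### Correctness and running time of the list functions -/

namespace LispProgram

open LispEvalWithin SExp

section Combinators

variable {P : LispProgram} {f g : ℕ} {β : Type*} (enc : β → SExp) {env : SExp} {τ : ℕ}

theorem runs_filter (hf : P.body f = LispExp.filterBody f g) (q : β → Bool) (l : List β)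
    (hq : ∀ a ∈ l, P.Runs g (.cons env (enc a)) (ofBool (q a)) τ) :
    P.Runs f (.cons env (ofList (l.map enc))) (ofList ((l.filter q).map enc))
      ((l.length + 1) * (τ + 30)) := by
  induction l with
  | nil => exact Runs.of_body hf (ite_nil (tail var0) nil) rfl (by simp)
  | cons a l ih =>
    have h1 := hq a List.mem_cons_self
    have h2 := ih fun b hb => hq b (List.mem_cons_of_mem _ hb)
    have ht : (((a :: l).length + 1) * (τ + 30)) = (l.length + 1) * (τ + 30) + τ + 30 := by
      rw [List.length_cons]; ring
    rw [ht]
    cases hqa : q a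
    · rw [hqa] at h1
      exact Runs.of_body hf (ite_cons (tail var0) (ite_nil (call (cons (head var0)
        (head (tail var0))) h1) (call (cons (head var0) (tail (tail var0))) h2)))
        (by simp [hqa]) (by omega)
    · rw [hqa] at h1
      exact Runs.of_body hf (ite_cons (tail var0) (ite_cons (call (cons (head var0)
        (head (tail var0))) h1) (cons (head (tail var0)) (call (cons (head var0)
        (tail (tail var0))) h2))))
        (by simp [hqa, ofList]) (by omega)

theorem runs_map (hf : P.body f = LispExp.mapBody f g) (φ : β → SExp) (l : List β)
    (hg : ∀ a ∈ l, P.Runs g (.cons env (enc a)) (φ a) τ) :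
    P.Runs f (.cons env (ofList (l.map enc))) (ofList (l.map φ)) ((l.length + 1) * (τ + 30)) := by
  induction l with
  | nil => exact Runs.of_body hf (ite_nil (tail var0) nil) rfl (by simp)
  | cons a l ih =>
    have h1 := hg a List.mem_cons_self
    have h2 := ih fun b hb => hg b (List.mem_cons_of_mem _ hb)
    have ht : (((a :: l).length + 1) * (τ + 30)) = (l.length + 1) * (τ + 30) + τ + 30 := by
      rw [List.length_cons]; ring
    rw [ht]
    exact Runs.of_body hf (ite_cons (tail var0) (cons (call (cons (head var0)
        (head (tail var0))) h1) (call (cons (head var0) (tail (tail var0))) h2)))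
        rfl (by omega)

theorem runs_append (h1 : P.body 1 = LispExp.appBody) (a b : List SExp) :
    P.Runs 1 (.cons (ofList a) (ofList b)) (ofList (a ++ b)) (20 * (a.length + 1)) := by
  induction a with
  | nil => exact Runs.of_body h1 (ite_nil (head var0) (tail var0)) rfl (by simp)
  | cons x a ih =>
    exact Runs.of_body h1 (ite_cons (head var0) (cons (head (head var0))
      (call (cons (tail (head var0)) (tail var0)) ih))) rfl (by simp; omega)

theorem runs_flatMap (h1 : P.body 1 = LispExp.appBody) (hf : P.body f = LispExp.flatMapBody f g)
    (φ : β → List SExp) {r : ℕ} (l : List β)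
    (hg : ∀ a ∈ l, P.Runs g (.cons env (enc a)) (ofList (φ a)) τ ∧ (φ a).length ≤ r) :
    P.Runs f (.cons env (ofList (l.map enc))) (ofList (l.flatMap φ))
      ((l.length + 1) * (τ + 20 * r + 50)) := by
  induction l with
  | nil => exact Runs.of_body hf (ite_nil (tail var0) nil) rfl (by simp)
  | cons a l ih =>
    obtain ⟨h3, h4⟩ := hg a List.mem_cons_self
    have h2 := ih fun b hb => hg b (List.mem_cons_of_mem _ hb)
    have ht : (((a :: l).length + 1) * (τ + 20 * r + 50)) =
        (l.length + 1) * (τ + 20 * r + 50) + τ + 20 * r + 50 := by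
      rw [List.length_cons]; ring
    rw [ht]
    exact Runs.of_body hf (ite_cons (tail var0) (call (cons (call (cons (head var0)
        (head (tail var0))) h3) (call (cons (head var0) (tail (tail var0))) h2))
        (runs_append h1 _ _))) (by rw [List.flatMap_cons]) (by omega)

end Combinators

section Lists

variable (K : ℕ)

theorem runs_le (a b : List SExp) :
    (colouringProgram K).Runs 2 (.cons (ofList a) (ofList b))
      (ofBool (decide (a.length ≤ b.length))) (20 * (a.length + 1)) := by
  induction a generalizing b with
  | nil =>
    exact Runs.of_body (e := LispExp.leBody) rfl (ite_nil (head var0) (cons nil nil)) (by simp [ofBool]) (by simp)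
  | cons x a ih =>
    cases b with
    | nil =>
      exact Runs.of_body (e := LispExp.leBody) rfl (ite_cons (head var0) (ite_nil (tail var0) nil)) (by simp [ofBool])
        (by simp; omega)
    | cons y b =>
      exact Runs.of_body (e := LispExp.leBody) rfl (ite_cons (head var0) (ite_cons (tail var0)
        (call (cons (tail (head var0)) (tail (tail var0))) (ih b)))) (by simp) (by simp; omega)

theorem runs_nth (i : ℕ) (l : List SExp) (hi : i < l.length) :
    (colouringProgram K).Runs 3 (.cons (ofNat i) (ofList l)) l[i] (20 * (i + 1)) := by
  induction i generalizing l with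
  | zero =>
    obtain ⟨x, l, rfl⟩ := List.exists_cons_of_length_pos hi
    exact Runs.of_body (e := LispExp.nthBody) rfl (ite_nil (head var0) (head (tail var0))) rfl (by simp)
  | succ i ih =>
    obtain ⟨x, l, rfl⟩ := List.exists_cons_of_length_pos (Nat.zero_lt_of_lt hi)
    exact Runs.of_body (e := LispExp.nthBody) rfl (ite_cons (head var0)
        (call (cons (tail (head var0)) (tail (tail var0))) (ih l (by simpa using hi)))) rfl
        (by omega)

theorem runs_take (w l : List SExp) :
    (colouringProgram K).Runs 12 (.cons (ofList w) (ofList l)) (ofList (l.take w.length))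
      (20 * (w.length + 1)) := by
  induction w generalizing l with
  | nil => exact Runs.of_body (e := LispExp.takeBody) rfl (ite_nil (head var0) nil) rfl (by simp)
  | cons x w ih =>
    cases l with
    | nil =>
      exact Runs.of_body (e := LispExp.takeBody) rfl (ite_cons (head var0) (ite_nil (tail var0) nil)) rfl (by simp; omega)
    | cons y l =>
      exact Runs.of_body (e := LispExp.takeBody) rfl (ite_cons (head var0) (ite_cons (tail var0) (cons (head (tail var0))
        (call (cons (tail (head var0)) (tail (tail var0))) (ih l))))) rfl (by simp; omega)

theorem runs_drop (w l : List SExp) :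
    (colouringProgram K).Runs 13 (.cons (ofList w) (ofList l)) (ofList (l.drop w.length))
      (20 * (w.length + 1)) := by
  induction w generalizing l with
  | nil => exact Runs.of_body (e := LispExp.dropBody) rfl (ite_nil (head var0) (tail var0)) rfl (by simp)
  | cons x w ih =>
    cases l with
    | nil =>
      exact Runs.of_body (e := LispExp.dropBody) rfl (ite_cons (head var0) (ite_nil (tail var0) nil)) rfl (by simp; omega)
    | cons y l =>
      exact Runs.of_body (e := LispExp.dropBody) rfl (ite_cons (head var0) (ite_cons (tail var0)
        (call (cons (tail (head var0)) (tail (tail var0))) (ih l)))) rfl (by simp; omega)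

theorem runs_half (l : List SExp) :
    (colouringProgram K).Runs 14 (ofList l) (ofNat (l.length / 2)) (20 * (l.length + 1)) := by
  induction hn : l.length using Nat.strong_induction_on generalizing l with
  | _ n ih =>
    match l, hn with
    | [], hn =>
      subst hn
      exact Runs.of_body (e := LispExp.halfBody) rfl (ite_nil var0 nil) rfl (by simp)
    | [a], hn =>
      subst hn
      exact Runs.of_body (e := LispExp.halfBody) rfl (ite_cons var0 (ite_nil (tail var0) nil))
        (by simp [ofNat, ofList]) (by simp)
    | a :: b :: l, hn =>
      subst hn
      have h := ih l.length (by simp) l rfl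
      refine Runs.of_body (e := LispExp.halfBody) rfl (ite_cons var0 (ite_cons (tail var0) (cons nil
        (call (tail (tail var0)) h)))) ?_ (by simp; omega)
      have : (a :: b :: l).length / 2 = l.length / 2 + 1 := by simp; omega
      rw [this]
      rfl

theorem runs_tails (l : List SExp) :
    (colouringProgram K).Runs 15 (ofList l) (ofList (l.tails.map ofList)) (20 * (l.length + 1)) := by
  induction l with
  | nil => exact Runs.of_body (e := LispExp.tailsBody) rfl (ite_nil var0 (cons nil nil)) rfl (by simp)
  | cons x l ih =>
    exact Runs.of_body (e := LispExp.tailsBody) rfl (ite_cons var0 (cons var0 (call (tail var0) ih))) (by simp [ofList])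
      (by simp; omega)

end Lists

end LispProgram

/-! ### Correctness and running time of the search rounds -/

namespace LispProgram

open LispEvalWithin SExp

section Vertices

variable {n : ℕ} (T : Digraph (Fin n)) [DecidableRel T.Adj]

/-- A vertex is represented by its number and its row of the adjacency matrix. -/
def encVertex (v : Fin n) : SExp :=
  .cons (ofNat v) (ofList (List.ofFn fun w => ofBool (decide (T.Adj v w))))

/-- A list of vertices. -/
def encList (X : List (Fin n)) : SExp := ofList (X.map (encVertex T))

/-- A list of lists of vertices. -/
def encFamily (D : List (List (Fin n))) : SExp := ofList (D.map (encList T))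

variable (K : ℕ) {B : ℕ}

theorem runs_adjOut (u v : Fin n) :
    (colouringProgram K).Runs 4 (.cons (encVertex T u) (encVertex T v))
      (ofBool (decide (T.Adj u v))) (30 * (n + 1)) := by
  have h := runs_nth K v (List.ofFn fun w => ofBool (decide (T.Adj u w))) (by simp)
  exact Runs.of_body (e := LispExp.adjOutBody) rfl
    (call (cons (head (tail var0)) (tail (head var0))) h) (by simp) (by have := v.2; omega)

theorem runs_adjIn (u v : Fin n) :
    (colouringProgram K).Runs 5 (.cons (encVertex T u) (encVertex T v))
      (ofBool (decide (T.Adj v u))) (30 * (n + 1)) := by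
  have h := runs_nth K u (List.ofFn fun w => ofBool (decide (T.Adj v w))) (by simp)
  exact Runs.of_body (e := LispExp.adjInBody) rfl
    (call (cons (head (head var0)) (tail (tail var0))) h) (by simp) (by have := u.2; omega)

theorem runs_nbrOut (hB : n + 1 ≤ B) (v : Fin n) {Y : List (Fin n)} (hY : Y.length + 1 ≤ B) :
    (colouringProgram K).Runs 6 (.cons (encVertex T v) (encList T Y))
      (encList T (Y.filter fun y => T.Adj v y)) (60 * B ^ 2) :=
  (runs_filter (encVertex T) rfl _ Y fun a _ => runs_adjOut T K v a).mono (by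
    calc _ ≤ B * (30 * B + 30 * B) := by gcongr; omega
      _ = 60 * B ^ 2 := by ring)

theorem runs_nbrIn (hB : n + 1 ≤ B) (v : Fin n) {Y : List (Fin n)} (hY : Y.length + 1 ≤ B) :
    (colouringProgram K).Runs 7 (.cons (encVertex T v) (encList T Y))
      (encList T (Y.filter fun y => T.Adj y v)) (60 * B ^ 2) :=
  (runs_filter (encVertex T) rfl _ Y fun a _ => runs_adjIn T K v a).mono (by
    calc _ ≤ B * (30 * B + 30 * B) := by gcongr; omega
      _ = 60 * B ^ 2 := by ring)

theorem runs_manyOut (hB : n + 1 ≤ B) {X Y W : List (Fin n)} (hX : X.length + 1 ≤ B)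
    (hY : Y.length + 1 ≤ B) (hW : W.length + 1 ≤ B) :
    (colouringProgram K).Runs 10 (.cons (.cons (encList T W) (encList T Y)) (encList T X))
      (encList T (T.manyOut X Y W)) (140 * B ^ 3) := by
  have hpred : ∀ v, (colouringProgram K).Runs 8
      (.cons (.cons (encList T W) (encList T Y)) (encVertex T v))
      (ofBool (decide (W.length ≤ (Y.filter fun y => T.Adj v y).length))) (110 * B ^ 2) := fun v =>
    Runs.of_body (e := LispExp.manyPredBody 6) rfl (call (cons (head (head var0)) (call (cons
      (tail var0) (tail (head var0))) (runs_nbrOut T K hB v hY))) (runs_le K _ _))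
      (by simp) (by simp only [List.length_map]; nlinarith)
  refine (runs_filter (encVertex T) rfl _ X fun a _ => hpred a).mono ?_
  have : 1 ≤ B := by omega
  calc _ ≤ B * (110 * B ^ 2 + 30 * B ^ 2) := by gcongr; nlinarith
    _ = 140 * B ^ 3 := by ring

theorem runs_manyIn (hB : n + 1 ≤ B) {X Y W : List (Fin n)} (hX : X.length + 1 ≤ B)
    (hY : Y.length + 1 ≤ B) (hW : W.length + 1 ≤ B) :
    (colouringProgram K).Runs 11 (.cons (.cons (encList T W) (encList T Y)) (encList T X))
      (encList T (T.manyIn X Y W)) (140 * B ^ 3) := by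
  have hpred : ∀ v, (colouringProgram K).Runs 9
      (.cons (.cons (encList T W) (encList T Y)) (encVertex T v))
      (ofBool (decide (W.length ≤ (Y.filter fun y => T.Adj y v).length))) (110 * B ^ 2) := fun v =>
    Runs.of_body (e := LispExp.manyPredBody 7) rfl (call (cons (head (head var0)) (call (cons
      (tail var0) (tail (head var0))) (runs_nbrIn T K hB v hY))) (runs_le K _ _))
      (by simp) (by simp only [List.length_map]; nlinarith)
  refine (runs_filter (encVertex T) rfl _ X fun a _ => hpred a).mono ?_
  have : 1 ≤ B := by omega
  calc _ ≤ B * (110 * B ^ 2 + 30 * B ^ 2) := by gcongr; nlinarith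
    _ = 140 * B ^ 3 := by ring

theorem runs_chain (hB : n + 1 ≤ B) {X : List (Fin n)} (hX : X.length + 1 ≤ B) :
    (colouringProgram K).Runs 23 (encList T X) (ofBool (decide (X.Pairwise T.Adj)))
      ((X.length + 1) * (110 * B ^ 2)) := by
  have hB1 : 1 ≤ B := by omega
  induction X with
  | nil =>
    exact Runs.of_body (e := LispExp.chainBody) rfl (ite_nil var0 (cons nil nil))
      (by simp [ofBool]) (by simp; nlinarith)
  | cons v X ih =>
    have h1 := ih (by simp at hX; omega)
    have h2 := runs_nbrOut T K hB v (Y := X) (by simp at hX; omega)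
    have h3 := runs_le K (X.map (encVertex T))
      ((X.filter fun y => T.Adj v y).map (encVertex T))
    -- The program tests whether `v` dominates the rest by comparing lengths: filtering
    -- out-neighbours must not shorten the list.
    have hiff : (X.map (encVertex T)).length ≤
        ((X.filter fun y => T.Adj v y).map (encVertex T)).length ↔ ∀ y ∈ X, T.Adj v y := by
      rw [List.length_map, List.length_map]
      refine ⟨fun h => ?_, fun h => ?_⟩
      · simpa using List.length_filter_eq_length_iff.1 (le_antisymm (List.length_filter_le _ _) h)
      · rw [List.filter_eq_self.2 (by simpa using h)]
    have ht : (20 : ℕ) * ((X.map (encVertex T)).length + 1) ≤ 20 * B := by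
      simp at hX ⊢; omega
    have ht' : ((v :: X).length + 1) * (110 * B ^ 2) =
        (X.length + 1) * (110 * B ^ 2) + 110 * B ^ 2 := by rw [List.length_cons]; ring
    have hBB : B ≤ B ^ 2 := by nlinarith
    rw [ht']
    by_cases hall : ∀ y ∈ X, T.Adj v y
    · rw [decide_eq_true (hiff.2 hall)] at h3
      exact Runs.of_body (e := LispExp.chainBody) rfl (ite_cons var0 (ite_cons (call (cons
        (tail var0) (call (cons (head var0) (tail var0)) h2)) h3) (call (tail var0) h1)))
        (congrArg ofBool (decide_eq_decide.2 (by rw [List.pairwise_cons]; tauto))) (by omega)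
    · rw [decide_eq_false (fun h => hall (hiff.1 h))] at h3
      exact Runs.of_body (e := LispExp.chainBody) rfl (ite_cons var0 (ite_nil (call (cons
        (tail var0) (call (cons (head var0) (tail var0)) h2)) h3) nil))
        (by simp [List.pairwise_cons, hall, ofBool]) (by omega)

theorem runs_longest (hB : n + 1 ≤ B) {D : List (List (Fin n))}
    (hD : ∀ X ∈ D, X.length + 1 ≤ B) :
    (colouringProgram K).Runs 24 (encFamily T D) (encList T (T.longestChain D))
      ((D.length + 1) * (160 * B ^ 3)) := by
  have hB1 : 1 ≤ B := by omega
  have hB2 : B ≤ B ^ 3 := Nat.le_self_pow (by norm_num) B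
  induction D with
  | nil =>
    exact Runs.of_body (e := LispExp.longestBody) rfl (ite_nil var0 nil) rfl (by simp; omega)
  | cons X D ih =>
    have h1 := ih fun Y hY => hD Y (List.mem_cons_of_mem _ hY)
    have hX := hD X List.mem_cons_self
    have h2 := (runs_chain T K hB hX).mono (t' := 110 * B ^ 3)
      (by calc _ ≤ B * (110 * B ^ 2) := Nat.mul_le_mul_right _ hX
            _ = 110 * B ^ 3 := by ring)
    have h3 := (runs_le K (X.map (encVertex T)) ((T.longestChain D).map (encVertex T))).mono
      (t' := 20 * B) (by simp; omega)
    have ht' : ((X :: D).length + 1) * (160 * B ^ 3) =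
        (D.length + 1) * (160 * B ^ 3) + 160 * B ^ 3 := by rw [List.length_cons]; ring
    rw [ht']
    by_cases hp : X.Pairwise T.Adj
    · rw [decide_eq_true hp] at h2
      by_cases hle : X.length ≤ (T.longestChain D).length
      · rw [decide_eq_true (by simpa using hle)] at h3
        refine Runs.of_body (e := LispExp.longestBody) rfl (ite_cons var0 (letE (call (tail var0) h1)
          (ite_cons (call (head var1) h2) (ite_cons (call (cons (head var1) var0) h3) var0))))
          ?_ (by omega)
        rw [Digraph.longestChain, if_neg (by omega)]
      · rw [decide_eq_false (by simpa using hle)] at h3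
        refine Runs.of_body (e := LispExp.longestBody) rfl (ite_cons var0 (letE (call (tail var0) h1)
          (ite_cons (call (head var1) h2) (ite_nil (call (cons (head var1) var0) h3)
          (head var1))))) ?_ (by omega)
        rw [Digraph.longestChain, if_pos ⟨hp, by omega⟩]
    · rw [decide_eq_false hp] at h2
      refine Runs.of_body (e := LispExp.longestBody) rfl (ite_cons var0 (letE (call (tail var0) h1)
          (ite_nil (call (head var1) h2) var0))) ?_ (by omega)
      rw [Digraph.longestChain, if_neg (fun h => hp h.1)]

variable {F : List (Fin n) → List (Fin n)} {m τ E : ℕ}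

theorem runs_derived (hB : n + 1 ≤ B) {X Y W : List (Fin n)} {D : SExp} (hX : X.length + 1 ≤ B)
    (hY : Y.length + 1 ≤ B) (hW : W.length + 1 ≤ B) (hm : m + 1 ≤ B)
    (hF : (colouringProgram K).Runs 25 (encList T (X.take m)) (encList T (F X)) τ) :
    (colouringProgram K).Runs 16
      (.cons (.cons (.cons (.cons (ofNat m) D) (encList T X)) (encList T Y)) (encList T W))
      (encFamily T (T.derived F X Y W)) (450 * B ^ 3 + τ) := by
  have hB1 : 1 ≤ B := by omega
  have hB2 : B ≤ B ^ 3 := Nat.le_self_pow (by norm_num) B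
  have h1 := (runs_append (P := colouringProgram K) rfl (X.map (encVertex T))
    (Y.map (encVertex T))).mono (t' := 20 * B) (by simp; omega)
  have h2 := (runs_take K (W.map (encVertex T)) (X.map (encVertex T))).mono
    (t' := 20 * B) (by simp; omega)
  have h3 := (runs_drop K (W.map (encVertex T)) (X.map (encVertex T))).mono
    (t' := 20 * B) (by simp; omega)
  have h4 := runs_manyOut T K hB hX hY hW
  have h5 := runs_manyIn T K hB hX hY hW
  have h6 := (runs_take K (List.replicate m .nil) (X.map (encVertex T))).mono
    (t' := 20 * B) (by simp; omega)
  rw [List.length_replicate, ← List.map_take] at h6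
  rw [← List.map_append] at h1
  rw [List.length_map, ← List.map_take] at h2
  rw [List.length_map, ← List.map_drop] at h3
  exact Runs.of_body (e := LispExp.derivedBody) rfl (letE (tail (head (head var0))) (cons var0
    (cons (call (cons var0 (tail (head var1))) h1) (cons (call (cons (tail var1) var0) h2)
    (cons (call (cons (tail var1) var0) h3)
    (cons (call (cons (cons (tail var1) (tail (head var1))) var0) h4)
    (cons (call (cons (cons (tail var1) (tail (head var1))) var0) h5)
    (cons (call (call (cons (head (head (head (head var1)))) var0) h6) hF) nil)))))))) rfl
    (by omega)

/-- `B` bounds the lengths of lists, `E` their number and `τ` a recursive call. Three nested loops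
over `D` produce the factor E³; their overhead goes into the coefficient of B³. -/
theorem runs_searchRound (hB : n + 1 ≤ B) (hm : m + 1 ≤ B) {D : List (List (Fin n))}
    (hD : ∀ X ∈ D, X.length + 1 ≤ B) (hE : D.length + 1 ≤ E)
    (hF : ∀ X ∈ D, (colouringProgram K).Runs 25 (encList T (X.take m)) (encList T (F X)) τ) :
    (colouringProgram K).Runs 21 (.cons (.cons (ofNat m) (encFamily T D)) (encFamily T D))
      (encFamily T (T.searchRound F D)) (E ^ 3 * (1060 * B ^ 3 + τ)) := by
  have hB1 : 1 ≤ B := by omega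
  have hB3 : 1 ≤ B ^ 3 := Nat.one_le_pow _ _ hB1
  have hE1 : 1 ≤ E := by omega
  have hE2 : 1 ≤ E ^ 2 := Nat.one_le_pow _ _ hE1
  have hmap : ∀ φ : List (Fin n) → List (List (Fin n)),
      D.flatMap (fun X => (φ X).map (encList T)) = (D.flatMap φ).map (encList T) := fun φ =>
    (List.map_flatMap).symm
  have hW : ∀ X ∈ D, ∀ Y ∈ D, (colouringProgram K).Runs 17
      (.cons (.cons (.cons (.cons (ofNat m) (encFamily T D)) (encList T X)) (encList T Y))
        (encFamily T D)) (encFamily T (D.flatMap fun W => T.derived F X Y W))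
        (E * (640 * B ^ 3 + τ)) := by
    intro X hX Y hY
    have h := runs_flatMap (P := colouringProgram K) (f := 17) (encList T) rfl rfl
      (fun W => (T.derived F X Y W).map (encList T)) (r := 7) D (fun W hW' =>
        ⟨runs_derived T K (D := encFamily T D) hB (hD X hX) (hD Y hY) (hD W hW') hm (hF X hX),
          by simp [Digraph.derived]⟩)
    rw [hmap] at h
    exact h.mono (Nat.mul_le_mul hE (by omega))
  have hY : ∀ X ∈ D, (colouringProgram K).Runs 19
      (.cons (.cons (.cons (ofNat m) (encFamily T D)) (encList T X)) (encFamily T D))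
      (encFamily T (D.flatMap fun Y => D.flatMap fun W => T.derived F X Y W))
        (E ^ 2 * (850 * B ^ 3 + τ)) := by
    intro X hX
    have h := runs_flatMap (P := colouringProgram K) (f := 19) (encList T) rfl rfl
      (fun Y => (D.flatMap fun W => T.derived F X Y W).map (encList T)) (r := 7 * E)
      (τ := E * (660 * B ^ 3 + τ)) D (fun Y hY' =>
        ⟨Runs.of_body (e := LispExp.loopThirdBody) rfl
          (call (cons var0 (tail (head (head var0)))) (hW X hX Y hY')) rfl (by nlinarith),
          by simp [List.length_flatMap, Digraph.derived]; omega⟩)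
    rw [hmap] at h
    refine h.mono (le_trans (Nat.mul_le_mul hE (le_refl _)) ?_)
    calc E * (E * (660 * B ^ 3 + τ) + 20 * (7 * E) + 50)
        ≤ E * (E * (660 * B ^ 3 + τ) + E * (140 * B ^ 3) + E * (50 * B ^ 3)) := by
          have h1 : 20 * (7 * E) ≤ E * (140 * B ^ 3) := by nlinarith
          have h2 : 50 ≤ E * (50 * B ^ 3) := by nlinarith
          exact Nat.mul_le_mul_left _ (by omega)
      _ = E ^ 2 * (850 * B ^ 3 + τ) := by ring
  have h := runs_flatMap (P := colouringProgram K) (f := 21) (encList T) rfl rfl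
      (fun X => (D.flatMap fun Y => D.flatMap fun W => T.derived F X Y W).map (encList T))
      (r := 7 * E ^ 2) (τ := E ^ 2 * (870 * B ^ 3 + τ)) (env := .cons (ofNat m) (encFamily T D)) D
      (fun X hX =>
        ⟨Runs.of_body (e := LispExp.loopSecondBody) rfl
          (call (cons var0 (tail (head var0))) (hY X hX)) rfl (by nlinarith), by
          simp only [List.length_map, List.length_flatMap, Digraph.derived, List.length_cons,
            List.length_nil, List.map_const', List.sum_replicate, smul_eq_mul]
          nlinarith⟩)
  rw [hmap] at h
  refine h.mono (le_trans (Nat.mul_le_mul hE (le_refl _)) ?_)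
  calc E * (E ^ 2 * (870 * B ^ 3 + τ) + 20 * (7 * E ^ 2) + 50)
      ≤ E * (E ^ 2 * (870 * B ^ 3 + τ) + E ^ 2 * (140 * B ^ 3) + E ^ 2 * (50 * B ^ 3)) := by
        have h1 : 20 * (7 * E ^ 2) ≤ E ^ 2 * (140 * B ^ 3) := by nlinarith
        have h2 : 50 ≤ E ^ 2 * (50 * B ^ 3) := by nlinarith
        exact Nat.mul_le_mul_left _ (by omega)
    _ = E ^ 3 * (1060 * B ^ 3 + τ) := by ring

theorem runs_rounds (hB : n + 1 ≤ B) (hm : m + 1 ≤ B) {S : List (Fin n)} {k : ℕ}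
    (hD : ∀ j ≤ k, ∀ X ∈ T.search F S j, X.length + 1 ≤ B)
    (hE : ∀ j ≤ k, (T.search F S j).length + 1 ≤ E)
    (hF : ∀ X, X.length + 1 ≤ B →
      (colouringProgram K).Runs 25 (encList T (X.take m)) (encList T (F X)) τ) (i j : ℕ)
    (hij : j + i = k) :
    (colouringProgram K).Runs 22
      (.cons (ofNat i) (.cons (ofNat m) (encFamily T (T.search F S j))))
      (encFamily T (T.search F S k)) ((i + 1) * (E ^ 3 * (1060 * B ^ 3 + τ) + 30)) := by
  induction i generalizing j with
  | zero =>
    exact Runs.of_body (e := LispExp.roundsBody) rfl (ite_nil (head var0) (tail (tail var0)))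
      (by rw [← hij, add_zero]) (by omega)
  | succ i ih =>
    have h1 := ih (j + 1) (by omega)
    have h2 := runs_searchRound T K hB hm (D := T.search F S j) (hD j (by omega)) (hE j (by omega))
      (fun X hX => hF X (hD j (by omega) X hX))
    have h3 : T.searchRound F (T.search F S j) = T.search F S (j + 1) := by
      rw [Digraph.search, Digraph.search, Function.iterate_succ_apply']
    rw [h3] at h2
    exact Runs.of_body (e := LispExp.roundsBody) rfl (ite_cons (head var0) (call (cons
      (tail (head var0)) (cons (head (tail var0)) (call (cons (tail var0) (tail (tail var0))) h2)))
      h1)) rfl (by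
        have : (i + 1 + 1) * (E ^ 3 * (1060 * B ^ 3 + τ) + 30) =
          (i + 1) * (E ^ 3 * (1060 * B ^ 3 + τ) + 30) + (E ^ 3 * (1060 * B ^ 3 + τ) + 30) := by ring
        omega)

end Vertices

end LispProgram

/-! ### Number and length of the lists in the search -/

namespace Digraph

/-- Concatenation may repeat vertices, so lengths can exceed n, but they at most double in a round.
-/
theorem length_mem_search_le {α : Type*} (T : Digraph α) [DecidableRel T.Adj]
    {F : List α → List α} {S : List α} {n : ℕ} (hS : S.length ≤ n) (hF : ∀ X, (F X).length ≤ n)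
    {k : ℕ} {X : List α} (hX : X ∈ T.search F S k) : X.length + 1 ≤ 2 ^ k * (n + 1) := by
  induction k generalizing X with
  | zero =>
    simp only [search, Function.iterate_zero, id_eq, List.mem_tails] at hX
    have := hX.length_le
    omega
  | succ k ih =>
    rw [search, Function.iterate_succ_apply'] at hX
    simp only [searchRound, List.mem_flatMap] at hX
    obtain ⟨X', hX', Y, hY, W, hW, hZ⟩ := hX
    have h1 := ih hX'
    have h2 := ih hY
    have h3 : 2 ^ (k + 1) * (n + 1) = 2 ^ k * (n + 1) + 2 ^ k * (n + 1) := by ring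
    have h4 : n + 1 ≤ 2 ^ k * (n + 1) := Nat.le_mul_of_pos_left _ (by positivity)
    simp only [derived, List.mem_cons, List.not_mem_nil, or_false] at hZ
    rcases hZ with rfl | rfl | rfl | rfl | rfl | rfl | rfl
    · omega
    · rw [List.length_append]; omega
    · rw [List.length_take]; omega
    · rw [List.length_drop]; omega
    · have : (T.manyOut X' Y W).length ≤ X'.length := List.length_filter_le _ _
      omega
    · have : (T.manyIn X' Y W).length ≤ X'.length := List.length_filter_le _ _
      omega
    · have := hF X'
      omega

/-- A round turns x lists into 7x³. With y ≥ 8 the bound 7y³ + 1 ≤ y⁴ allows a fourth power per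
round. -/
theorem length_search_le {α : Type*} (T : Digraph α) [DecidableRel T.Adj]
    (F : List α → List α) {S : List α} {n : ℕ} (hS : S.length ≤ n) (k : ℕ) :
    (T.search F S k).length + 1 ≤ (n + 8) ^ 4 ^ k := by
  induction k with
  | zero => simp [search]; omega
  | succ k ih =>
    have h1 : (T.search F S (k + 1)).length =
        (T.search F S k).length * ((T.search F S k).length * ((T.search F S k).length * 7)) := by
      rw [search, Function.iterate_succ_apply', ← search]
      simp [searchRound, derived, List.length_flatMap]
    have h2 : 8 ≤ (n + 8) ^ 4 ^ k :=
      le_trans (by omega) (Nat.le_self_pow (by positivity) (n + 8))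
    set x := (T.search F S k).length
    rw [h1, pow_succ 4, pow_mul]
    set y := (n + 8) ^ 4 ^ k
    have h4 : x * (x * (x * 7)) ≤ 7 * y ^ 3 := by
      calc x * (x * (x * 7)) ≤ y * (y * (y * 7)) := by gcongr <;> omega
        _ = 7 * y ^ 3 := by ring
    have h5 : 1 ≤ y ^ 3 := Nat.one_le_pow _ _ (by omega)
    calc x * (x * (x * 7)) + 1 ≤ 8 * y ^ 3 := by omega
      _ ≤ y * y ^ 3 := Nat.mul_le_mul_right _ h2
      _ = y ^ 4 := by ring

end Digraph

/-! ### Total running time -/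

namespace LispProgram

open LispEvalWithin SExp

section Main

variable {n : ℕ} (T : Digraph (Fin n)) [DecidableRel T.Adj] (K : ℕ)

/-- A bound on the running time of the search without its recursive calls. -/
def searchTime (K n : ℕ) : ℕ :=
  1500 * (K + 1) * ((n + 8) ^ 4 ^ K) ^ 3 * (2 ^ K * (n + 1)) ^ 3

theorem le_searchTime (K n : ℕ) : 1500 * (2 ^ K * (n + 1)) ^ 3 ≤ searchTime K n := by
  have h1 : 1 ≤ (K + 1) * ((n + 8) ^ 4 ^ K) ^ 3 := Nat.succ_le_of_lt (by positivity)
  calc 1500 * (2 ^ K * (n + 1)) ^ 3 = 1500 * 1 * (2 ^ K * (n + 1)) ^ 3 := by ring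
    _ ≤ 1500 * ((K + 1) * ((n + 8) ^ 4 ^ K) ^ 3) * (2 ^ K * (n + 1)) ^ 3 := by gcongr
    _ = searchTime K n := by rw [searchTime]; ring

theorem eval_ofNat {P : LispProgram} {env : List SExp} (i : ℕ) :
    LispEvalWithin P env (LispExp.ofNat i) (ofNat i) (2 * i + 1) := by
  induction i with
  | zero => exact nil
  | succ i ih => exact (cons nil ih).mono (by omega)

theorem length_findChain_le (hT : T.IsTournament) (S : List (Fin n)) :
    (T.findChain K S).length ≤ n := by
  have h : (T.findChain K S).Nodup := (T.pairwise_findChain K S).imp hT.ne_of_adj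
  simpa using h.length_le_card

/-- With Q = `searchTime K n`, the recursive calls at one level cost at most Q·τ and the remaining
work at most Q, where τ bounds one call on half the length. So each of the d+1 levels contributes a
factor 2Q. -/
theorem runs_find (hT : T.IsTournament) (d : ℕ) {S : List (Fin n)} (hS : S.length ≤ n)
    (hd : S.length < 2 ^ (d + 1)) :
    (colouringProgram K).Runs 25 (encList T S) (encList T (T.findChain K S))
      ((2 * searchTime K n) ^ (d + 1)) := by
  set B := 2 ^ K * (n + 1) with hB
  set E := (n + 8) ^ 4 ^ K with hE
  set Q := searchTime K n with hQ
  have hBn : n + 1 ≤ B := Nat.le_mul_of_pos_left _ (by positivity)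
  have hB1 : 1 ≤ B := by omega
  have hB3 : B ≤ B ^ 3 := Nat.le_self_pow (by norm_num) B
  have hQB : 1500 * B ^ 3 ≤ Q := le_searchTime K n
  have hshort : ∀ (d : ℕ) (S : List (Fin n)), S.length ≤ 1 →
      (colouringProgram K).Runs 25 (encList T S) (encList T (T.findChain K S))
        ((2 * Q) ^ (d + 1)) := by
    intro d S hS
    have h10 : 10 ≤ (2 * Q) ^ (d + 1) :=
      le_trans (by omega) (Nat.le_self_pow (by omega) (2 * Q))
    rw [Digraph.findChain, dif_pos hS]
    match S, hS with
    | [], _ =>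
      exact Runs.of_body (e := LispExp.findBody K) rfl (ite_nil var0 var0) rfl (by omega)
    | [a], _ =>
      exact Runs.of_body (e := LispExp.findBody K) rfl (ite_cons var0 (ite_nil (tail var0) var0))
        rfl (by omega)
  induction d generalizing S with
  | zero => exact hshort 0 S (by omega)
  | succ d ih =>
    by_cases hS1 : S.length ≤ 1
    · exact hshort (d + 1) S hS1
    · set m := S.length / 2 with hm
      set F : List (Fin n) → List (Fin n) := fun X => T.findChain K (X.take m) with hFdef
      set τ := (2 * Q) ^ (d + 1) with hτ
      have hF : ∀ X : List (Fin n),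
          (colouringProgram K).Runs 25 (encList T (X.take m)) (encList T (F X)) τ := fun X =>
        ih (by rw [List.length_take]; omega) (by
          rw [List.length_take]
          have : 2 ^ (d + 1 + 1) = 2 ^ (d + 1) * 2 := pow_succ _ _
          omega)
      have hlen : ∀ j ≤ K, ∀ X ∈ T.search F S j, X.length + 1 ≤ B := fun j hj X hX =>
        (T.length_mem_search_le hS (fun X => length_findChain_le T K hT _) hX).trans
          (Nat.mul_le_mul_right _ (Nat.pow_le_pow_right (by norm_num) hj))
      have hcard : ∀ j ≤ K, (T.search F S j).length + 1 ≤ E := fun j hj =>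
        (T.length_search_le F hS j).trans
          (Nat.pow_le_pow_right (by omega) (Nat.pow_le_pow_right (by norm_num) hj))
      have h1 := runs_half K (S.map (encVertex T))
      have h2 := runs_tails K (S.map (encVertex T))
      have h3 := runs_rounds T K hBn (m := m) (by omega) hlen hcard (fun X _ => hF X) K 0 (zero_add K)
      have h4 := runs_longest T K hBn (hlen K le_rfl)
      have htails : (S.map (encVertex T)).tails.map ofList =
          (T.search F S 0).map (encList T) := by
        rw [List.map_tails, List.map_map]
        rfl
      rw [htails, List.length_map] at h2
      rw [List.length_map] at h1
      have hfind : T.findChain K S = T.longestChain (T.search F S K) := by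
        rw [Digraph.findChain, dif_neg hS1]
      rw [hfind]
      have hS2 : ∃ a b l, S = a :: b :: l := by
        match S, hS1 with
        | [], h => simp at h
        | [a], h => simp at h
        | a :: b :: l, _ => exact ⟨a, b, l, rfl⟩
      have hbody : LispEvalWithin (colouringProgram K) [encList T S] (LispExp.findBody K)
          (encList T (T.longestChain (T.search F S K)))
          (20 * (S.length + 1) + 20 * (S.length + 1) + 2 * K +
            (K + 1) * (E ^ 3 * (1060 * B ^ 3 + τ) + 30) +
            ((T.search F S K).length + 1) * (160 * B ^ 3) + 30) := by
        have h6 := call (env := [encList T S]) (call (cons (eval_ofNat K) (cons (call var0 h1) (call var0 h2))) h3) h4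
        obtain ⟨a, b, l, hab⟩ := hS2
        have h7 : LispEvalWithin (colouringProgram K) [encList T S] LispExp.arg
            (.cons (encVertex T a) (.cons (encVertex T b) (encList T l))) 1 := by
          rw [hab]; exact var0
        exact (ite_cons h7 (ite_cons (tail h7) h6)).mono (by omega)
      refine Runs.of_body (e := LispExp.findBody K) rfl hbody rfl ?_
      have hE1 : 1 ≤ E ^ 3 := Nat.one_le_pow _ _ (by positivity)
      have hEK : 1 ≤ (K + 1) * E ^ 3 := by nlinarith
      have hB31 : 1 ≤ B ^ 3 := by omega
      have hKEB : (K + 1) * E ^ 3 * B ^ 3 * 1500 = Q := by rw [hQ, searchTime]; ring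
      have hx : B ^ 3 ≤ (K + 1) * E ^ 3 * B ^ 3 := Nat.le_mul_of_pos_left _ hEK
      have hy : (K + 1) ≤ (K + 1) * E ^ 3 * B ^ 3 := by
        rw [mul_assoc]; exact Nat.le_mul_of_pos_right _ (by positivity)
      have hz : ((T.search F S K).length + 1) * (160 * B ^ 3) ≤ 160 * ((K + 1) * E ^ 3 * B ^ 3) := by
        have hE2 : (T.search F S K).length + 1 ≤ E ^ 3 :=
          (hcard K le_rfl).trans (Nat.le_self_pow (by norm_num) E)
        calc _ ≤ E ^ 3 * (160 * B ^ 3) := Nat.mul_le_mul_right _ hE2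
          _ = 160 * (1 * E ^ 3 * B ^ 3) := by ring
          _ ≤ _ := by gcongr; omega
      have hw : (K + 1) * (E ^ 3 * (1060 * B ^ 3 + τ) + 30) =
          1060 * ((K + 1) * E ^ 3 * B ^ 3) + (K + 1) * E ^ 3 * τ + 30 * (K + 1) := by ring
      have hv : (K + 1) * E ^ 3 * τ ≤ Q * τ := by
        refine Nat.mul_le_mul_right _ ?_
        rw [← hKEB]
        nlinarith
      have hτ1 : 1 ≤ τ := Nat.one_le_pow _ _ (by omega)
      have hQτ : Q ≤ Q * τ := Nat.le_mul_of_pos_right _ hτ1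
      have hgoal : (2 * Q) ^ (d + 1 + 1) = Q * τ + Q * τ := by rw [pow_succ, ← hτ]; ring
      rw [hgoal, hw]
      omega

theorem runs_mem {B : ℕ} (hB : n + 1 ≤ B) (v : Fin n) (X : List (Fin n)) :
    (colouringProgram K).Runs 26 (.cons (encVertex T v) (encList T X)) (ofBool (decide (v ∈ X)))
      ((X.length + 1) * (80 * B)) := by
  induction X with
  | nil =>
    exact Runs.of_body (e := LispExp.memBody) rfl (ite_nil (tail var0) nil) (by simp [ofBool])
      (by simp; omega)
  | cons w X ih =>
    have h1 := runs_le K (List.replicate v .nil) (List.replicate w .nil)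
    have h2 := runs_le K (List.replicate w .nil) (List.replicate v .nil)
    rw [List.length_replicate, List.length_replicate] at h1 h2
    have ht : ((w :: X).length + 1) * (80 * B) = (X.length + 1) * (80 * B) + 80 * B := by
      rw [List.length_cons]; ring
    rw [ht]
    have hv := v.2
    have hw := w.2
    by_cases hle : (v : ℕ) ≤ w
    · rw [decide_eq_true hle] at h1
      by_cases hge : (w : ℕ) ≤ v
      · rw [decide_eq_true hge] at h2
        have hvw : v = w := Fin.ext (le_antisymm hle hge)
        exact Runs.of_body (e := LispExp.memBody) rfl (ite_cons (tail var0) (ite_cons (ite_cons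
          (call (cons (head (head var0)) (head (head (tail var0)))) h1)
          (call (cons (head (head (tail var0))) (head (head var0))) h2)) (cons nil nil)))
          (by simp [hvw, ofBool]) (by omega)
      · rw [decide_eq_false hge] at h2
        have hvw : v ≠ w := by rintro rfl; exact hge le_rfl
        exact Runs.of_body (e := LispExp.memBody) rfl (ite_cons (tail var0) (ite_nil (ite_cons
          (call (cons (head (head var0)) (head (head (tail var0)))) h1)
          (call (cons (head (head (tail var0))) (head (head var0))) h2))
          (call (cons (head var0) (tail (tail var0))) ih)))
          (by simp [hvw]) (by omega)
    · rw [decide_eq_false hle] at h1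
      have hvw : v ≠ w := by rintro rfl; exact hle le_rfl
      exact Runs.of_body (e := LispExp.memBody) rfl (ite_cons (tail var0) (ite_nil (ite_nil
        (call (cons (head (head var0)) (head (head (tail var0)))) h1) nil)
        (call (cons (head var0) (tail (tail var0))) ih)))
        (by simp [hvw]) (by omega)

theorem runs_minus {B : ℕ} (hB : n + 1 ≤ B) {X R : List (Fin n)} (hX : X.length + 1 ≤ B)
    (hR : R.length + 1 ≤ B) :
    (colouringProgram K).Runs 28 (.cons (encList T X) (encList T R))
      (encList T (R.filter fun v => v ∉ X)) (120 * B ^ 3) := by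
  have hB1 : 1 ≤ B := by omega
  have hpred : ∀ v, (colouringProgram K).Runs 27 (.cons (encList T X) (encVertex T v))
      (ofBool (decide (v ∉ X))) (90 * B ^ 2) := by
    intro v
    have h1 := (runs_mem T K hB v X).mono (t' := 80 * B ^ 2)
      (by calc _ ≤ B * (80 * B) := Nat.mul_le_mul_right _ hX
            _ = 80 * B ^ 2 := by ring)
    have h2 : 1 ≤ B ^ 2 := Nat.one_le_pow _ _ hB1
    by_cases hv : v ∈ X
    · rw [decide_eq_true hv] at h1
      exact Runs.of_body (e := LispExp.notMemBody) rfl (ite_cons (call (cons (tail var0)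
        (head var0)) h1) nil) (by simp [hv, ofBool]) (by omega)
    · rw [decide_eq_false hv] at h1
      exact Runs.of_body (e := LispExp.notMemBody) rfl (ite_nil (call (cons (tail var0)
        (head var0)) h1) (cons nil nil)) (by simp [hv, ofBool]) (by omega)
  refine (runs_filter (encVertex T) rfl _ R fun a _ => hpred a).mono ?_
  calc _ ≤ B * (90 * B ^ 2 + 30 * B ^ 2) := by gcongr; nlinarith
    _ = 120 * B ^ 3 := by ring

/-- Only the length of `w` matters, as a unary counter; the main function passes the list of all
vertices, and n repetitions suffice. -/
theorem runs_cover (hT : T.IsTournament) {B τ : ℕ} (hB : n + 1 ≤ B)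
    (hfind : ∀ R : List (Fin n), R.length ≤ n →
      (colouringProgram K).Runs 25 (encList T R) (encList T (T.findChain K R)) τ)
    (w : List SExp) {R : List (Fin n)} (hR : R.length ≤ n) :
    (colouringProgram K).Runs 29 (.cons (ofList w) (encList T R))
      (encFamily T (T.chainCover K w.length R)) ((w.length + 1) * (τ + 120 * B ^ 3 + 30)) := by
  induction w generalizing R with
  | nil =>
    exact Runs.of_body (e := LispExp.coverBody) rfl (ite_nil (head var0) nil) rfl (by simp)
  | cons x w ih =>
    have ht : ((x :: w).length + 1) * (τ + 120 * B ^ 3 + 30) =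
        (w.length + 1) * (τ + 120 * B ^ 3 + 30) + (τ + 120 * B ^ 3 + 30) := by
      rw [List.length_cons]; ring
    rw [ht]
    by_cases hR0 : R = []
    · subst hR0
      exact Runs.of_body (e := LispExp.coverBody) rfl (ite_cons (head var0)
        (ite_nil (tail var0) nil)) (by simp [Digraph.chainCover, encFamily, ofList]) (by omega)
    · have h1 := hfind R hR
      have h2 := runs_minus T K hB (X := T.findChain K R) (R := R)
        (by have := length_findChain_le T K hT R; omega) (by omega)
      have h3 := ih (R := R.filter fun v => v ∉ T.findChain K R)
        ((List.length_filter_le _ _).trans hR)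
      obtain ⟨v, R', rfl⟩ := List.exists_cons_of_ne_nil hR0
      exact Runs.of_body (e := LispExp.coverBody) rfl (ite_cons (head var0)
        (ite_cons (tail var0) (letE (call (tail var0) h1) (cons var0 (call (cons (tail (head var1))
        (call (cons var0 (tail var1)) h2)) h3)))))
        (by rw [List.length_cons, Digraph.chainCover, if_neg hR0]; rfl) (by omega)

theorem runs_color {B : ℕ} (hB : n + 1 ≤ B) {L : List (List (Fin n))}
    (hL : ∀ X ∈ L, X.length + 1 ≤ B) (v : Fin n) :
    (colouringProgram K).Runs 30 (.cons (encFamily T L) (encVertex T v))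
      (ofNat (L.findIdx fun X => v ∈ X)) ((L.length + 1) * (100 * B ^ 2)) := by
  have hB1 : 1 ≤ B ^ 2 := Nat.one_le_pow _ _ (by omega)
  induction L with
  | nil =>
    exact Runs.of_body (e := LispExp.colorBody) rfl (ite_nil (head var0) nil) rfl (by simp; omega)
  | cons X L ih =>
    have ht : ((X :: L).length + 1) * (100 * B ^ 2) =
        (L.length + 1) * (100 * B ^ 2) + 100 * B ^ 2 := by rw [List.length_cons]; ring
    have h1 := (runs_mem T K hB v X).mono (t' := 80 * B ^ 2)
      (by calc _ ≤ B * (80 * B) := Nat.mul_le_mul_right _ (hL X List.mem_cons_self)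
            _ = 80 * B ^ 2 := by ring)
    have h2 := ih fun Y hY => hL Y (List.mem_cons_of_mem _ hY)
    rw [ht, List.findIdx_cons]
    by_cases hv : v ∈ X
    · rw [decide_eq_true hv] at h1
      exact Runs.of_body (e := LispExp.colorBody) rfl (ite_cons (head var0) (ite_cons
        (call (cons (tail var0) (head (head var0))) h1) nil)) (by simp [hv, ofNat, ofList])
        (by omega)
    · rw [decide_eq_false hv] at h1
      exact Runs.of_body (e := LispExp.colorBody) rfl (ite_cons (head var0) (ite_nil
        (call (cons (tail var0) (head (head var0))) h1)
        (cons nil (call (cons (tail (head var0)) (tail var0)) h2))))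
        (by simp [hv, ofNat, ofList, List.replicate_succ]) (by omega)

theorem runs_number (i : ℕ) (l : List SExp) :
    (colouringProgram K).Runs 32 (.cons (ofNat i) (ofList l))
      (ofList ((l.zipIdx i).map fun p => .cons (ofNat p.2) p.1)) (20 * (l.length + 1)) := by
  induction l generalizing i with
  | nil => exact Runs.of_body (e := LispExp.numberBody) rfl (ite_nil (tail var0) nil) rfl (by simp)
  | cons x l ih =>
    exact Runs.of_body (e := LispExp.numberBody) rfl (ite_cons (tail var0) (cons (cons (head var0)
      (head (tail var0))) (call (cons (cons nil (head var0)) (tail (tail var0))) (ih (i + 1)))))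
      rfl (by simp; omega)

theorem length_chainCover_le_arg (m : ℕ) (R : List (Fin n)) :
    (T.chainCover K m R).length ≤ m := by
  induction m generalizing R with
  | zero => simp [Digraph.chainCover]
  | succ m ih =>
    rw [Digraph.chainCover]
    split_ifs
    · simp
    · simpa using ih _

theorem length_le_of_mem_chainCover (hT : T.IsTournament) {m : ℕ} {R X : List (Fin n)}
    (h : X ∈ T.chainCover K m R) : X.length ≤ n := by
  have h : X.Nodup := (T.pairwise_of_mem_chainCover h).imp hT.ne_of_adj
  simpa using h.length_le_card

/-- The colouring program colours every vertex by the index of the first transitive set of the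
greedy cover that contains it. -/
theorem outputs_colouringProgram (hT : T.IsTournament) :
    ∃ s ≤ (2 * searchTime K n) ^ (Nat.log 2 n + 2), (colouringProgram K).Outputs
      (ofList (List.ofFn fun i => ofList (List.ofFn fun j => ofBool (decide (T.Adj i j)))))
      (ofList (List.ofFn fun v : Fin n =>
        ofNat ((T.chainCover K n (List.finRange n)).findIdx fun X => v ∈ X))) s := by
  set B := 2 ^ K * (n + 1) with hB
  set Q := searchTime K n with hQ
  set τ := (2 * Q) ^ (Nat.log 2 n + 1) with hτ
  set L := T.chainCover K n (List.finRange n) with hL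
  have hBn : n + 1 ≤ B := Nat.le_mul_of_pos_left _ (by positivity)
  have hQB : 1500 * B ^ 3 ≤ Q := le_searchTime K n
  have h1 := runs_number K 0
    (List.ofFn fun i => ofList (List.ofFn fun j => ofBool (decide (T.Adj i j))))
  -- Numbering the rows of the adjacency matrix yields exactly the representation of vertices by
  -- number and row.
  have hV : (((List.ofFn fun i => ofList (List.ofFn fun j => ofBool (decide (T.Adj i j)))).zipIdx
      0).map fun p => SExp.cons (ofNat p.2) p.1) = (List.finRange n).map (encVertex T) := by
    apply List.ext_getElem
    · simp
    · intro i h1 h2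
      simp [encVertex]
  rw [hV, List.length_ofFn] at h1
  have h2 := runs_cover T K hT hBn (fun R hR => runs_find T K hT (Nat.log 2 n) hR
    (lt_of_le_of_lt hR (Nat.lt_pow_succ_log_self (by norm_num) n)))
    ((List.finRange n).map (encVertex T)) (R := List.finRange n) (by simp)
  rw [List.length_map, List.length_finRange, ← hτ, ← hL] at h2
  have h3 := runs_map (P := colouringProgram K) (f := 31) (g := 30) (encVertex T)
    (env := encFamily T L) rfl (fun v => ofNat (L.findIdx fun X => v ∈ X)) (List.finRange n)
    (fun v _ => (runs_color T K hBn (fun X hX =>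
      (Nat.succ_le_succ (length_le_of_mem_chainCover T K hT hX)).trans hBn) v).mono
      (t' := 100 * B ^ 3) (by
        have : L.length + 1 ≤ B :=
          (Nat.succ_le_succ (length_chainCover_le_arg T K n (List.finRange n))).trans hBn
        calc _ ≤ B * (100 * B ^ 2) := Nat.mul_le_mul_right _ this
          _ = 100 * B ^ 3 := by ring))
  rw [List.length_finRange] at h3
  have hbody := letE (P := colouringProgram K) (env := [_]) (call (cons nil var0) h1)
    (letE (call (cons var0 var0) h2) (call (cons var0 var1) h3))
  rw [List.ofFn_eq_map (f := fun v : Fin n => ofNat (L.findIdx fun X => v ∈ X))]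
  refine hbody.mono ?_
  have hB1 : 1 ≤ B := by omega
  have hB3 : B ≤ B ^ 3 := Nat.le_self_pow (by norm_num) B
  have hτ1 : 1 ≤ τ := Nat.one_le_pow _ _ (by omega)
  have hgoal : (2 * Q) ^ (Nat.log 2 n + 2) = Q * τ + Q * τ := by rw [pow_succ, ← hτ]; ring
  have h4 : (n + 1) * (τ + 120 * B ^ 3 + 30) ≤ Q * τ := by
    calc (n + 1) * (τ + 120 * B ^ 3 + 30) ≤ B * (τ + 120 * B ^ 3 + 30) :=
          Nat.mul_le_mul_right _ hBn
      _ ≤ Q * τ := by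
        have hQτ : Q ≤ τ := le_trans (by omega) (Nat.le_self_pow (by omega) (2 * Q))
        have h5 : 120 * B ^ 3 + 30 ≤ τ := by omega
        have h6 : 2 * B ≤ Q := by omega
        nlinarith [Nat.mul_le_mul_left B h5, Nat.mul_le_mul_right τ h6]
  have h5 : (n + 1) * (100 * B ^ 3 + 30) + 20 * (n + 1) + 20 ≤ Q * τ := by
    have hQτ : 2 * Q ≤ τ := Nat.le_self_pow (by omega) (2 * Q)
    have h6 : 100 * B ^ 3 + 70 ≤ τ := by omega
    have h7 : (n + 1) * (100 * B ^ 3 + 70) ≤ Q * τ := Nat.mul_le_mul (by omega) h6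
    nlinarith
  rw [hgoal]
  omega

end Main

/-- For fixed `K` the base is polynomial in n, at most 2^(cu) with u = log₂ n + 1 (logarithm rounded
down). The exponent u + 1 makes the total at most 2^(2cu²). -/
theorem isQuasipolynomial_searchTime (K : ℕ) :
    IsQuasipolynomial fun n => (2 * searchTime K n) ^ (Nat.log 2 n + 2) := by
  set c := 15 + 6 * K + 12 * 4 ^ K with hc
  refine ⟨2 * c, fun n => ?_⟩
  set u := Nat.log 2 n + 1 with hu
  have hn : n < 2 ^ u := Nat.lt_pow_succ_log_self (by norm_num) n
  have hu1 : 1 ≤ u := by omega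
  have h2u : 2 ≤ 2 ^ u := Nat.le_self_pow (by omega) 2
  have h8 : n + 8 ≤ 2 ^ (4 * u) := by
    have : 2 ^ (4 * u) = 2 ^ (3 * u) * 2 ^ u := by rw [← pow_add]; congr 1; ring
    have h3 : 8 ≤ 2 ^ (3 * u) := by
      calc 8 = 2 ^ 3 := by norm_num
        _ ≤ 2 ^ (3 * u) := Nat.pow_le_pow_right (by norm_num) (by omega)
    rw [this]
    nlinarith
  have hK : 2 * (1500 * (K + 1)) ≤ 2 ^ (12 + K) := by
    have : K + 1 ≤ 2 ^ K := Nat.lt_two_pow_self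
    rw [pow_add]
    omega
  have hle : 2 * searchTime K n ≤ 2 ^ (c * u) := by
    calc 2 * searchTime K n
        = 2 * (1500 * (K + 1)) * ((n + 8) ^ 4 ^ K) ^ 3 * (2 ^ K * (n + 1)) ^ 3 := by
          rw [searchTime]; ring
      _ ≤ 2 ^ (12 + K) * ((2 ^ (4 * u)) ^ 4 ^ K) ^ 3 * (2 ^ K * 2 ^ u) ^ 3 := by
          gcongr
          omega
      _ = 2 ^ (12 + K + 4 * u * 4 ^ K * 3 + (K + u) * 3) := by
          simp only [← pow_mul, ← pow_add]
      _ ≤ 2 ^ (c * u) := by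
          apply Nat.pow_le_pow_right (by norm_num)
          rw [hc]
          nlinarith [Nat.zero_le (K * (u - 1)), Nat.mul_le_mul_left K hu1]
  calc (2 * searchTime K n) ^ (Nat.log 2 n + 2) ≤ (2 ^ (c * u)) ^ (u + 1) :=
        Nat.pow_le_pow_left hle _
    _ = 2 ^ (c * u * (u + 1)) := by rw [← pow_mul]
    _ ≤ 2 ^ (2 * c * u ^ (2 * c)) := by
        apply Nat.pow_le_pow_right (by norm_num)
        have h1 : u ^ 2 ≤ u ^ (2 * c) := Nat.pow_le_pow_right hu1 (by omega)
        calc c * u * (u + 1) ≤ c * u * (2 * u) := Nat.mul_le_mul_left _ (by omega)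
          _ = 2 * c * u ^ 2 := by ring
          _ ≤ _ := Nat.mul_le_mul_left _ h1

end LispProgram

theorem theorem6 :
    ∃ C K : ℝ, 0 < C ∧ 0 < K ∧
      ∀ (V : Type*) [Fintype V] (H : Digraph V),
        2 ≤ Fintype.card V → H.IsPrime → H.IsGalaxy →
        ∃ (P : LispProgram) (t : ℕ → ℕ), IsQuasipolynomial t ∧
          ∀ (n : ℕ) (T : Digraph (Fin n)), T.IsTournament → T.IsFree H →
            ∃ (k : ℕ) (c : Fin n → Fin k),
              T.IsColoring c ∧
              (2 ≤ n → (k : ℝ) ≤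
                K * ((n : ℝ) ^
                    (1 - C / ((Fintype.card V : ℝ) ^ 5 * Real.log (Fintype.card V : ℝ))) *
                  Real.log (n : ℝ))) ∧
              ∃ s ≤ t n, P.Outputs (encodeDigraph T) (encodeColoring c) s := by
  classical
  -- The program and its time bound depend on `H` only through its number of vertices, which fixes
  -- the number of rounds.
  refine ⟨1 / 1000, 3, by norm_num, by norm_num, fun V _ H hV _ hH =>
    ⟨colouringProgram (Digraph.searchDepth (Fintype.card V)), _,
      LispProgram.isQuasipolynomial_searchTime
      (Digraph.searchDepth (Fintype.card V)), fun n T hT hfree => ?_⟩⟩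
  obtain ⟨k, c, hc, hk, hcolor⟩ := Digraph.exists_coloring hV hH hT hfree
  refine ⟨k, c, hc, hk, ?_⟩
  have h := LispProgram.outputs_colouringProgram T (Digraph.searchDepth (Fintype.card V)) hT
  simp only [← hcolor] at h
  unfold encodeDigraph encodeColoring
  convert h
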